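/- **Setting.** Let $d\ge 2$, $\varepsilon>0$, $\mu_\varepsilon:=\varepsilon^{-(d-1)}$, and let $\mathcal D^\varepsilon_N$ be the set of configurations $Z_N=(x_i,v_i)_{i\le N}\in(\mathbb T^d\times\mathbb R^d)^N$ with $|x_i-x_j|>\varepsilon$ for all $i\ne j$ ($\mathbb T^d$ the unit torus with its flat distance). For almost every $Z_N\in\mathcal D^\varepsilon_N$ let $t\mapsto \mathbf Z^\varepsilon_N(t)=(\mathbf z^\varepsilon_i(t))_{i\le N}$, $t\ge0$, be the hard-sphere dynamics (diameter $\varepsilon$, free transport between collisions, elastic reflection at collisions) started from $Z_N$. The grand canonical equilibrium measure $\mathbb P^{\rm eq}_\varepsilon$ on $\bigcup_{N\ge0}\mathcal D^\varepsilon_N$, with expectation $\mathbb E^{\rm eq}_\varepsilon$, has density $$\frac1{\mathcal Z^\varepsilon}\,\frac{\mu_\varepsilon^N}{N!}\,\mathbf 1_{\mathcal D^\varepsilon_N}(Z_N)\prod_{i=1}^N\mathcal M(v_i),\qquad \mathcal M(v)=(2\pi)^{-d/2}e^{-|v|^2/2},$$ on $N$-particle configurations, $\mathcal Z^\varepsilon$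 being the normalization. With $\mathcal N$ the number of particles, put $$\pi^\varepsilon_t(h)=\frac1{\mu_\varepsilon}\sum_{i=1}^{\mathcal N}h(\mathbf z^\varepsilon_i(t)),\qquad \zeta^{\varepsilon,\rm eq}_t(h)=\sqrt{\mu_\varepsilon}\,\big(\pi^\varepsilon_t(h)-\mathbb E^{\rm eq}_\varepsilon[\pi^\varepsilon_t(h)]\big).$$ **Conditioning.** Put $\gamma=4d$, $\mathbb V=|\log\varepsilon|$, $\delta=\varepsilon^{1-\frac1{2d}}$. Given $\tau>0$, $\Theta\ge1$, an integer $P\ge2$ and times $0\le\theta_1\le\dots\le\theta_P\le\Theta$, let $\Upsilon^\varepsilon$ be the set of admissible initial configurations such that for all $p\in\{2,\dots,P\}$ and all integers $k,r$ with $1\le k\le(\theta_p-\theta_{p-1})/\tau$ and $0\le r\le\tau/\delta$, the configuration at time $\theta_p-(k-1)\tau-r\delta$ has all velocities of norm at most $\mathbb V$, and every connected component of the graph joining particles at distance at most $3\sqrt\gamma\,\mathbb V\delta$ has at most $\gamma$ particles. Put $\mathbb E_\varepsilon[F]:=\mathbb E^{\rm eq}_\varepsilon[\mathbf 1_{\Upsilon^\varepsilon}F]$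 and $\zeta^{\varepsilon}_t(h)=\sqrt{\mu_\varepsilon}\,\big(\pi^\varepsilon_t(h)-\mathbb E_\varepsilon[\pi^\varepsilon_t(h)]\big)$, and, for $h^{(1)},\dots,h^{(P)}\in L^\infty(\mathbb T^d\times\mathbb R^d)$, $$I_P^{\varepsilon,\rm eq}=\mathbb E^{\rm eq}_\varepsilon\Big[\prod_{p=1}^P\zeta^{\varepsilon,\rm eq}_{\theta_p}(h^{(p)})\Big],\qquad I_P^{\varepsilon}=\mathbb E_\varepsilon\Big[\prod_{p=1}^P\zeta^{\varepsilon}_{\theta_p}(h^{(p)})\Big].$$ Below $\tau=\tau(\varepsilon)$ and $\Theta=\Theta(\varepsilon)$ are functions of $\varepsilon$ with $\tau>0$, $\Theta\ge1$ for $\varepsilon$ small, and limits are as $\varepsilon\to0^+$. **Proposition.** 1. For every real $p\ge1$ there is a constant $C_p>0$ depending only on $p$ such that the following holds for every $d\ge2$. (a) For all $\varepsilon$ small enough, all $h\in L^\infty(\mathbb T^d\times\mathbb R^d)$ and all $t\ge0$, $$\mathbb E^{\rm eq}_\varepsilon\big[|\zeta^{\varepsilon,\rm eq}_t(h)|^p\big]\le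 C_p\|h\|_\infty^p,\qquad\text{and, if $p$ is an integer,}\quad \big|\mathbb E^{\rm eq}_\varepsilon\big[\zeta^{\varepsilon,\rm eq}_t(h)^p\big]\big|\le C_p\|h\|_\infty^p .$$ (b) Let $P\ge2$ and assume $\delta/\tau\to0$, $\tau\to0$ and $\Theta=O(\log\log|\log\varepsilon|)$. Then for all $\varepsilon$ small enough, all $0\le\theta_1\le\dots\le\theta_P\le\Theta$, all $h\in L^\infty(\mathbb T^d\times\mathbb R^d)$ and all $t\ge0$, $$\mathbb E_\varepsilon\big[|\zeta^{\varepsilon}_t(h)|^p\big]\le C_p\|h\|_\infty^p,\qquad\text{and, if $p$ is an integer,}\quad \big|\mathbb E_\varepsilon\big[\zeta^{\varepsilon}_t(h)^p\big]\big|\le C_p\|h\|_\infty^p .$$ 2. For every $P\ge2$ there is a constant $C_P>0$ depending only on $P$ such that for every $d\ge2$, if $\Theta^{3(P-1)}\tau\to0$ and $\Theta/(\tau\log|\log\varepsilon|)\to0$, then for all $\varepsilon$ small enough, uniformly in $0\le\theta_1\le\dots\le\theta_P\le\Theta$ and in $h^{(1)},\dots,h^{(P)}\in L^\infty(\mathbb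 T^d\times\mathbb R^d)$, $$\big|I_P^{\varepsilon,\rm eq}-I_P^{\varepsilon}\big|\le\Big(\prod_{p=1}^P\|h^{(p)}\|_{L^\infty}\Big)\,C_P\,(\Theta\varepsilon^d)^{1/2}.$$ All the expectations above are of integrable functions. -/

import Mathlib

open MeasureTheory Filter Topology

noncomputable section

namespace HardSphere

/-- Phase space of one particle: position in the unit torus `𝕋^d`, velocity in `ℝ^d`. -/
abbrev Particle (d : ℕ) : Type := UnitAddTorus (Fin d) × EuclideanSpace ℝ (Fin d)

/-- Configurations `Z_N = (z_1, …, z_N)`. -/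
abbrev Config (d N : ℕ) : Type := Fin N → Particle d

/-- Configurations with an arbitrary number of particles (grand canonical phase space). -/
abbrev Phase (d : ℕ) : Type := Σ N : ℕ, Config d N

/-- The canonical projection `ℝ^d → 𝕋^d = ℝ^d / ℤ^d`. -/
def proj {d : ℕ} (y : EuclideanSpace ℝ (Fin d)) : UnitAddTorus (Fin d) :=
  fun k => ((y k : ℝ) : UnitAddCircle)

/-- The flat (Euclidean) distance `|x - y|` on `𝕋^d`. On each factor, `‖·‖` is the distance to
the nearest integer. -/
def torusDist {d : ℕ} (x y : UnitAddTorus (Fin d)) : ℝ :=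
  Real.sqrt (∑ k, ‖x k - y k‖ ^ 2)

/-- Admissible configurations `𝒟^ε_N`: the centers are at mutual distance larger than `ε`. -/
def admissible (d : ℕ) (ε : ℝ) (N : ℕ) : Set (Config d N) :=
  {Z | ∀ i j, i ≠ j → ε < torusDist (Z i).1 (Z j).1}

/-! ### Hard sphere dynamics -/

/-- Some pair of particles is at distance exactly `ε`. -/
def InContact {d N : ℕ} (ε : ℝ) (Z : Config d N) : Prop :=
  ∃ i j, i ≠ j ∧ torusDist (Z i).1 (Z j).1 = ε

/-- `Y : t ↦ Y t`, `t ≥ 0`, is a trajectory of `N` hard spheres of diameter `ε` (velocities are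
taken right continuous, i.e. `Y t` is the post-collisional configuration at a collision time `t`).
There are no multiple collisions and no accumulation of collision times. -/
structure IsTrajectory {d N : ℕ} (ε : ℝ) (Y : ℝ → Config d N) : Prop where
  /-- The spheres never overlap. -/
  exclusion : ∀ t, 0 ≤ t → ∀ i j, i ≠ j → ε ≤ torusDist (Y t i).1 (Y t j).1
  /-- Collision times do not accumulate. -/
  finite_contact : ∀ T : ℝ, {t | 0 ≤ t ∧ t ≤ T ∧ InContact ε (Y t)}.Finite
  /-- Positions move in straight lines between collisions. -/
  free_pos : ∀ s t, 0 ≤ s → s ≤ t → (∀ u, s < u → u < t → ¬ InContact ε (Y u)) →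
    ∀ i, (Y t i).1 = (Y s i).1 + proj ((t - s) • (Y s i).2)
  /-- Velocities are constant as long as there is no collision. -/
  free_vel : ∀ s t, 0 ≤ s → s ≤ t → (∀ u, s < u → u ≤ t → ¬ InContact ε (Y u)) →
    ∀ i, (Y t i).2 = (Y s i).2
  /-- At a collision time `t` exactly one pair `{i, j}` is in contact; with `n` the vector of
  length `ε` representing `x_i - x_j`, the velocities `v_i, v_j` just before `t` (those at a time
  `s < t` without collisions in between) are reflected, and the others do not change. -/
  collision : ∀ t, 0 < t → InContact ε (Y t) →
    ∃ i j, i ≠ j ∧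
      (∀ k l, k ≠ l → torusDist (Y t k).1 (Y t l).1 = ε → (k = i ∧ l = j) ∨ (k = j ∧ l = i)) ∧
      ∃ n : EuclideanSpace ℝ (Fin d), ‖n‖ = ε ∧ proj n = (Y t i).1 - (Y t j).1 ∧
        ∀ s, 0 ≤ s → s < t → (∀ u, s < u → u < t → ¬ InContact ε (Y u)) →
          (Y t i).2 = (Y s i).2 - (1 / ε ^ 2 * inner ℝ ((Y s i).2 - (Y s j).2) n) • n ∧
          (Y t j).2 = (Y s j).2 + (1 / ε ^ 2 * inner ℝ ((Y s i).2 - (Y s j).2) n) • n ∧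
          ∀ k, k ≠ i → k ≠ j → (Y t k).2 = (Y s k).2

open Classical in
/-- The configuration at time `t ≥ 0` of the hard spheres started from `Z`. For almost every
admissible `Z` there is a trajectory starting from `Z`, and it is then unique on `[0, ∞)`; on the
exceptional null set the value is irrelevant and set to `Z`. -/
def flow {d N : ℕ} (ε : ℝ) (Z : Config d N) (t : ℝ) : Config d N :=
  if h : ∃ Y : ℝ → Config d N, IsTrajectory ε Y ∧ Y 0 = Z then h.choose t else Z

/-! ### Equilibrium measure -/

/-- `μ_ε = ε^{-(d-1)}`. -/
def mu (d : ℕ) (ε : ℝ) : ℝ := (ε ^ (d - 1))⁻¹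

/-- The Maxwellian `ℳ(v) = (2π)^{-d/2} exp (-|v|²/2)`. -/
def maxwellian {d : ℕ} (v : EuclideanSpace ℝ (Fin d)) : ℝ :=
  1 / (2 * Real.pi) ^ ((d : ℝ) / 2) * Real.exp (-‖v‖ ^ 2 / 2)

/-- The measure `(μ_ε^N / N!) 1_{𝒟^ε_N}(Z_N) ℳ^{⊗N}(V_N) dZ_N`. -/
def weight (d : ℕ) (ε : ℝ) (N : ℕ) : Measure (Config d N) :=
  ENNReal.ofReal (mu d ε ^ N / (N.factorial : ℝ)) •
    ((volume.restrict (admissible d ε N)).withDensity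
      fun Z => ENNReal.ofReal (∏ i, maxwellian (Z i).2))

/-- The partition function `𝒵^ε`. -/
def partitionFunction (d : ℕ) (ε : ℝ) : ENNReal := ∑' N, weight d ε N Set.univ

/-- The grand canonical equilibrium measure (the law `ℙ^eq_ε` of the initial configuration). -/
def eqMeasure (d : ℕ) (ε : ℝ) : Measure (Phase d) :=
  (partitionFunction d ε)⁻¹ • Measure.sum fun N => (weight d ε N).map (Sigma.mk N)

/-! ### Conditioning -/

/-- The microscopic cluster of particle `i`: the particles connected to `i` by a chain of
particles with successive distances at most `r`. -/
def cluster {d N : ℕ} (r : ℝ) (Z : Config d N) (i : Fin N) : Set (Fin N) :=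
  {j | Relation.ReflTransGen (fun k l => torusDist (Z k).1 (Z l).1 ≤ r) i j}

/-- The microscopic time scale `δ = ε^{1 - 1/(2d)}`. -/
def delta (d : ℕ) (ε : ℝ) : ℝ := ε ^ (1 - 1 / (2 * (d : ℝ)))

/-- The energy cut-off `𝕍 = |log ε|`. -/
def cutoff (ε : ℝ) : ℝ := |Real.log ε|

/-- Velocities are at most `𝕍`, and all microscopic clusters, with interaction range
`3 √γ 𝕍 δ`, have size at most `γ = 4d`. -/
def Controlled {d N : ℕ} (ε : ℝ) (Z : Config d N) : Prop :=
  (∀ j, ‖(Z j).2‖ ≤ cutoff ε) ∧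
  ∀ j, (cluster (3 * Real.sqrt (4 * d) * cutoff ε * delta d ε) Z j).ncard ≤ 4 * d

/-- The set `Υ^ε` of initial configurations that are controlled at all the sampling times
`θ_p - (k-1) τ - r δ`. The times `θ_1, …, θ_P` are indexed by `Fin P`; `q` stands for `p - 1`. -/
def conditioning (d : ℕ) (ε τ : ℝ) {P : ℕ} (θ : Fin P → ℝ) : Set (Phase d) :=
  {Z | Z.2 ∈ admissible d ε Z.1 ∧
    ∀ p q : Fin P, (q : ℕ) + 1 = p →
      ∀ k : ℕ, 1 ≤ k → (k : ℝ) ≤ (θ p - θ q) / τ →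
        ∀ r : ℕ, (r : ℝ) ≤ τ / delta d ε →
          Controlled ε (flow ε Z.2 (θ p - ((k : ℝ) - 1) * τ - r * delta d ε))}

/-- The unnormalized conditioned measure `ℙ_ε(A) = ℙ^eq_ε(Υ^ε ∩ A)`. -/
def condMeasure (d : ℕ) (ε τ : ℝ) {P : ℕ} (θ : Fin P → ℝ) : Measure (Phase d) :=
  (eqMeasure d ε).restrict (conditioning d ε τ θ)

/-! ### Fluctuation fields -/

/-- The empirical density tested against `h`: `π^ε_t(h) = μ_ε⁻¹ ∑_i h(z_i(t))`. -/
def empirical {d : ℕ} (ε t : ℝ) (h : Particle d → ℝ) (Z : Phase d) : ℝ :=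
  1 / mu d ε * ∑ i, h (flow ε Z.2 t i)

/-- `√μ_ε (π^ε_t(h) - 𝔼[π^ε_t(h)])`, where `𝔼` is the integral against `m`. -/
def fluctuation {d : ℕ} (m : Measure (Phase d)) (ε t : ℝ) (h : Particle d → ℝ) (Z : Phase d) :
    ℝ :=
  Real.sqrt (mu d ε) * (empirical ε t h Z - ∫ Z', empirical ε t h Z' ∂m)

/-- The equilibrium fluctuation field `ζ^{ε,eq}_t(h)`. -/
def zetaEq {d : ℕ} (ε t : ℝ) (h : Particle d → ℝ) : Phase d → ℝ :=
  fluctuation (eqMeasure d ε) ε t h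

/-- The fluctuation field `ζ^ε_t(h)` under the conditioned measure. -/
def zetaCond {d : ℕ} (ε τ : ℝ) {P : ℕ} (θ : Fin P → ℝ) (t : ℝ) (h : Particle d → ℝ) :
    Phase d → ℝ :=
  fluctuation (condMeasure d ε τ θ) ε t h

/-- The `P`-point moment `I_P^{ε,eq}`. -/
def momentEq {d : ℕ} (ε : ℝ) {P : ℕ} (θ : Fin P → ℝ) (h : Fin P → Particle d → ℝ) : ℝ :=
  ∫ Z, ∏ p, zetaEq ε (θ p) (h p) Z ∂(eqMeasure d ε)

/-- The conditioned `P`-point moment `I_P^ε`. -/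
def momentCond {d : ℕ} (ε τ : ℝ) {P : ℕ} (θ : Fin P → ℝ) (h : Fin P → Particle d → ℝ) : ℝ :=
  ∫ Z, ∏ p, zetaCond ε τ θ (θ p) (h p) Z ∂(condMeasure d ε τ θ)

/-- The norm of `L^∞(𝕋^d × ℝ^d)` (Lebesgue measure). -/
def supNorm {d : ℕ} (h : Particle d → ℝ) : ℝ := (eLpNorm h ⊤ volume).toReal

end HardSphere

end

/-! Two facts carry the theorem. The equilibrium measure is invariant under the hard-sphere flow, so
everything about a single time reduces to time zero. At time zero it is a hard-core gas of low
density, whose linear statistics are subgaussian.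

Invariance (Alexander's theorem, `phaseFlow_eqMeasure`). On a shell of energy at most R², time is
cut into steps of length s = t / 2^n. If at most one pair of particles is within distance ε + 4Rs, a
step is free transport, possibly with a grazing contact, or contains a single genuine collision. The
collision acts on the relative motion by the scattering map, which is injective with Jacobian ±1
(`exists_hasFDerivAt_scatter`), so a step does not increase volume
(`volume_good_inter_preimage_step_le`). Two pairs are close simultaneously on a set of volume O(s²),
and t/s steps lose only O(s). In the limit, trajectories exist almost everywhere and the
push-forward of the volume of the shell is at most that volume; equality holds because the mass is
finite and conserved. Energy conservation then takes care of the Maxwellian factor.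

Statics. For S = ∑ h(z_i), the derivative of v ↦ log E[exp(vS)] is the mean of S in the gas with
weight exp(vh). By Mecke's formula, changing the weight at x changes this mean through h(x) and
through the effect of excluding the neighbours of x. That exclusion is itself a change of weight, of
L¹ size at most 1/2 when 6·2^d ε ≤ 1, so its effect is at most sup |h| by a contraction argument
(`abs_gasMean_insert_le`). Hence E[exp(u(S - m))] ≤ exp(4H²u²μ_ε) (`integral_exp_gas_le`), and u =
±1/(H√μ_ε) gives E[exp(|ζ|/H)] ≤ 2e⁴ for every H > 0 bounding |h| (`zetaEq_exp`). All moments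
follow; the dimension only decides how small ε must be.

Conditioning. By invariance and a union bound, the complement of Υ^ε costs at most 2P²Θ/δ times the
static probability of a fast particle or a large cluster. Mecke's inequality and the choices γ = 4d,
δ = ε^{1-1/(2d)} make the latter o(δ ε^d), so Υ^ε fails with probability at most b², where b =
(Θε^d)^{1/2} (`eventually_conditioning`).

Comparison. The two centrings differ by √μ_ε times the integral of the empirical density over the
complement of Υ^ε. Bounding |x| by b⁻¹ + b x² on that event, with the exponential moments, shows
that both this shift and the difference of the P-fold products are O(b) (`exists_zetaCond_eq`,
`abs_integral_prod_sub_le`). -/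

noncomputable section

namespace HardSphere

/-! ### Two-body scattering: reversibility and unit Jacobian. -/

section Scattering

variable {V : Type*} [NormedAddCommGroup V] [InnerProductSpace ℝ V]

/-- The discriminant of `t ↦ ‖x + t w‖² - ε²`. -/
def disc (ε : ℝ) (x w : V) : ℝ := (inner ℝ x w) ^ 2 - ‖w‖ ^ 2 * (‖x‖ ^ 2 - ε ^ 2)

/-- The time at which the line `x + t w` enters the ball of radius `ε`. -/
def entryTime (ε : ℝ) (x w : V) : ℝ := (-(inner ℝ x w) - Real.sqrt (disc ε x w)) / ‖w‖ ^ 2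

/-- The point at which the line `x + t w` enters the ball of radius `ε`. -/
def impact (ε : ℝ) (x w : V) : V := x + entryTime ε x w • w

/-- The reflection with respect to the hyperplane orthogonal to `y`, for `‖y‖ = ε`. -/
def reflect (ε : ℝ) (y u : V) : V := u - (2 / ε ^ 2 * inner ℝ y u) • y

/-- The scattering map of the ball of radius `ε`: the asymptotic incoming line `x + t w` is sent to
the asymptotic outgoing line. -/
def scatter (ε : ℝ) (p : V × V) : V × V :=
  (reflect ε (impact ε p.1 p.2) p.1 + (2 : ℝ) • impact ε p.1 p.2,
    reflect ε (impact ε p.1 p.2) p.2)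

lemma ne_zero_of_disc_pos {ε : ℝ} {x w : V} (h : 0 < disc ε x w) : w ≠ 0 := by
  rintro rfl
  simp [disc] at h

lemma norm_add_smul_sq (x w : V) (t : ℝ) :
    ‖x + t • w‖ ^ 2 = ‖x‖ ^ 2 + 2 * t * inner ℝ x w + t ^ 2 * ‖w‖ ^ 2 := by
  rw [norm_add_sq_real, inner_smul_right, norm_smul, mul_pow, Real.norm_eq_abs, sq_abs]
  ring

lemma inner_add_smul_right (x w : V) (t : ℝ) :
    inner ℝ (x + t • w) w = inner ℝ x w + t * ‖w‖ ^ 2 := by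
  rw [inner_add_left, real_inner_smul_left, real_inner_self_eq_norm_sq]

lemma inner_impact {ε : ℝ} {x w : V} (h : 0 < disc ε x w) :
    inner ℝ (impact ε x w) w = - Real.sqrt (disc ε x w) := by
  have hw : ‖w‖ ≠ 0 := norm_ne_zero_iff.2 (ne_zero_of_disc_pos h)
  rw [impact, inner_add_smul_right, entryTime]
  field_simp
  ring

lemma inner_impact_neg {ε : ℝ} {x w : V} (h : 0 < disc ε x w) :
    inner ℝ (impact ε x w) w < 0 := by
  rw [inner_impact h]
  have := Real.sqrt_pos.2 h
  linarith

lemma norm_impact_sq {ε : ℝ} {x w : V} (h : 0 < disc ε x w) : ‖impact ε x w‖ ^ 2 = ε ^ 2 := by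
  have hw : ‖w‖ ^ 2 ≠ 0 := by have := ne_zero_of_disc_pos h; positivity
  have hs := Real.sq_sqrt h.le
  set s := Real.sqrt (disc ε x w) with hsd
  have ht : entryTime ε x w * ‖w‖ ^ 2 = -(inner ℝ x w) - s := by
    rw [entryTime, div_mul_cancel₀ _ hw]
  have hd : disc ε x w = (inner ℝ x w) ^ 2 - ‖w‖ ^ 2 * (‖x‖ ^ 2 - ε ^ 2) := rfl
  rw [impact, norm_add_smul_sq]
  have : ‖w‖ ^ 2 * (‖x‖ ^ 2 + 2 * entryTime ε x w * inner ℝ x w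
      + entryTime ε x w ^ 2 * ‖w‖ ^ 2 - ε ^ 2) = 0 := by
    set t := entryTime ε x w
    set b : ℝ := inner ℝ x w
    have : t ^ 2 * ‖w‖ ^ 2 * ‖w‖ ^ 2 = (-b - s) ^ 2 := by rw [← ht]; ring
    have h2 : t * ‖w‖ ^ 2 * b = (-b - s) * b := by rw [ht]
    nlinarith
  have := (mul_eq_zero.1 this).resolve_left hw
  linarith

lemma norm_impact {ε : ℝ} (hε : 0 < ε) {x w : V} (h : 0 < disc ε x w) : ‖impact ε x w‖ = ε := by
  have := norm_impact_sq h
  exact (pow_left_inj₀ (norm_nonneg _) hε.le two_ne_zero).1 this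

/-- The entry time is the only time at which the sphere is crossed inwards. -/
lemma entryTime_eq {ε : ℝ} {x w : V} {t : ℝ} (h1 : ‖x + t • w‖ ^ 2 = ε ^ 2)
    (h2 : inner ℝ (x + t • w) w < 0) : 0 < disc ε x w ∧ entryTime ε x w = t := by
  rw [norm_add_smul_sq] at h1
  rw [inner_add_smul_right] at h2
  have hd : disc ε x w = (inner ℝ x w + t * ‖w‖ ^ 2) ^ 2 := by
    rw [disc, ← h1]; ring
  have hpos : 0 < disc ε x w := by rw [hd]; exact sq_pos_of_ne_zero h2.ne
  have hw : ‖w‖ ≠ 0 := norm_ne_zero_iff.2 (ne_zero_of_disc_pos hpos)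
  refine ⟨hpos, ?_⟩
  rw [entryTime, hd, Real.sqrt_sq_eq_abs, abs_of_neg h2]
  field_simp
  ring

lemma reflect_self {ε : ℝ} (hε : 0 < ε) {y : V} (hy : ‖y‖ = ε) : reflect ε y y = -y := by
  rw [reflect, real_inner_self_eq_norm_sq, hy, div_mul_cancel₀ _ (by positivity), two_smul]
  abel

lemma reflect_add (ε : ℝ) (y u v : V) : reflect ε y (u + v) = reflect ε y u + reflect ε y v := by
  simp only [reflect, inner_add_right, mul_add, add_smul]
  abel

lemma reflect_smul (ε : ℝ) (y : V) (r : ℝ) (u : V) :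
    reflect ε y (r • u) = r • reflect ε y u := by
  simp only [reflect, inner_smul_right, smul_sub, smul_smul]
  congr 2
  ring

lemma inner_reflect {ε : ℝ} (hε : 0 < ε) {y : V} (hy : ‖y‖ = ε) (u : V) :
    inner ℝ y (reflect ε y u) = - inner ℝ y u := by
  rw [reflect, inner_sub_right, inner_smul_right, real_inner_self_eq_norm_sq, hy]
  field_simp
  ring

lemma reflect_reflect {ε : ℝ} (hε : 0 < ε) {y : V} (hy : ‖y‖ = ε) (u : V) :
    reflect ε y (reflect ε y u) = u := by
  conv_lhs => rw [reflect, inner_reflect hε hy, reflect]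
  rw [mul_neg, neg_smul]
  abel

lemma norm_reflect {ε : ℝ} (hε : 0 < ε) {y : V} (hy : ‖y‖ = ε) (u : V) :
    ‖reflect ε y u‖ = ‖u‖ := by
  rw [← pow_left_inj₀ (norm_nonneg _) (norm_nonneg _) two_ne_zero]
  rw [reflect, norm_sub_sq_real, inner_smul_right, norm_smul, mul_pow, hy, Real.norm_eq_abs, sq_abs,
    real_inner_comm]
  field_simp
  ring

/-- After the collision, the relative position moves along the reflected velocity. -/
lemma scatter_add_smul {ε : ℝ} (hε : 0 < ε) {x w : V} (h : 0 < disc ε x w) (u : ℝ) :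
    (scatter ε (x, w)).1 + u • (scatter ε (x, w)).2 =
      impact ε x w + (u - entryTime ε x w) • reflect ε (impact ε x w) w := by
  have hy := norm_impact hε h
  have hx : x = impact ε x w + (-entryTime ε x w) • w := by rw [impact]; simp
  simp only [scatter]
  set y := impact ε x w
  set t := entryTime ε x w
  -- Reflecting x = y - t w gives -y - t w'; the term 2y in `scatter` corrects this to y - t w', the
  -- outgoing line read at time 0.
  rw [hx, reflect_add, reflect_self hε hy, reflect_smul, sub_smul, neg_smul, two_smul]
  abel

/-- Time reversal of the scattering. -/
lemma scatter_reverse {ε : ℝ} (hε : 0 < ε) {x w : V} (h : 0 < disc ε x w) :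
    scatter ε ((scatter ε (x, w)).1, -(scatter ε (x, w)).2) = (x, -w) := by
  have hy := norm_impact hε h
  have key := scatter_add_smul hε h
  have hin := inner_impact_neg h
  have hx : x = impact ε x w + (-entryTime ε x w) • w := by rw [impact]; simp
  set x' := (scatter ε (x, w)).1 with hx'
  set w' := (scatter ε (x, w)).2 with hw'
  have hwy : w' = reflect ε (impact ε x w) w := rfl
  set y := impact ε x w
  set t := entryTime ε x w
  have e1 : x' + (-t) • (-w') = y := by
    have := key t
    rw [sub_self, zero_smul, add_zero] at this
    rw [← this]; simp
  obtain ⟨hd, ht⟩ := entryTime_eq (ε := ε) (x := x') (w := -w') (t := -t) (by rw [e1, hy])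
    (by rw [e1, inner_neg_right, hwy, inner_reflect hε hy, neg_neg]; exact hin)
  have himp : impact ε x' (-w') = y := by rw [impact, ht, e1]
  have hxx : x' = y + (-t) • w' := by rw [← e1]; simp
  simp only [scatter, himp]
  rw [hxx, reflect_add, reflect_self hε hy, reflect_smul, hwy, reflect_reflect hε hy,
    ← neg_one_smul ℝ (reflect ε y w), reflect_smul, reflect_reflect hε hy]
  ext1
  · simp only [two_smul]
    conv_rhs => rw [hx]
    abel
  · simp

/-- Reversibility: reversing the outgoing velocity and scattering again recovers the incoming line.
-/
lemma scatter_injOn {ε : ℝ} (hε : 0 < ε) :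
    Set.InjOn (scatter ε) {p : V × V | 0 < disc ε p.1 p.2} := by
  rintro ⟨x, w⟩ h ⟨x', w'⟩ h' heq
  have h1 := scatter_reverse hε (show 0 < disc ε x w from h)
  have h2 := scatter_reverse hε (show 0 < disc ε x' w' from h')
  rw [heq, h2] at h1
  simp only [Prod.mk.injEq, neg_inj] at h1
  ext1
  · exact h1.1.symm
  · exact h1.2.symm

lemma isOpen_disc_pos (ε : ℝ) : IsOpen {p : V × V | 0 < disc ε p.1 p.2} := by
  apply isOpen_lt continuous_const
  unfold disc
  fun_prop

lemma differentiableAt_entryTime {ε : ℝ} {p : V × V} (h : 0 < disc ε p.1 p.2) :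
    DifferentiableAt ℝ (fun q : V × V => entryTime ε q.1 q.2) p := by
  have hw : ‖p.2‖ ^ 2 ≠ 0 := by have := ne_zero_of_disc_pos h; positivity
  have hb : DifferentiableAt ℝ (fun q : V × V => (inner ℝ q.1 q.2 : ℝ)) p :=
    differentiableAt_fst.inner ℝ differentiableAt_snd
  have h1 : DifferentiableAt ℝ (fun q : V × V => ‖q.1‖ ^ 2) p := differentiableAt_fst.norm_sq ℝ
  have h2 : DifferentiableAt ℝ (fun q : V × V => ‖q.2‖ ^ 2) p := differentiableAt_snd.norm_sq ℝ
  have hd : DifferentiableAt ℝ (fun q : V × V => disc ε q.1 q.2) p := by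
    unfold disc
    exact (hb.pow 2).sub (h2.mul (h1.sub_const _))
  unfold entryTime
  simp only [div_eq_mul_inv]
  have h3 : DifferentiableAt ℝ (fun q : V × V => (‖q.2‖ ^ 2)⁻¹) p := DifferentiableAt.fun_inv h2 hw
  exact (hb.neg.sub (hd.sqrt h.ne')).mul h3

/-- The derivative of the impact point is tangent to the sphere. -/
lemma exists_hasFDerivAt_impact {ε : ℝ} {p : V × V} (h : 0 < disc ε p.1 p.2) :
    ∃ t' : V × V →L[ℝ] ℝ,
      HasFDerivAt (fun q : V × V => impact ε q.1 q.2)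
        (ContinuousLinearMap.fst ℝ V V + (entryTime ε p.1 p.2 • ContinuousLinearMap.snd ℝ V V +
          t'.smulRight p.2)) p ∧
      ∀ δ : V × V, inner ℝ (impact ε p.1 p.2)
        (δ.1 + (entryTime ε p.1 p.2 • δ.2 + t' δ • p.2)) = 0 := by
  refine ⟨fderiv ℝ (fun q : V × V => entryTime ε q.1 q.2) p, ?_, ?_⟩
  · exact hasFDerivAt_fst.add ((differentiableAt_entryTime h).hasFDerivAt.smul hasFDerivAt_snd)
  · intro δ
    set t' := fderiv ℝ (fun q : V × V => entryTime ε q.1 q.2) p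
    have hd : HasFDerivAt (fun q : V × V => impact ε q.1 q.2)
        (ContinuousLinearMap.fst ℝ V V + (entryTime ε p.1 p.2 • ContinuousLinearMap.snd ℝ V V +
          t'.smulRight p.2)) p :=
      hasFDerivAt_fst.add ((differentiableAt_entryTime h).hasFDerivAt.smul hasFDerivAt_snd)
    have h1 := hd.norm_sq
    -- The impact point stays on the sphere near p, so its squared norm is locally constant;
    -- uniqueness of the derivative gives tangency.
    have h2 : HasFDerivAt (fun q : V × V => ‖impact ε q.1 q.2‖ ^ 2) (0 : V × V →L[ℝ] ℝ) p := by
      refine (hasFDerivAt_const (ε ^ 2) p).congr_of_eventuallyEq ?_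
      filter_upwards [(isOpen_disc_pos ε).mem_nhds h] with q hq
      exact norm_impact_sq hq
    have h3 := congrArg (fun L => L δ) (h1.unique h2)
    simp only [inner_add_right, inner_smul_right]
    simp [inner_smul_right] at h3
    linarith

/-- The derivative of the scattering map has this shape. An involution has determinant ±1; det (1 +
B) is the characteristic polynomial of the nilpotent map -B, a power of X, evaluated at 1. -/
lemma abs_det_eq_one_of_sq_zero {W : Type*} [AddCommGroup W] [Module ℝ W] [FiniteDimensional ℝ W]
    {A B : Module.End ℝ W} (hA : A * A = 1) (hB : B * B = 0) :
    |LinearMap.det (A * (1 + B))| = 1 := by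
  have h1 : |LinearMap.det A| = 1 := by
    have := congrArg LinearMap.det hA
    rw [map_mul, map_one] at this
    rcases mul_self_eq_one_iff.1 this with h | h <;> simp [h]
  have h2 : LinearMap.det (1 + B) = 1 := by
    have hn : IsNilpotent (-B) := ⟨2, by rw [pow_two, neg_mul_neg, hB]⟩
    have h3 := (LinearMap.charpoly_eq_X_pow_iff (-B)).2 fun m => by
      obtain ⟨n, hn⟩ := hn
      exact ⟨n, by rw [hn]; rfl⟩
    have h4 := LinearMap.eval_charpoly (-B) (1 : ℝ)
    rw [h3] at h4
    simp only [Polynomial.eval_pow, Polynomial.eval_X, one_pow, map_one, sub_neg_eq_add] at h4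
    exact h4.symm
  rw [map_mul, abs_mul, h1, h2]
  simp

/-- The scattering map has Jacobian `±1`. -/
lemma exists_hasFDerivAt_scatter [FiniteDimensional ℝ V] {ε : ℝ} (hε : 0 < ε) {p : V × V}
    (h : 0 < disc ε p.1 p.2) :
    ∃ D : V × V →L[ℝ] V × V, HasFDerivAt (scatter ε) D p ∧ |D.det| = 1 := by
  obtain ⟨t', hy', htan⟩ := exists_hasFDerivAt_impact h
  have hny := norm_impact hε h
  have hin := inner_impact_neg h
  have hyp : impact ε p.1 p.2 = p.1 + entryTime ε p.1 p.2 • p.2 := rfl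
  have hr : ∀ (f : V × V → V) (f' : V × V →L[ℝ] V), HasFDerivAt f f' p →
      HasFDerivAt (fun q : V × V => reflect ε (impact ε q.1 q.2) (f q)) _ p := fun f f' hf =>
    hf.sub (((hy'.inner ℝ hf).const_mul (2 / ε ^ 2)).smul hy')
  have hD := ((hr _ _ hasFDerivAt_fst).add (hy'.const_smul (2 : ℝ))).prodMk
    (hr _ _ hasFDerivAt_snd)
  refine ⟨_, hD, ?_⟩
  set y := impact ε p.1 p.2 with hydef
  set t := entryTime ε p.1 p.2
  set c : ℝ := 2 / ε ^ 2 with hc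
  have hcε : c * ε ^ 2 = 2 := by rw [hc]; field_simp
  have hyy : inner ℝ y y = ε ^ 2 := by rw [real_inner_self_eq_norm_sq, hny]
  let ρ : V →ₗ[ℝ] V :=
    { toFun := reflect ε y
      map_add' := reflect_add ε y
      map_smul' := reflect_smul ε y }
  have hρ : ∀ u, ρ u = u - (c * inner ℝ y u) • y := fun u => rfl
  -- The derivative factors as A (1 + L M). Here A reflects both components with the impact point
  -- frozen, M is the derivative of the impact point, and L, after reflection by A, is the response
  -- of the outgoing line to a displacement of the impact point. M takes tangent values and M L
  -- kills tangent vectors, so (L M)² = 0.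
  let A : Module.End ℝ (V × V) := ρ.prodMap ρ
  let M : V × V →ₗ[ℝ] V :=
    LinearMap.fst ℝ V V + (t • LinearMap.snd ℝ V V + (t' : V × V →ₗ[ℝ] ℝ).smulRight p.2)
  have hM : ∀ δ : V × V, M δ = δ.1 + (t • δ.2 + t' δ • p.2) := fun δ => rfl
  let k : V → V →ₗ[ℝ] V := fun u => ((innerₛₗ ℝ u).smulRight (c • y)) - (c * inner ℝ y u) • LinearMap.id
  have hk : ∀ u η, k u η = (inner ℝ u η : ℝ) • c • y - (c * inner ℝ y u) • η := fun u η => rfl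
  let L : V →ₗ[ℝ] V × V := ((k p.1) + (2 : ℝ) • LinearMap.id).prod (k p.2)
  have hL : ∀ η, L η = (k p.1 η + (2 : ℝ) • η, k p.2 η) := fun η => rfl
  have hA : A * A = 1 := by
    ext δ <;> simp [A, ρ, reflect_reflect hε hny]
  have hML : ∀ η, inner ℝ y η = 0 → M (L η) = 0 := by
    intro η hη
    -- The variation L η keeps the position at time t fixed. Tangency then forces the entry time to
    -- be stationary as well, because the line is transverse to the sphere, and so M (L η) = 0.
    have e1 : (L η).1 + t • (L η).2 = 0 := by
      have : (L η).1 + t • (L η).2 =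
          ((inner ℝ p.1 η + t * inner ℝ p.2 η : ℝ) * c) • y
            - (c * (inner ℝ y p.1 + t * inner ℝ y p.2) - 2) • η := by
        rw [hL, hk, hk]; module
      rw [this]
      have e2 : (inner ℝ p.1 η + t * inner ℝ p.2 η : ℝ) = inner ℝ y η := by
        rw [hyp, inner_add_left, real_inner_smul_left]
      have e3 : (inner ℝ y p.1 + t * inner ℝ y p.2 : ℝ) = inner ℝ y y := by
        conv_rhs => rw [hyp, inner_add_right, inner_smul_right, ← hyp]
      rw [e2, e3, hη, hyy, hcε]
      simp
    have e4 := htan (L η)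
    rw [← add_assoc, e1, zero_add, inner_smul_right] at e4
    have e5 : t' (L η) = 0 := (mul_eq_zero.1 e4).resolve_right hin.ne
    rw [hM, ← add_assoc, e1, e5, zero_smul, zero_add]
  have hB : (L ∘ₗ M : Module.End ℝ (V × V)) * (L ∘ₗ M) = 0 := by
    ext1 <;> ext1 δ <;> simp only [Module.End.mul_eq_comp, LinearMap.comp_apply]
    · rw [hML (M _) (htan _)]; simp
    · rw [hML (M _) (htan _)]; simp
  rw [ContinuousLinearMap.det]
  rw [← abs_det_eq_one_of_sq_zero hA hB]
  congr 2
  refine LinearMap.ext fun δ => ?_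
  have hη := htan δ
  rw [← hM] at hη
  have eA : ∀ z, A z = (ρ z.1, ρ z.2) := fun z => rfl
  simp only [Module.End.mul_apply, LinearMap.add_apply, Module.End.one_apply, LinearMap.comp_apply,
    eA, Prod.fst_add, Prod.snd_add, hL, hρ, hk, ContinuousLinearMap.coe_coe,
    ContinuousLinearMap.prod_apply, _root_.add_apply, _root_.sub_apply,
    _root_.smul_apply, ContinuousLinearMap.smulRight_apply,
    ContinuousLinearMap.comp_apply, fderivInnerCLM_apply, ContinuousLinearMap.coe_fst',
    ContinuousLinearMap.coe_snd', ← hM, inner_add_right, inner_sub_right, inner_smul_right, hη, hyy,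
    smul_eq_mul]
  have sw : ∀ u : V, (inner ℝ (M δ) u : ℝ) = inner ℝ u (M δ) := fun u => real_inner_comm _ _
  ext1
  · simp only [sw]
    have : ((c * (inner ℝ y δ.1 + (inner ℝ p.1 (M δ) * (c * ε ^ 2) - c * inner ℝ y p.1 * 0 + 2 * 0))) : ℝ)
      = c * inner ℝ y δ.1 + 2 * c * inner ℝ p.1 (M δ) := by rw [hcε]; ring
    rw [this]
    module
  · simp only [sw]
    have : ((c * (inner ℝ y δ.2 + (inner ℝ p.2 (M δ) * (c * ε ^ 2) - c * inner ℝ y p.2 * 0))) : ℝ)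
      = c * inner ℝ y δ.2 + 2 * c * inner ℝ p.2 (M δ) := by rw [hcε]; ring
    rw [this]
    module

end Scattering

/-! ### The flat torus: fundamental domain, distance, volumes of balls and shells. -/

section Torus

variable {d : ℕ}

instance : IsProbabilityMeasure (volume : Measure UnitAddCircle) := ⟨UnitAddCircle.measure_univ⟩

instance : IsProbabilityMeasure (volume : Measure (UnitAddTorus (Fin d))) :=
  inferInstanceAs (IsProbabilityMeasure (Measure.pi fun _ : Fin d => (volume : Measure UnitAddCircle)))

instance : (volume : Measure (UnitAddTorus (Fin d))).IsAddHaarMeasure :=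
  inferInstanceAs (Measure.pi fun _ : Fin d => (volume : Measure UnitAddCircle)).IsAddHaarMeasure

instance : (volume : Measure (Particle d)).IsAddHaarMeasure :=
  Measure.prod.instIsAddHaarMeasure volume volume

instance : BorelSpace (Particle d) := Prod.borelSpace

instance : MeasurableAdd (Particle d) := ContinuousAdd.measurableAdd

instance {N : ℕ} : (volume : Measure (Config d N)).IsAddHaarMeasure :=
  Measure.pi.isAddHaarMeasure _

/-- The fundamental domain `(-1/2, 1/2]^d` of the torus. -/
def cube (d : ℕ) : Set (EuclideanSpace ℝ (Fin d)) :=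
  {y | ∀ k, y k ∈ Set.Ioc (-(1 / 2) : ℝ) (-(1 / 2) + 1)}

/-- The representative in `(-1/2, 1/2]^d` of a point of the torus. -/
def sec (x : UnitAddTorus (Fin d)) : EuclideanSpace ℝ (Fin d) :=
  WithLp.toLp 2 fun k => (AddCircle.measurableEquivIoc 1 (-(1 / 2)) (x k) : ℝ)

lemma sec_mem_cube (x : UnitAddTorus (Fin d)) : sec x ∈ cube d := fun k =>
  (AddCircle.measurableEquivIoc 1 (-(1 / 2)) (x k)).2

lemma proj_sec (x : UnitAddTorus (Fin d)) : proj (sec x) = x := by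
  funext k
  exact (AddCircle.equivIoc 1 (-(1 / 2) : ℝ)).symm_apply_apply (x k)

lemma sec_proj {y : EuclideanSpace ℝ (Fin d)} (hy : y ∈ cube d) : sec (proj y) = y := by
  ext k
  exact congrArg Subtype.val ((AddCircle.equivIoc 1 (-(1 / 2) : ℝ)).apply_symm_apply ⟨y k, hy k⟩)

lemma mem_cube_of_norm_lt {y : EuclideanSpace ℝ (Fin d)} (hy : ‖y‖ < 1 / 2) : y ∈ cube d := by
  intro k
  have h1 : ‖y k‖ ≤ ‖y‖ := PiLp.norm_apply_le y k
  rw [Real.norm_eq_abs] at h1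
  have := abs_lt.1 (h1.trans_lt hy)
  constructor <;> linarith

lemma sec_proj_of_norm_lt {y : EuclideanSpace ℝ (Fin d)} (hy : ‖y‖ < 1 / 2) :
    sec (proj y) = y := sec_proj (mem_cube_of_norm_lt hy)

lemma proj_add (y z : EuclideanSpace ℝ (Fin d)) : proj (y + z) = proj y + proj z := by
  funext k; simp [proj]

lemma proj_neg (y : EuclideanSpace ℝ (Fin d)) : proj (-y) = -proj y := by
  funext k; simp [proj]

lemma proj_sub (y z : EuclideanSpace ℝ (Fin d)) : proj (y - z) = proj y - proj z := by
  rw [sub_eq_add_neg, proj_add, proj_neg, sub_eq_add_neg]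

lemma proj_zero : proj (0 : EuclideanSpace ℝ (Fin d)) = 0 := by
  funext k; simp [proj]

lemma continuous_proj : Continuous (proj : EuclideanSpace ℝ (Fin d) → _) := by
  unfold proj
  exact continuous_pi fun k => (AddCircle.continuous_mk' 1).comp (by fun_prop)

lemma norm_coe_le (r : ℝ) : ‖(r : UnitAddCircle)‖ ≤ |r| := by
  rw [UnitAddCircle.norm_eq]
  simpa using round_le r 0

lemma norm_apply_eq (x : UnitAddTorus (Fin d)) (k : Fin d) : ‖x k‖ = |sec x k| := by
  have h1 := congrFun (proj_sec x) k
  have h2 := sec_mem_cube x k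
  conv_lhs => rw [← h1]
  refine (AddCircle.norm_coe_eq_abs_iff 1 one_ne_zero).2 ?_
  rw [abs_one, abs_le]
  constructor <;> linarith [h2.1, h2.2]

lemma sqrt_sum_eq_norm_sec (x : UnitAddTorus (Fin d)) :
    Real.sqrt (∑ k, ‖x k‖ ^ 2) = ‖sec x‖ := by
  rw [EuclideanSpace.norm_eq]
  simp_rw [norm_apply_eq, Real.norm_eq_abs]

lemma torusDist_eq (x y : UnitAddTorus (Fin d)) : torusDist x y = ‖sec (x - y)‖ :=
  sqrt_sum_eq_norm_sec (x - y)

lemma norm_sec_proj_le (y : EuclideanSpace ℝ (Fin d)) : ‖sec (proj y)‖ ≤ ‖y‖ := by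
  rw [← sqrt_sum_eq_norm_sec, EuclideanSpace.norm_eq]
  apply Real.sqrt_le_sqrt
  refine Finset.sum_le_sum fun k _ => ?_
  gcongr
  exact norm_coe_le _

lemma norm_sec_add_le (x y : UnitAddTorus (Fin d)) : ‖sec (x + y)‖ ≤ ‖sec x‖ + ‖sec y‖ := by
  conv_lhs => rw [← proj_sec x, ← proj_sec y, ← proj_add]
  exact (norm_sec_proj_le _).trans (norm_add_le _ _)

lemma norm_sec_neg (x : UnitAddTorus (Fin d)) : ‖sec (-x)‖ = ‖sec x‖ := by
  simp [← sqrt_sum_eq_norm_sec]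

lemma torusDist_comm (x y : UnitAddTorus (Fin d)) : torusDist x y = torusDist y x := by
  rw [torusDist_eq, torusDist_eq, ← norm_sec_neg, neg_sub]

lemma torusDist_triangle (x y z : UnitAddTorus (Fin d)) :
    torusDist x z ≤ torusDist x y + torusDist y z := by
  simp only [torusDist_eq]
  have := norm_sec_add_le (x - y) (y - z)
  rwa [sub_add_sub_cancel] at this

lemma torusDist_self (x : UnitAddTorus (Fin d)) : torusDist x x = 0 := by
  simp [torusDist]

/-- Moving the points by `proj a` and `proj b` changes their distance by at most `‖a - b‖`. -/
lemma torusDist_add_proj_le (x y : UnitAddTorus (Fin d)) (a b : EuclideanSpace ℝ (Fin d)) :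
    torusDist x y ≤ torusDist (x + proj a) (y + proj b) + ‖a - b‖ := by
  simp only [torusDist_eq]
  have h : x - y = (x + proj a - (y + proj b)) + proj (b - a) := by
    rw [proj_sub]; abel
  rw [h, ← norm_sub_rev b a]
  exact (norm_sec_add_le _ _).trans (by gcongr; exact norm_sec_proj_le _)

lemma continuous_norm_sec : Continuous fun x : UnitAddTorus (Fin d) => ‖sec x‖ := by
  simp_rw [← sqrt_sum_eq_norm_sec]
  fun_prop

lemma continuous_torusDist_comp {α : Type*} [TopologicalSpace α] {f g : α → UnitAddTorus (Fin d)}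
    (hf : Continuous f) (hg : Continuous g) : Continuous fun a => torusDist (f a) (g a) := by
  simp_rw [torusDist_eq]
  exact continuous_norm_sec.comp (hf.sub hg)

lemma measurable_sec : Measurable (sec : UnitAddTorus (Fin d) → _) := by
  unfold sec
  refine (WithLp.measurable_toLp 2 _).comp (measurable_pi_lambda _ fun k => ?_)
  exact measurable_subtype_coe.comp
    ((AddCircle.measurableEquivIoc 1 (-(1 / 2))).measurable.comp (measurable_pi_apply k))

lemma measurable_proj : Measurable (proj : EuclideanSpace ℝ (Fin d) → _) :=
  continuous_proj.measurable

lemma cube_eq_preimage : cube d = WithLp.ofLp ⁻¹'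
    (Set.univ.pi fun _ : Fin d => Set.Ioc (-(1 / 2) : ℝ) (-(1 / 2) + 1)) := by
  ext y; simp [cube]

lemma measurableSet_cube : MeasurableSet (cube d) := by
  rw [cube_eq_preimage]
  exact (WithLp.measurable_ofLp 2 _) (MeasurableSet.univ_pi fun _ => measurableSet_Ioc)

lemma measurePreserving_proj :
    MeasurePreserving (proj : EuclideanSpace ℝ (Fin d) → _) (volume.restrict (cube d)) volume := by
  have h1 := measurePreserving_pi (fun _ : Fin d => (volume.restrict
    (Set.Ioc (-(1 / 2) : ℝ) (-(1 / 2) + 1)))) (fun _ => (volume : Measure UnitAddCircle))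
    (f := fun _ => QuotientAddGroup.mk) fun _ => UnitAddCircle.measurePreserving_mk (-(1 / 2))
  rw [← Measure.restrict_pi_pi, ← volume_pi, ← volume_pi] at h1
  have h2 := (PiLp.volume_preserving_ofLp (Fin d)).restrict_preimage
    (MeasurableSet.univ_pi fun _ : Fin d => (measurableSet_Ioc : MeasurableSet
      (Set.Ioc (-(1 / 2) : ℝ) (-(1 / 2) + 1))))
  rw [← cube_eq_preimage] at h2
  exact h1.comp h2

lemma measurePreserving_sec :
    MeasurePreserving (sec : UnitAddTorus (Fin d) → _) volume (volume.restrict (cube d)) := by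
  refine ⟨measurable_sec, ?_⟩
  rw [← measurePreserving_proj.map_eq, Measure.map_map measurable_sec measurable_proj]
  have : (sec ∘ proj) =ᵐ[volume.restrict (cube d)] (id : EuclideanSpace ℝ (Fin d) → _) := by
    filter_upwards [ae_restrict_mem measurableSet_cube] with y hy
    exact sec_proj hy
  rw [Measure.map_congr this, Measure.map_id]

/-- A Euclidean ball lies in the sup-norm ball, a product of arcs of length at most 2ρ. -/
lemma volume_norm_sec_le (ρ : ℝ) :
    volume {x : UnitAddTorus (Fin d) | ‖sec x‖ ≤ ρ} ≤ ENNReal.ofReal (2 * ρ) ^ d := by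
  have : {x : UnitAddTorus (Fin d) | ‖sec x‖ ≤ ρ} ⊆
      Set.univ.pi fun _ => Metric.closedBall (0 : UnitAddCircle) ρ := by
    intro x hx k _
    rw [mem_closedBall_zero_iff, norm_apply_eq, ← Real.norm_eq_abs]
    exact (PiLp.norm_apply_le _ k).trans hx
  refine (measure_mono this).trans ?_
  rw [volume_pi, Measure.pi_pi]
  simp only [AddCircle.volume_closedBall, Finset.prod_const, Finset.card_univ, Fintype.card_fin]
  gcongr
  exact min_le_right _ _

lemma volume_norm_sec_eq {ε : ℝ} (hε : 0 < ε) :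
    volume {x : UnitAddTorus (Fin d) | ‖sec x‖ = ε} = 0 := by
  have := measurePreserving_sec.measure_preimage (s := Metric.sphere (0 : EuclideanSpace ℝ (Fin d)) ε)
    Metric.isClosed_sphere.measurableSet.nullMeasurableSet
  have h2 : sec ⁻¹' Metric.sphere (0 : EuclideanSpace ℝ (Fin d)) ε = {x | ‖sec x‖ = ε} := by
    ext x; simp
  rw [h2] at this
  rw [this]
  exact le_antisymm ((Measure.restrict_apply_le _ _).trans
    (Measure.addHaar_sphere_of_ne_zero _ _ hε.ne').le) bot_le

/-- A crude Lipschitz bound, sufficient to see that a spherical shell of thickness s has volume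
O(s). -/
lemma add_pow_sub_pow_le {a s : ℝ} (ha : 0 ≤ a) (ha1 : a ≤ 1) (hs : 0 ≤ s) (hs1 : s ≤ 1) (n : ℕ) :
    (a + s) ^ n - a ^ n ≤ n * 2 ^ n * s := by
  induction n with
  | zero => simp
  | succ n ih =>
    have h1 : (a + s) ^ n ≤ 2 ^ n := pow_le_pow_left₀ (by linarith) (by linarith) n
    have h2 : (0 : ℝ) ≤ n * 2 ^ n * s := by positivity
    have h3 : (0 : ℝ) ≤ 2 ^ n * s := by positivity
    have h4 : a * ((a + s) ^ n - a ^ n) ≤ 1 * (n * 2 ^ n * s) :=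
      (mul_le_mul_of_nonneg_left ih ha).trans (mul_le_mul_of_nonneg_right ha1 h2)
    have h5 : s * (a + s) ^ n ≤ s * 2 ^ n := mul_le_mul_of_nonneg_left h1 hs
    have h6 : (a + s) ^ (n + 1) - a ^ (n + 1) = a * ((a + s) ^ n - a ^ n) + s * (a + s) ^ n := by ring
    rw [h6]
    push_cast
    have : ((n : ℝ) + 1) * 2 ^ (n + 1) * s = 2 * (n * 2 ^ n * s) + 2 * (2 ^ n * s) := by ring
    linarith

/-- The volume of a thin spherical shell. -/
lemma volume_shell_le (hd : 1 ≤ d) {ε : ℝ} (hε : 0 < ε) (hε1 : ε ≤ 1) :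
    ∃ C : ℝ, 0 ≤ C ∧ ∀ s, 0 ≤ s → s ≤ 1 →
      volume {x : UnitAddTorus (Fin d) | ε < ‖sec x‖ ∧ ‖sec x‖ ≤ ε + s} ≤ ENNReal.ofReal (C * s) := by
  set b := volume (Metric.ball (0 : EuclideanSpace ℝ (Fin d)) 1) with hb
  have hbt : b ≠ ⊤ := measure_ball_lt_top.ne
  refine ⟨d * 2 ^ d * b.toReal, by positivity, fun s hs hs1 => ?_⟩
  have : Nonempty (Fin d) := ⟨⟨0, hd⟩⟩
  have hm : MeasurableSet (Metric.closedBall (0 : EuclideanSpace ℝ (Fin d)) (ε + s) \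
      Metric.closedBall 0 ε) :=
    Metric.isClosed_closedBall.measurableSet.diff Metric.isClosed_closedBall.measurableSet
  have := measurePreserving_sec.measure_preimage hm.nullMeasurableSet
  have h2 : sec ⁻¹' (Metric.closedBall (0 : EuclideanSpace ℝ (Fin d)) (ε + s) \
      Metric.closedBall 0 ε) = {x | ε < ‖sec x‖ ∧ ‖sec x‖ ≤ ε + s} := by
    ext x; simp [and_comm]
  rw [h2] at this
  rw [this]
  refine (Measure.restrict_apply_le _ _).trans ?_
  rw [measure_sdiff (Metric.closedBall_subset_closedBall (by linarith))
    Metric.isClosed_closedBall.measurableSet.nullMeasurableSet measure_closedBall_lt_top.ne,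
    Measure.addHaar_closedBall _ _ (by linarith), Measure.addHaar_closedBall _ _ hε.le,
    finrank_euclideanSpace_fin, ← hb, ← ENNReal.ofReal_toReal hbt,
    ← ENNReal.ofReal_mul (by positivity), ← ENNReal.ofReal_mul (by positivity),
    ← ENNReal.ofReal_sub _ (by positivity), ENNReal.toReal_ofReal ENNReal.toReal_nonneg]
  apply ENNReal.ofReal_le_ofReal
  have h3 := add_pow_sub_pow_le hε.le hε1 hs hs1 d
  have h4 : (0 : ℝ) ≤ b.toReal := ENNReal.toReal_nonneg
  nlinarith

end Torus

/-! ### Free transport. -/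

section FreeFlow

variable {d N : ℕ}

/-- Free transport of all particles during the time `s`. -/
def freeFlow (s : ℝ) (Z : Config d N) : Config d N :=
  fun k => ((Z k).1 + proj (s • (Z k).2), (Z k).2)

/-- The distance between the particles `i` and `j`. -/
def gap (Z : Config d N) (i j : Fin N) : ℝ := torusDist (Z i).1 (Z j).1

/-- Relative position (in the fundamental domain) and relative velocity. -/
def relState (r : Particle d) : EuclideanSpace ℝ (Fin d) × EuclideanSpace ℝ (Fin d) :=
  (sec r.1, r.2)

/-- Twice the kinetic energy. -/
def energy (Z : Config d N) : ℝ := ∑ k, ‖(Z k).2‖ ^ 2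

lemma freeFlow_zero (Z : Config d N) : freeFlow 0 Z = Z := by
  funext k; simp [freeFlow, proj_zero]

lemma freeFlow_add (s t : ℝ) (Z : Config d N) : freeFlow (s + t) Z = freeFlow s (freeFlow t Z) := by
  funext k
  simp only [freeFlow, add_smul, proj_add]
  ext1
  · simp only; abel
  · rfl

lemma energy_freeFlow (s : ℝ) (Z : Config d N) : energy (freeFlow s Z) = energy Z := rfl

lemma gap_comm (Z : Config d N) (i j : Fin N) : gap Z i j = gap Z j i := torusDist_comm _ _

lemma continuous_gap (i j : Fin N) : Continuous fun Z : Config d N => gap Z i j :=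
  continuous_torusDist_comp (by fun_prop) (by fun_prop)

lemma gap_eq (Z : Config d N) (i j : Fin N) : gap Z i j = ‖(relState (Z i - Z j)).1‖ :=
  torusDist_eq _ _

lemma continuous_freeFlow (s : ℝ) : Continuous (freeFlow s : Config d N → Config d N) := by
  refine continuous_pi fun k => Continuous.prodMk ?_ (by fun_prop)
  exact Continuous.add (by fun_prop) (continuous_proj.comp (by fun_prop))

/-- For fixed velocities the positions are merely translated. -/
lemma measurePreserving_freeFlow (s : ℝ) :
    MeasurePreserving (freeFlow s : Config d N → Config d N) := by
  have h1 : MeasurePreserving (fun r : Particle d => ((r.1 + proj (s • r.2), r.2) : Particle d)) := by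
    have h := (MeasurePreserving.id (volume : Measure (EuclideanSpace ℝ (Fin d)))).skew_product
      (μc := (volume : Measure (UnitAddTorus (Fin d)))) (μd := volume)
      (g := fun v x => x + proj (s • v)) (by
        refine measurable_snd.add (measurable_proj.comp ?_)
        exact measurable_fst.const_smul s)
      (ae_of_all _ fun v => (measurePreserving_add_right volume _).map_eq)
    have h2 := (Measure.measurePreserving_swap (μ := (volume : Measure (EuclideanSpace ℝ (Fin d))))
      (ν := (volume : Measure (UnitAddTorus (Fin d))))).comp (h.comp
        (Measure.measurePreserving_swap (μ := (volume : Measure (UnitAddTorus (Fin d))))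
          (ν := (volume : Measure (EuclideanSpace ℝ (Fin d))))))
    exact h2
  exact volume_preserving_pi fun _ => h1

lemma freeFlow_sub_fst (u : ℝ) (Z : Config d N) (i j : Fin N) :
    (freeFlow u Z i).1 - (freeFlow u Z j).1 =
      proj ((relState (Z i - Z j)).1 + u • (relState (Z i - Z j)).2) := by
  simp only [freeFlow, relState, proj_add, proj_sec, smul_sub, proj_sub, Prod.fst_sub,
    Prod.snd_sub]
  abel

/-- Within distance 1/2 the relative motion on the torus lifts to a straight line in ℝ^d, which is
how Euclidean scattering enters. -/
lemma gap_freeFlow_eq {u : ℝ} {Z : Config d N} {i j : Fin N}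
    (h : ‖(relState (Z i - Z j)).1 + u • (relState (Z i - Z j)).2‖ < 1 / 2) :
    gap (freeFlow u Z) i j = ‖(relState (Z i - Z j)).1 + u • (relState (Z i - Z j)).2‖ := by
  rw [gap, torusDist_eq, freeFlow_sub_fst, sec_proj_of_norm_lt h]

lemma norm_vel_le {Z : Config d N} {R : ℝ} (hR : 0 ≤ R) (h : energy Z ≤ R ^ 2) (k : Fin N) :
    ‖(Z k).2‖ ≤ R := by
  have h1 : ‖(Z k).2‖ ^ 2 ≤ energy Z :=
    Finset.single_le_sum (f := fun k => ‖(Z k).2‖ ^ 2) (fun _ _ => by positivity) (Finset.mem_univ k)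
  exact (pow_le_pow_iff_left₀ (norm_nonneg _) hR two_ne_zero).1 (h1.trans h)

lemma norm_relVel_le {Z : Config d N} {R : ℝ} (hR : 0 ≤ R) (h : energy Z ≤ R ^ 2) (i j : Fin N) :
    ‖(relState (Z i - Z j)).2‖ ≤ 2 * R := by
  have h1 := norm_vel_le hR h i
  have h2 := norm_vel_le hR h j
  refine (norm_sub_le (Z i).2 (Z j).2).trans ?_
  linarith

end FreeFlow

/-! ### The collision of a pair on the torus. -/

section Collision

variable {d N : ℕ}

/-- The momentum transferred from `i` to `j` in their next collision, as a function of
`z_i - z_j`. -/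
def kick (ε : ℝ) (r : Particle d) : EuclideanSpace ℝ (Fin d) :=
  (1 / ε ^ 2 * inner ℝ (impact ε (relState r).1 (relState r).2) (relState r).2) •
    impact ε (relState r).1 (relState r).2

/-- The change of the asymptotic free trajectory of `i` due to its collision with `j`. -/
def jump (ε : ℝ) (r : Particle d) : Particle d :=
  (proj (entryTime ε (relState r).1 (relState r).2 • kick ε r), -kick ε r)

/-- The scattering of the pair `i`, `j`. -/
def collide (ε : ℝ) (i j : Fin N) (Z : Config d N) : Config d N :=
  Z + (Pi.single i (jump ε (Z i - Z j)) - Pi.single j (jump ε (Z i - Z j)))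

lemma collide_left (ε : ℝ) {i j : Fin N} (h : i ≠ j) (Z : Config d N) :
    collide ε i j Z i = Z i + jump ε (Z i - Z j) := by
  simp [collide, h]

lemma collide_right (ε : ℝ) {i j : Fin N} (h : i ≠ j) (Z : Config d N) :
    collide ε i j Z j = Z j - jump ε (Z i - Z j) := by
  simp [collide, h.symm, sub_eq_add_neg]

lemma collide_of_ne (ε : ℝ) {i j k : Fin N} (hi : k ≠ i) (hj : k ≠ j) (Z : Config d N) :
    collide ε i j Z k = Z k := by
  simp [collide, hi, hj]

/-- Since i receives the jump and j its opposite, the relative state moves by twice the jump; this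
ties `collide` to the scattering map. -/
lemma scatter_relState (ε : ℝ) (r : Particle d) (h : 0 < disc ε (relState r).1 (relState r).2) :
    r + (2 : ℕ) • jump ε r = (proj (scatter ε (relState r)).1, (scatter ε (relState r)).2) := by
  have hx : (relState r).1 = impact ε (relState r).1 (relState r).2 +
      (-entryTime ε (relState r).1 (relState r).2) • (relState r).2 := by rw [impact]; simp
  have e2 : (scatter ε (relState r)).2 = r.2 - (2 : ℝ) • kick ε r := by
    have : ∀ a : ℝ, 2 / ε ^ 2 * a = 2 * (1 / ε ^ 2 * a) := fun a => by ring
    simp only [scatter, reflect, kick, smul_smul, this]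
    rfl
  ext1
  · rcases eq_or_ne ε 0 with rfl | hε
    -- For ε = 0 the discriminant cannot be positive, by Cauchy–Schwarz.
    · have h0 : kick 0 r = 0 := by simp [kick]
      have : impact 0 (relState r).1 (relState r).2 = 0 := by
        have := norm_impact_sq h
        simpa using this
      have h1 := h
      simp only [disc] at h1
      have hcs := abs_real_inner_le_norm (relState r).1 (relState r).2
      have hcs2 : (inner ℝ (relState r).1 (relState r).2 : ℝ) ^ 2 ≤
          (‖(relState r).1‖ * ‖(relState r).2‖) ^ 2 := by
        rw [← sq_abs]; exact pow_le_pow_left₀ (abs_nonneg _) hcs 2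
      exfalso
      nlinarith
    · have e1 : (scatter ε (relState r)).1 =
          sec r.1 + (2 * entryTime ε (relState r).1 (relState r).2) • kick ε r := by
        have hyy : (inner ℝ (impact ε (relState r).1 (relState r).2)
            (impact ε (relState r).1 (relState r).2) : ℝ) = ε ^ 2 := by
          rw [real_inner_self_eq_norm_sq, norm_impact_sq h]
        have hin : (inner ℝ (impact ε (relState r).1 (relState r).2) (relState r).1 : ℝ) = ε ^ 2 -
            entryTime ε (relState r).1 (relState r).2 *
              inner ℝ (impact ε (relState r).1 (relState r).2) (relState r).2 := by
          have key : ∀ (x y w : EuclideanSpace ℝ (Fin d)) (t : ℝ), x = y + (-t) • w →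
              inner ℝ y y = ε ^ 2 → (inner ℝ y x : ℝ) = ε ^ 2 - t * inner ℝ y w := by
            rintro x y w t rfl hy
            rw [inner_add_right, inner_smul_right, hy]
            ring
          exact key _ _ _ _ hx hyy
        have hsec : sec r.1 = (relState r).1 := rfl
        simp only [scatter, reflect, kick, hin, hsec, smul_smul]
        rw [mul_sub, div_mul_cancel₀ _ (pow_ne_zero 2 hε)]
        module
      rw [e1]
      simp only [Prod.fst_add, jump, proj_add, proj_sec, mul_smul, two_smul]
  · rw [e2]
    simp only [Prod.snd_add, jump, two_smul]
    abel

lemma measurable_disc (ε : ℝ) : Measurable fun p : EuclideanSpace ℝ (Fin d) ×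
    EuclideanSpace ℝ (Fin d) => disc ε p.1 p.2 := by
  unfold disc; fun_prop

lemma measurable_entryTime (ε : ℝ) : Measurable fun p : EuclideanSpace ℝ (Fin d) ×
    EuclideanSpace ℝ (Fin d) => entryTime ε p.1 p.2 := by
  unfold entryTime
  have := measurable_disc (d := d) ε
  fun_prop

lemma measurable_impact (ε : ℝ) : Measurable fun p : EuclideanSpace ℝ (Fin d) ×
    EuclideanSpace ℝ (Fin d) => impact ε p.1 p.2 := by
  unfold impact
  have := measurable_entryTime (d := d) ε
  fun_prop

lemma measurable_scatter (ε : ℝ) : Measurable (scatter ε : EuclideanSpace ℝ (Fin d) ×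
    EuclideanSpace ℝ (Fin d) → _) := by
  unfold scatter reflect
  have := measurable_impact (d := d) ε
  fun_prop

lemma measurable_relState : Measurable (relState : Particle d → _) :=
  (measurable_sec.comp measurable_fst).prodMk measurable_snd

lemma measurable_kick (ε : ℝ) : Measurable (kick ε : Particle d → _) := by
  have h1 := (measurable_impact (d := d) ε).comp measurable_relState
  have h2 := (measurable_relState (d := d)).snd
  exact ((Measurable.inner (𝕜 := ℝ) h1 h2).const_mul _).smul h1

lemma measurable_jump (ε : ℝ) : Measurable (jump ε : Particle d → _) := by
  have h1 := (measurable_entryTime (d := d) ε).comp measurable_relState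
  exact (measurable_proj.comp (h1.smul (measurable_kick ε))).prodMk (measurable_kick ε).neg

lemma measurable_collide (ε : ℝ) (i j : Fin N) : Measurable (collide (d := d) ε i j) := by
  have h : Measurable fun Z : Config d N => jump ε (Z i - Z j) :=
    (measurable_jump ε).comp ((measurable_pi_apply i).sub (measurable_pi_apply j))
  have hs : ∀ k : Fin N, Measurable fun r : Particle d => (Pi.single k r : Config d N) := fun k => by
    refine measurable_pi_lambda _ fun l => ?_
    by_cases hl : l = k
    · subst hl; simpa using measurable_id'
    · simp [Pi.single_eq_of_ne hl]
  exact measurable_id.add (((hs i).comp h).sub ((hs j).comp h))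

/-- Change of variables, from injectivity and |det| = 1. -/
lemma map_scatter_restrict_le {ε : ℝ} (hε : 0 < ε)
    {B : Set (EuclideanSpace ℝ (Fin d) × EuclideanSpace ℝ (Fin d))} (hB : MeasurableSet B)
    (hpos : ∀ p ∈ B, 0 < disc ε p.1 p.2) :
    (volume.restrict B).map (scatter ε) ≤ volume := by
  refine Measure.le_iff.2 fun A hA => ?_
  rw [Measure.map_apply (measurable_scatter ε) hA, Measure.restrict_apply (measurable_scatter ε hA)]
  have hm : MeasurableSet (scatter ε ⁻¹' A ∩ B) := (measurable_scatter ε hA).inter hB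
  choose! D hD1 hD2 using fun (p : EuclideanSpace ℝ (Fin d) × EuclideanSpace ℝ (Fin d))
    (hp : 0 < disc ε p.1 p.2) => exists_hasFDerivAt_scatter hε hp
  have : (volume : Measure (EuclideanSpace ℝ (Fin d) × EuclideanSpace ℝ (Fin d))).IsAddHaarMeasure :=
    Measure.prod.instIsAddHaarMeasure volume volume
  have h := lintegral_abs_det_fderiv_eq_addHaar_image volume hm
    (fun p hp => (hD1 p (hpos p hp.2)).hasFDerivWithinAt)
    ((scatter_injOn hε).mono fun p hp => hpos p hp.2)
  rw [setLIntegral_congr_fun hm (g := fun _ => 1)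
    (fun p hp => by simp only [hD2 p (hpos p hp.2), ENNReal.ofReal_one]), setLIntegral_one] at h
  rw [h]
  exact measure_mono (by rintro _ ⟨p, hp, rfl⟩; exact hp.1)

/-- The relative states that lead to a collision within the time `s`. -/
def collSet (d : ℕ) (ε s R : ℝ) : Set (Particle d) :=
  {r | 0 < disc ε (relState r).1 (relState r).2 ∧
    entryTime ε (relState r).1 (relState r).2 ∈ Set.Icc 0 s ∧ ‖r.2‖ ≤ 2 * R}

lemma measurableSet_collSet (ε s R : ℝ) : MeasurableSet (collSet d ε s R) := by
  refine (measurableSet_lt measurable_const ((measurable_disc ε).comp measurable_relState)).inter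
    (MeasurableSet.inter ?_ (measurableSet_le measurable_snd.norm measurable_const))
  exact ((measurable_entryTime ε).comp measurable_relState) measurableSet_Icc

/-- Transfers the Jacobian computation from ℝ^d to the torus. The smallness of s keeps the outgoing
positions inside the fundamental domain, where the projection preserves measure. -/
lemma map_relative_le {ε s R : ℝ} (hε : 0 < ε) (hs : ε + 2 * R * s < 1 / 2) :
    (volume.restrict (collSet d ε s R)).map (fun r => r + (2 : ℕ) • jump ε r) ≤ volume := by
  set G := collSet d ε s R
  have hG : MeasurableSet G := measurableSet_collSet ε s R
  let G' : Set (EuclideanSpace ℝ (Fin d) × EuclideanSpace ℝ (Fin d)) :=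
    {p | 0 < disc ε p.1 p.2 ∧ entryTime ε p.1 p.2 ∈ Set.Icc 0 s ∧ ‖p.2‖ ≤ 2 * R}
  have hG' : MeasurableSet G' := by
    refine (measurableSet_lt measurable_const (measurable_disc ε)).inter
      (MeasurableSet.inter ?_ (measurableSet_le measurable_snd.norm measurable_const))
    exact (measurable_entryTime ε) measurableSet_Icc
  let Q : Set (EuclideanSpace ℝ (Fin d) × EuclideanSpace ℝ (Fin d)) := cube d ×ˢ Set.univ
  have hQ : MeasurableSet Q := measurableSet_cube.prod MeasurableSet.univ
  have hQv : (volume.restrict (cube d)).prod (volume : Measure (EuclideanSpace ℝ (Fin d))) =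
      volume.restrict Q := by
    rw [← Measure.restrict_univ (μ := (volume : Measure (EuclideanSpace ℝ (Fin d)))),
      Measure.prod_restrict, Measure.restrict_univ]
    rfl
  have h1 : MeasurePreserving (relState : Particle d → _) volume (volume.restrict Q) := by
    rw [← hQv]
    exact measurePreserving_sec.prod (MeasurePreserving.id volume)
  have h2 : MeasurePreserving (Prod.map proj id : EuclideanSpace ℝ (Fin d) ×
      EuclideanSpace ℝ (Fin d) → Particle d) (volume.restrict Q) volume := by
    rw [← hQv]
    exact measurePreserving_proj.prod (MeasurePreserving.id volume)
  refine Measure.le_iff.2 fun A hA => ?_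
  have hmeas : Measurable fun r : Particle d => r + (2 : ℕ) • jump ε r :=
    measurable_id.add ((measurable_jump ε).const_smul 2)
  rw [Measure.map_apply hmeas hA, Measure.restrict_apply (hmeas hA)]
  -- Extrapolated back to time 0, the outgoing line is at most ‖w‖ s ≤ 2Rs away from the impact
  -- point, which has norm ε.
  have hmaps : ∀ p ∈ G', scatter ε p ∈ Q := by
    rintro ⟨x, w⟩ ⟨hp1, hp2, hp3⟩
    refine ⟨mem_cube_of_norm_lt ?_, trivial⟩
    have h := scatter_add_smul hε hp1 0
    rw [zero_smul, add_zero, zero_sub] at h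
    simp only at hp2 hp3
    rw [h]
    refine lt_of_le_of_lt ((norm_add_le _ _).trans ?_) hs
    rw [norm_smul, norm_reflect hε (norm_impact hε hp1), norm_impact hε hp1, norm_neg,
      Real.norm_eq_abs, abs_of_nonneg hp2.1, mul_comm]
    have h3 := (norm_nonneg _).trans hp3
    have h4 := hp2.2
    have h5 := hp2.1
    gcongr
  set A' := Prod.map proj id ⁻¹' A ∩ Q with hA'
  have hA'm : MeasurableSet A' := (h2.measurable hA).inter hQ
  have hsub : (fun r : Particle d => r + (2 : ℕ) • jump ε r) ⁻¹' A ∩ G ⊆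
      relState ⁻¹' (scatter ε ⁻¹' A' ∩ G') := by
    rintro r ⟨hr1, hr2⟩
    have hr3 : relState r ∈ G' := hr2
    refine ⟨⟨?_, hmaps _ hr3⟩, hr3⟩
    have := scatter_relState ε r hr3.1
    simp only [Set.mem_preimage] at hr1 ⊢
    rw [this] at hr1
    exact hr1
  have hm1 : MeasurableSet (scatter ε ⁻¹' A' ∩ G') := (measurable_scatter ε hA'm).inter hG'
  calc volume ((fun r : Particle d => r + (2 : ℕ) • jump ε r) ⁻¹' A ∩ G)
      ≤ volume (relState ⁻¹' (scatter ε ⁻¹' A' ∩ G')) := measure_mono hsub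
    _ = volume.restrict Q (scatter ε ⁻¹' A' ∩ G') := h1.measure_preimage hm1.nullMeasurableSet
    _ ≤ volume (scatter ε ⁻¹' A' ∩ G') := Measure.restrict_apply_le _ _
    _ = (volume.restrict G').map (scatter ε) A' := by
      rw [Measure.map_apply (measurable_scatter ε) hA'm,
        Measure.restrict_apply (measurable_scatter ε hA'm)]
    _ ≤ volume A' := map_scatter_restrict_le hε hG' (fun p hp => hp.1) A'
    _ = volume.restrict Q (Prod.map proj id ⁻¹' A) := by
      rw [Measure.restrict_apply (h2.measurable hA)]
    _ = volume A := h2.measure_preimage hA.nullMeasurableSet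

end Collision

/-! ### Measure-theoretic lemmas on maps acting on one coordinate. -/

section Coordinates

variable {X : Type*} [MeasureSpace X] [SigmaFinite (volume : Measure X)] {N : ℕ}

/-- A shear: c ignores the i-th coordinate, so with the others frozen this is a translation. -/
lemma measurePreserving_update_add [AddCommGroup X] [MeasurableAdd₂ X]
    [(volume : Measure X).IsAddRightInvariant] (i : Fin N)
    {c : (Fin N → X) → X} (hc : Measurable c) (hci : ∀ Z x, c (Function.update Z i x) = c Z) :
    MeasurePreserving (fun Z : Fin N → X => Function.update Z i (Z i + c Z)) := by
  obtain ⟨n, rfl⟩ : ∃ n, N = n + 1 := ⟨N - 1, by have := i.2; omega⟩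
  have he := volume_preserving_piFinSuccAbove (fun _ : Fin (n + 1) => X) i
  set e := MeasurableEquiv.piFinSuccAbove (fun _ : Fin (n + 1) => X) i with hedef
  have hins : Measurable fun z : Fin n → X => c (e.symm (0, z)) :=
    hc.comp (e.symm.measurable.comp (measurable_const.prodMk measurable_id))
  have hS := (MeasurePreserving.id (volume : Measure (Fin n → X))).skew_product
      (μc := (volume : Measure X)) (μd := volume) (g := fun z x => x + c (e.symm (0, z))) (by
        exact measurable_snd.add (hins.comp measurable_fst))
      (ae_of_all _ fun v => (measurePreserving_add_right volume _).map_eq)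
  have hS2 := (Measure.measurePreserving_swap.comp hS).comp
    (Measure.measurePreserving_swap (μ := (volume : Measure X))
      (ν := (volume : Measure (Fin n → X))))
  have h := (he.symm e).comp (hS2.comp he)
  convert h using 1
  funext Z
  have h1 : e Z = (Z i, fun j => Z (i.succAbove j)) := rfl
  have h2 : ∀ p : X × (Fin n → X), e.symm p = i.insertNth p.1 p.2 := fun p => rfl
  have h3 : c (e.symm (0, (e Z).2)) = c Z := by
    have : e.symm (0, (e Z).2) = Function.update Z i 0 := by
      rw [h2, h1]
      exact Fin.insertNth_removeNth i (0 : X) Z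
    rw [this, hci]
  simp only [Function.comp_apply, Prod.swap, id, h3]
  rw [h2, h1]
  exact (Fin.insertNth_removeNth i _ Z).symm

lemma map_update_restrict_le (i : Fin N) {g : X → X} (hg : Measurable g) {G : Set X}
    (hG : MeasurableSet G) (hle : (volume.restrict G).map g ≤ volume) :
    (volume.restrict {Z : Fin N → X | Z i ∈ G}).map
      (fun Z => Function.update Z i (g (Z i))) ≤ volume := by
  obtain ⟨n, rfl⟩ : ∃ n, N = n + 1 := ⟨N - 1, by have := i.2; omega⟩
  have he := volume_preserving_piFinSuccAbove (fun _ : Fin (n + 1) => X) i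
  set e := MeasurableEquiv.piFinSuccAbove (fun _ : Fin (n + 1) => X) i with hedef
  have hm : MeasurableSet (G ×ˢ (Set.univ : Set (Fin n → X))) := hG.prod MeasurableSet.univ
  have h1 := he.restrict_preimage hm
  have h2 : e ⁻¹' (G ×ˢ (Set.univ : Set (Fin n → X))) = {Z : Fin (n + 1) → X | Z i ∈ G} := by
    ext Z
    simp only [Set.mem_preimage, Set.mem_prod, Set.mem_univ, and_true, Set.mem_ofPred_eq]
    rfl
  rw [h2] at h1
  have h3 : (fun Z : Fin (n + 1) → X => Function.update Z i (g (Z i))) =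
      e.symm ∘ Prod.map g id ∘ e := by
    funext Z
    have h4 : ∀ p : X × (Fin n → X), e.symm p = i.insertNth p.1 p.2 := fun p => rfl
    simp only [Function.comp_apply]
    rw [h4]
    exact (Fin.insertNth_removeNth i _ Z).symm
  have hgm : Measurable (Prod.map g id : X × (Fin n → X) → _) := hg.prodMap measurable_id
  rw [h3, ← Measure.map_map e.symm.measurable (hgm.comp e.measurable),
    ← Measure.map_map hgm e.measurable, h1.map_eq, Measure.volume_eq_prod, ← Measure.prod_restrict,
    ← Measure.map_prod_map _ _ hg measurable_id, Measure.map_id, Measure.restrict_univ]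
  calc _ ≤ Measure.map e.symm ((volume : Measure X).prod (volume : Measure (Fin n → X))) :=
        Measure.map_mono (Measure.prod_mono hle le_rfl) e.symm.measurable
    _ = volume := (he.symm e).map_eq

lemma map_comp_le {α β : Type*} [MeasurableSpace α] [MeasurableSpace β] {μ : Measure α}
    {ν : Measure β} {f : α → β} (hf : Measurable f) {γ : Type*} [MeasurableSpace γ]
    {ξ : Measure γ} {g : β → γ} (hg : Measurable g) (h1 : μ.map f ≤ ν) (h2 : ν.map g ≤ ξ) :
    μ.map (g ∘ f) ≤ ξ := by
  rw [← Measure.map_map hg hf]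
  exact (Measure.map_mono h1 hg).trans h2

end Coordinates

/-! ### Volume and energy under the collision of a pair. -/

section Collision

variable {d N : ℕ}

/-- The collision map of a pair is volume nonincreasing on the configurations for which this pair
is about to collide. -/
lemma map_collide_restrict_le {ε s R : ℝ} (hε : 0 < ε) (hs : ε + 2 * R * s < 1 / 2) {i j : Fin N}
    (hij : i ≠ j) :
    (volume.restrict {Z : Config d N | Z i - Z j ∈ collSet d ε s R}).map (collide ε i j) ≤
      volume := by
  -- With r = z_i - z_j and J the jump, the collision is the composition (z_i, z_j) ↦ (r, z_j) ↦ (r,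
  -- z_j - J(r)) ↦ (r + 2J(r), z_j - J(r)), followed by adding the second entry to the first. Three
  -- factors are shears; only the third is not.
  have hm1 : Measurable fun Z : Config d N => -(Z j) := (measurable_pi_apply j).neg
  have A1 := measurePreserving_update_add (X := Particle d) i hm1
    (fun Z x => by simp [Function.update_of_ne hij.symm])
  have hm2 : Measurable fun Z : Config d N => -(jump ε (Z i)) :=
    ((measurable_jump ε).comp (measurable_pi_apply i)).neg
  have A2 := measurePreserving_update_add (X := Particle d) j hm2
    (fun Z x => by simp [Function.update_of_ne hij])
  have A3 := map_update_restrict_le (N := N) i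
    (measurable_id.add ((measurable_jump ε).const_smul 2)) (measurableSet_collSet ε s R)
    (map_relative_le (d := d) hε hs)
  have A4 := measurePreserving_update_add (X := Particle d) i (measurable_pi_apply j)
    (fun Z x => by simp [Function.update_of_ne hij.symm])
  have hS : MeasurableSet {Z : Config d N | Z i ∈ collSet d ε s R} :=
    measurable_pi_apply i (measurableSet_collSet ε s R)
  have B1 := (A1.restrict_preimage (A2.measurable hS))
  have B2 := (A2.restrict_preimage hS)
  have e1 : (fun Z : Config d N => Function.update Z i (Z i + -(Z j))) ⁻¹'
      ((fun Z : Config d N => Function.update Z j (Z j + -(jump ε (Z i)))) ⁻¹'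
        {Z : Config d N | Z i ∈ collSet d ε s R}) =
      {Z : Config d N | Z i - Z j ∈ collSet d ε s R} := by
    ext Z
    simp [Function.update_of_ne hij, sub_eq_add_neg]
  rw [e1] at B1
  have hm3 : Measurable fun Z : Config d N =>
      Function.update Z i ((id + (2 : ℕ) • jump ε : Particle d → Particle d) (Z i)) := by
    refine measurable_pi_lambda _ fun k => ?_
    by_cases hk : k = i
    · subst hk
      simp only [Function.update_self]
      exact (measurable_id.add ((measurable_jump ε).const_smul 2)).comp (measurable_pi_apply k)
    · simp only [Function.update_of_ne hk]
      exact measurable_pi_apply k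
  have C := map_comp_le (B2.comp B1).measurable (A4.measurable.comp hm3) (B2.comp B1).map_eq.le
    (map_comp_le hm3 A4.measurable A3 A4.map_eq.le)
  have hcomp : collide (d := d) ε i j = ((fun Z : Config d N => Function.update Z i (Z i + Z j)) ∘
      fun Z : Config d N =>
        Function.update Z i ((id + (2 : ℕ) • jump ε : Particle d → Particle d) (Z i))) ∘
      (fun Z : Config d N => Function.update Z j (Z j + -(jump ε (Z i)))) ∘
        fun Z : Config d N => Function.update Z i (Z i + -(Z j)) := by
    funext Z k
    simp only [Function.comp_apply]
    by_cases hki : k = i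
    · subst hki
      rw [collide_left ε hij]
      simp [Function.update_of_ne hij, Function.update_of_ne hij.symm, sub_eq_add_neg]
      abel
    · by_cases hkj : k = j
      · subst hkj
        rw [collide_right ε hij]
        simp [Function.update_of_ne hki, Function.update_of_ne hij, sub_eq_add_neg]
      · rw [collide_of_ne ε hki hkj]
        simp [Function.update_of_ne hki, Function.update_of_ne hkj]
  rw [hcomp]
  exact C

lemma energy_collide {ε : ℝ} (hε : ε ≠ 0) {i j : Fin N} (hij : i ≠ j) (Z : Config d N)
    (h : 0 < disc ε (relState (Z i - Z j)).1 (relState (Z i - Z j)).2) :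
    energy (collide ε i j Z) = energy Z := by
  have hsplit : ∀ W : Config d N, energy W = ‖(W i).2‖ ^ 2 + ‖(W j).2‖ ^ 2 +
      ∑ k ∈ (Finset.univ.erase i).erase j, ‖(W k).2‖ ^ 2 := by
    intro W
    rw [energy, ← Finset.add_sum_erase _ _ (Finset.mem_univ i),
      ← Finset.add_sum_erase (Finset.univ.erase i) _ (Finset.mem_erase.2 ⟨hij.symm, Finset.mem_univ j⟩)]
    ring
  rw [hsplit, hsplit, collide_left ε hij, collide_right ε hij]
  congr 1
  · set y := impact ε (relState (Z i - Z j)).1 (relState (Z i - Z j)).2 with hy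
    have hyy : ‖y‖ ^ 2 = ε ^ 2 := norm_impact_sq h
    have hw : (relState (Z i - Z j)).2 = (Z i).2 - (Z j).2 := rfl
    have hk : kick ε (Z i - Z j) = (1 / ε ^ 2 * inner ℝ y ((Z i).2 - (Z j).2)) • y := rfl
    simp only [Prod.snd_add, Prod.snd_sub, jump, hk]
    set a := 1 / ε ^ 2 * inner ℝ y ((Z i).2 - (Z j).2) with ha
    have ha2 : a * ε ^ 2 = inner ℝ y (Z i).2 - inner ℝ y (Z j).2 := by
      rw [ha, inner_sub_right]; field_simp
    rw [← sub_eq_add_neg, sub_neg_eq_add, norm_sub_sq_real, norm_add_sq_real, inner_smul_right,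
      inner_smul_right, norm_smul, mul_pow, hyy, Real.norm_eq_abs, sq_abs, real_inner_comm y,
      real_inner_comm y]
    linear_combination 2 * a * ha2
  · refine Finset.sum_congr rfl fun k hk => ?_
    simp only [Finset.mem_erase] at hk
    rw [collide_of_ne ε hk.2.1 hk.1]

end Collision

/-! ### Lines crossing a ball. -/

section Line

variable {V : Type*} [NormedAddCommGroup V] [InnerProductSpace ℝ V]

/-- A line penetrating the ball after time `0` enters it at a positive time. -/
lemma entryTime_mem_of_norm_lt {ε : ℝ} (hε : 0 < ε) {x w : V} (hx : ε < ‖x‖) {u : ℝ} (hu : 0 < u)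
    (h : ‖x + u • w‖ < ε) :
    0 < disc ε x w ∧ 0 < entryTime ε x w ∧ entryTime ε x w < u := by
  have h1 : ‖x‖ ^ 2 + 2 * u * inner ℝ x w + u ^ 2 * ‖w‖ ^ 2 < ε ^ 2 := by
    rw [← norm_add_smul_sq]
    exact pow_lt_pow_left₀ h (norm_nonneg _) two_ne_zero
  have h2 : ε ^ 2 < ‖x‖ ^ 2 := pow_lt_pow_left₀ hx hε.le two_ne_zero
  set b : ℝ := inner ℝ x w with hb
  have hw : w ≠ 0 := by
    rintro rfl
    simp [hb] at h1
    linarith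
  have ha : 0 < ‖w‖ ^ 2 := by positivity
  set a := ‖w‖ ^ 2
  have hdef : disc ε x w = b ^ 2 - a * (‖x‖ ^ 2 - ε ^ 2) := rfl
  have hbneg : b < 0 := by
    by_contra hcon
    push Not at hcon
    have : 0 ≤ 2 * u * b := by positivity
    have : 0 ≤ u ^ 2 * a := by positivity
    linarith
  -- Completing the square: a (‖x + u w‖² - ε²) = (a u + b)² - disc.
  have hd1 : (a * u + b) ^ 2 < disc ε x w := by
    rw [hdef]; nlinarith
  have hd2 : disc ε x w < b ^ 2 := by rw [hdef]; nlinarith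
  have hd : 0 < disc ε x w := lt_of_le_of_lt (sq_nonneg _) hd1
  have hs1 : |a * u + b| < Real.sqrt (disc ε x w) := Real.lt_sqrt_of_sq_lt (by rwa [sq_abs])
  have hs2 : Real.sqrt (disc ε x w) < -b := (Real.sqrt_lt' (by linarith)).2 (by nlinarith)
  refine ⟨hd, ?_, ?_⟩
  · exact div_pos (by linarith) ha
  · rw [entryTime, div_lt_iff₀ ha]
    have := (abs_lt.1 hs1).1
    nlinarith

/-- The relative position before (`r ≤ 0`) and after (`0 ≤ r`) the collision. -/
lemma norm_impact_add_smul_sq {ε : ℝ} (hε : 0 < ε) {x w : V} (h : 0 < disc ε x w) (r : ℝ) :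
    ‖impact ε x w + r • reflect ε (impact ε x w) w‖ ^ 2 =
      ε ^ 2 - 2 * r * inner ℝ (impact ε x w) w + r ^ 2 * ‖w‖ ^ 2 := by
  rw [norm_add_smul_sq, norm_reflect hε (norm_impact hε h), norm_impact hε h,
    inner_reflect hε (norm_impact hε h)]
  ring

end Line

/-! ### One short time step: at most one collision, no increase of volume. -/

section Step

variable {d N : ℕ}

/-- Unordered pairs of particles. -/
abbrev Pair (N : ℕ) : Type := {p : Fin N × Fin N // p.1 < p.2}

/-- The distance of a pair of particles. -/
def pgap (Z : Config d N) (p : Pair N) : ℝ := gap Z p.1.1 p.1.2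

/-- The pair `p` penetrates under free transport during the time `s`. -/
def pen (ε s : ℝ) (p : Pair N) : Set (Config d N) :=
  {Z | ∃ u ∈ Set.Ioo 0 s, pgap (freeFlow u Z) p < ε}

/-- The pair `p` penetrates under backward free transport during the time `s`. -/
def penBack (ε s : ℝ) (p : Pair N) : Set (Config d N) :=
  {Z | ∃ u ∈ Set.Ioo 0 s, pgap (freeFlow (-u) Z) p < ε}

/-- Configurations of bounded energy where at most one pair may collide during the time `s`. -/
def good (ε s R : ℝ) : Set (Config d N) :=
  {Z | (∀ i j, i ≠ j → ε < gap Z i j) ∧ energy Z ≤ R ^ 2 ∧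
    ∀ p q : Pair N, pgap Z p ≤ ε + 4 * R * s → pgap Z q ≤ ε + 4 * R * s → p = q}

/-- The transition during the time `s` for good configurations. -/
def step (ε s : ℝ) (Z : Config d N) : Config d N :=
  freeFlow s (Z + ∑ p : Pair N, (pen ε s p).indicator (fun Z => collide ε p.1.1 p.1.2 Z - Z) Z)

lemma continuous_pgap (p : Pair N) : Continuous fun Z : Config d N => pgap Z p :=
  continuous_gap _ _

lemma isOpen_pen (ε s : ℝ) (p : Pair N) : IsOpen (pen ε s p : Set (Config d N)) := by
  have : (pen ε s p : Set (Config d N)) = ⋃ u ∈ Set.Ioo 0 s, {Z | pgap (freeFlow u Z) p < ε} := by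
    ext Z; simp [pen]
  rw [this]
  refine isOpen_biUnion fun u _ => isOpen_lt ?_ continuous_const
  exact (continuous_pgap p).comp (continuous_freeFlow u)

lemma isOpen_penBack (ε s : ℝ) (p : Pair N) : IsOpen (penBack ε s p : Set (Config d N)) := by
  have : (penBack ε s p : Set (Config d N)) =
      ⋃ u ∈ Set.Ioo 0 s, {Z | pgap (freeFlow (-u) Z) p < ε} := by
    ext Z; simp [penBack]
  rw [this]
  refine isOpen_biUnion fun u _ => isOpen_lt ?_ continuous_const
  exact (continuous_pgap p).comp (continuous_freeFlow _)

lemma measurable_energy : Measurable (energy : Config d N → ℝ) := by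
  unfold energy; fun_prop

lemma measurableSet_good (ε s R : ℝ) : MeasurableSet (good ε s R : Set (Config d N)) := by
  refine MeasurableSet.inter ?_ (MeasurableSet.inter ?_ ?_)
  · have : {Z : Config d N | ∀ i j, i ≠ j → ε < gap Z i j} =
        ⋂ i, ⋂ j, ⋂ _ : i ≠ j, {Z | ε < gap Z i j} := by ext; simp
    change MeasurableSet {Z : Config d N | ∀ i j, i ≠ j → ε < gap Z i j}
    rw [this]
    exact MeasurableSet.iInter fun i => MeasurableSet.iInter fun j => MeasurableSet.iInter fun _ =>
      (isOpen_lt continuous_const (continuous_gap i j)).measurableSet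
  · exact measurableSet_le measurable_energy measurable_const
  · change MeasurableSet {Z : Config d N | ∀ p q : Pair N, pgap Z p ≤ ε + 4 * R * s →
      pgap Z q ≤ ε + 4 * R * s → p = q}
    have : {Z : Config d N | ∀ p q : Pair N, pgap Z p ≤ ε + 4 * R * s →
        pgap Z q ≤ ε + 4 * R * s → p = q} = ⋂ p : Pair N, ⋂ q : Pair N, ⋂ _ : p ≠ q,
          ({Z | pgap Z p ≤ ε + 4 * R * s} ∩ {Z | pgap Z q ≤ ε + 4 * R * s})ᶜ := by
      ext Z
      simp only [Set.mem_ofPred_eq, Set.mem_iInter, Set.mem_compl_iff, Set.mem_inter_iff, not_and]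
      exact ⟨fun h p q hpq h1 h2 => hpq (h p q h1 h2), fun h p q h1 h2 => by
        by_contra hpq; exact h p q hpq h1 h2⟩
    rw [this]
    exact MeasurableSet.iInter fun p => MeasurableSet.iInter fun q => MeasurableSet.iInter fun _ =>
      (((isClosed_le (continuous_pgap p) continuous_const).measurableSet).inter
        ((isClosed_le (continuous_pgap q) continuous_const).measurableSet)).compl

lemma measurable_step (ε s : ℝ) : Measurable (step ε s : Config d N → Config d N) := by
  refine (continuous_freeFlow s).measurable.comp (measurable_id.add ?_)
  refine Finset.measurable_fun_sum _ fun p _ => ?_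
  exact ((measurable_collide ε _ _).sub measurable_id).indicator (isOpen_pen ε s p).measurableSet

variable {ε s R : ℝ}

lemma gap_le_gap_freeFlow_add (hR : 0 ≤ R) {Z : Config d N} (hE : energy Z ≤ R ^ 2) (i j : Fin N)
    {u : ℝ} (hu : 0 ≤ u) (hus : u ≤ s) : gap Z i j ≤ gap (freeFlow u Z) i j + 2 * R * s := by
  refine (torusDist_add_proj_le (Z i).1 (Z j).1 (u • (Z i).2) (u • (Z j).2)).trans ?_
  have h1 := norm_relVel_le hR hE i j
  have h2 : ‖u • (Z i).2 - u • (Z j).2‖ ≤ 2 * R * s := by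
    rw [← smul_sub, norm_smul, Real.norm_eq_abs, abs_of_nonneg hu, mul_comm]
    exact mul_le_mul h1 hus hu (by linarith)
  gcongr
  rfl

lemma pgap_le_of_pen (hR : 0 ≤ R) {Z : Config d N} (hE : energy Z ≤ R ^ 2) {p : Pair N}
    (hp : Z ∈ pen ε s p) : pgap Z p ≤ ε + 2 * R * s := by
  obtain ⟨u, hu, h⟩ := hp
  have := gap_le_gap_freeFlow_add hR hE p.1.1 p.1.2 hu.1.le hu.2.le
  unfold pgap at h ⊢
  linarith

/-- Relative speeds are at most 2R, so a penetrating pair starts within ε + 2Rs and uses up the only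
close pair allowed by `good`. -/
lemma good.pen_unique (hR : 0 ≤ R) (hs : 0 ≤ s) {Z : Config d N} (hZ : Z ∈ good ε s R)
    {p q : Pair N} (hp : Z ∈ pen ε s p) (hq : pgap Z q ≤ ε + 4 * R * s) : p = q := by
  have h := pgap_le_of_pen hR hZ.2.1 hp
  have hRs := mul_nonneg hR hs
  exact hZ.2.2 p q (by linarith) hq

lemma step_of_not_pen {Z : Config d N} (h : ∀ p, Z ∉ pen ε s p) :
    step ε s Z = freeFlow s Z := by
  rw [step, Finset.sum_eq_zero, add_zero]
  intro p _
  rw [Set.indicator_of_notMem (h p)]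

lemma good.step_of_pen (hR : 0 ≤ R) (hs : 0 ≤ s) {Z : Config d N} (hZ : Z ∈ good ε s R)
    {p : Pair N} (hp : Z ∈ pen ε s p) :
    step ε s Z = freeFlow s (collide ε p.1.1 p.1.2 Z) := by
  rw [step, Finset.sum_eq_single p]
  · rw [Set.indicator_of_mem hp]; simp
  · intro q _ hq
    refine Set.indicator_of_notMem (fun h => hq ?_) _
    have h1 := pgap_le_of_pen hR hZ.2.1 h
    have hRs := mul_nonneg hR hs
    exact (good.pen_unique hR hs hZ hp (by linarith)).symm
  · simp

/-- In a good configuration, a pair that penetrates does have a collision. -/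
lemma good.entry (hε : 0 < ε) (hR : 0 ≤ R) (hs' : ε + 4 * R * s < 1 / 2)
    {Z : Config d N} (hZ : Z ∈ good ε s R) {p : Pair N} (hp : Z ∈ pen ε s p) :
    0 < disc ε (relState (Z p.1.1 - Z p.1.2)).1 (relState (Z p.1.1 - Z p.1.2)).2 ∧
    0 < entryTime ε (relState (Z p.1.1 - Z p.1.2)).1 (relState (Z p.1.1 - Z p.1.2)).2 ∧
    entryTime ε (relState (Z p.1.1 - Z p.1.2)).1 (relState (Z p.1.1 - Z p.1.2)).2 < s := by
  have hg := pgap_le_of_pen hR hZ.2.1 hp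
  obtain ⟨u, hu, h⟩ := hp
  have hx : ε < ‖(relState (Z p.1.1 - Z p.1.2)).1‖ := by
    rw [← gap_eq]; exact hZ.1 _ _ p.2.ne
  rw [pgap, gap_eq] at hg
  rw [pgap, gap_freeFlow_eq] at h
  · obtain ⟨h1, h2, h3⟩ := entryTime_mem_of_norm_lt hε hx hu.1 h
    exact ⟨h1, h2, h3.trans hu.2⟩
  · refine lt_of_le_of_lt (b := (ε + 2 * R * s) + 2 * R * s) ((norm_add_le _ _).trans ?_)
      (by linarith)
    rw [norm_smul, Real.norm_eq_abs, abs_of_pos hu.1, mul_comm]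
    have h1 := norm_relVel_le hR hZ.2.1 p.1.1 p.1.2
    exact add_le_add hg (mul_le_mul h1 hu.2.le hu.1.le (by linarith))

lemma freeFlow_collide_sub_fst (hε : 0 < ε) {i j : Fin N} (hij : i ≠ j) {Z : Config d N}
    (h : 0 < disc ε (relState (Z i - Z j)).1 (relState (Z i - Z j)).2) (u : ℝ) :
    (freeFlow u (collide ε i j Z) i).1 - (freeFlow u (collide ε i j Z) j).1 =
      proj (impact ε (relState (Z i - Z j)).1 (relState (Z i - Z j)).2 +
        (u - entryTime ε (relState (Z i - Z j)).1 (relState (Z i - Z j)).2) •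
          reflect ε (impact ε (relState (Z i - Z j)).1 (relState (Z i - Z j)).2)
            (relState (Z i - Z j)).2) := by
  rw [← scatter_add_smul hε h, proj_add]
  have h1 : collide ε i j Z i - collide ε i j Z j = Z i - Z j + (2 : ℕ) • jump ε (Z i - Z j) := by
    rw [collide_left ε hij, collide_right ε hij, two_smul]; abel
  rw [scatter_relState ε _ h] at h1
  have h2 := congrArg Prod.fst h1
  have h3 := congrArg Prod.snd h1
  simp only at h2 h3
  rw [Prod.mk.eta, ← h2, ← h3]
  simp only [freeFlow, Prod.fst_sub, Prod.snd_sub, smul_sub, proj_sub]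
  abel

/-- The displacement of the particles. -/
lemma good.exists_displacement (hε : 0 < ε) (hR : 0 ≤ R) (hs' : ε + 4 * R * s < 1 / 2)
    {Z : Config d N} (hZ : Z ∈ good ε s R) {p : Pair N} (hp : Z ∈ pen ε s p) {v : ℝ} (hv : 0 ≤ v)
    (hvs : v ≤ s) (k : Fin N) :
    ∃ a : EuclideanSpace ℝ (Fin d), ‖a‖ ≤ 2 * R * s ∧
      (freeFlow v (collide ε p.1.1 p.1.2 Z) k).1 = (Z k).1 + proj a := by
  obtain ⟨hd, ht0, hts⟩ := good.entry hε hR hs' hZ hp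
  have hE := energy_collide hε.ne' p.2.ne Z hd
  have hvel := norm_vel_le hR hZ.2.1 k
  have hvel' := norm_vel_le hR (hE.le.trans hZ.2.1) k
  set t := entryTime ε (relState (Z p.1.1 - Z p.1.2)).1 (relState (Z p.1.1 - Z p.1.2)).2
  -- For v < t the outgoing line is followed backwards, hence |v - t| and the bound 2Rs rather than
  -- Rs.
  have hbound : ‖t • (Z k).2 + (v - t) • (collide ε p.1.1 p.1.2 Z k).2‖ ≤ 2 * R * s := by
    refine (norm_add_le _ _).trans ?_
    rw [norm_smul, norm_smul, Real.norm_eq_abs, Real.norm_eq_abs, abs_of_pos ht0]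
    have h1 : t * ‖(Z k).2‖ ≤ s * R := mul_le_mul hts.le hvel (norm_nonneg _) (by linarith)
    have h2 : |v - t| * ‖(collide ε p.1.1 p.1.2 Z k).2‖ ≤ s * R :=
      mul_le_mul (abs_le.2 ⟨by linarith, by linarith⟩) hvel' (norm_nonneg _) (by linarith)
    linarith
  refine ⟨_, hbound, ?_⟩
  by_cases h1 : k = p.1.1
  · subst h1
    have e : t • (Z p.1.1).2 + (v - t) • (collide ε p.1.1 p.1.2 Z p.1.1).2 =
        t • kick ε (Z p.1.1 - Z p.1.2) + v • (collide ε p.1.1 p.1.2 Z p.1.1).2 := by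
      rw [collide_left ε p.2.ne]
      simp only [Prod.snd_add, jump]
      module
    rw [e, proj_add]
    conv_lhs => rw [freeFlow]
    simp only
    rw [← add_assoc]
    congr 1
    rw [collide_left ε p.2.ne]
    rfl
  · by_cases h2 : k = p.1.2
    · subst h2
      have e : t • (Z p.1.2).2 + (v - t) • (collide ε p.1.1 p.1.2 Z p.1.2).2 =
          -(t • kick ε (Z p.1.1 - Z p.1.2)) + v • (collide ε p.1.1 p.1.2 Z p.1.2).2 := by
        rw [collide_right ε p.2.ne]
        simp only [Prod.snd_sub, jump]
        module
      rw [e, proj_add]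
      conv_lhs => rw [freeFlow]
      simp only
      rw [← add_assoc]
      congr 1
      rw [collide_right ε p.2.ne, proj_neg]
      exact sub_eq_add_neg _ _
    · rw [collide_of_ne ε h1 h2]
      simp only [freeFlow, collide_of_ne ε h1 h2]
      congr 2
      module

/-- The pairs that do not collide stay apart. -/
lemma good.gap_other (hε : 0 < ε) (hR : 0 ≤ R) (hs : 0 ≤ s) (hs' : ε + 4 * R * s < 1 / 2)
    {Z : Config d N} (hZ : Z ∈ good ε s R) {p q : Pair N} (hp : Z ∈ pen ε s p) (hpq : p ≠ q)
    {v : ℝ} (hv : 0 ≤ v) (hvs : v ≤ s) :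
    ε < pgap (freeFlow v (collide ε p.1.1 p.1.2 Z)) q := by
  obtain ⟨a, ha, ha'⟩ := good.exists_displacement hε hR hs' hZ hp hv hvs q.1.1
  obtain ⟨b, hb, hb'⟩ := good.exists_displacement hε hR hs' hZ hp hv hvs q.1.2
  have h1 : ε + 4 * R * s < pgap Z q := by
    by_contra hcon
    exact hpq (good.pen_unique hR hs hZ hp (not_lt.1 hcon))
  -- Both particles of q are displaced by at most 2Rs; this is what the margin 4Rs in `good` pays
  -- for.
  have h2 := torusDist_add_proj_le (Z q.1.1).1 (Z q.1.2).1 a b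
  have h3 := (norm_sub_le a b).trans (add_le_add ha hb)
  rw [pgap, gap, ha', hb']
  rw [pgap, gap] at h1
  linarith

/-- The outgoing relative velocity points outwards, so the outgoing line followed backwards beyond
the impact enters the ball. The pair that collided can therefore be read off the final
configuration. -/
lemma good.step_mem_penBack (hε : 0 < ε) (hR : 0 ≤ R) (hs : 0 ≤ s) (hs' : ε + 4 * R * s < 1 / 2)
    {Z : Config d N} (hZ : Z ∈ good ε s R) {p : Pair N} (hp : Z ∈ pen ε s p) :
    step ε s Z ∈ penBack ε s p := by
  obtain ⟨hd, ht0, hts⟩ := good.entry hε hR hs' hZ hp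
  have key := norm_impact_add_smul_sq hε hd
  have key2 := freeFlow_collide_sub_fst hε p.2.ne hd
  have hin := inner_impact_neg hd
  have hw : 0 < ‖(relState (Z p.1.1 - Z p.1.2)).2‖ ^ 2 := by
    have := ne_zero_of_disc_pos hd; positivity
  rw [good.step_of_pen hR hs hZ hp]
  set x := (relState (Z p.1.1 - Z p.1.2)).1
  set w := (relState (Z p.1.1 - Z p.1.2)).2
  set t := entryTime ε x w
  set b : ℝ := -inner ℝ (impact ε x w) w with hb
  -- A time r before the impact, the squared distance on the outgoing line is ε² - 2rb + r²‖w‖²,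
  -- below ε² for small r.
  obtain ⟨r, hr0, hrt, hrb⟩ : ∃ r, 0 < r ∧ r < t ∧ r * ‖w‖ ^ 2 < 2 * b := by
    refine ⟨min (t / 2) (b / ‖w‖ ^ 2), ?_, ?_, ?_⟩
    · exact lt_min (by linarith) (div_pos (by linarith) hw)
    · exact (min_le_left _ _).trans_lt (by linarith)
    · calc min (t / 2) (b / ‖w‖ ^ 2) * ‖w‖ ^ 2 ≤ b / ‖w‖ ^ 2 * ‖w‖ ^ 2 := by
            gcongr; exact min_le_right _ _
        _ = b := div_mul_cancel₀ _ hw.ne'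
        _ < 2 * b := by linarith
  refine ⟨s - (t - r), ⟨by linarith, by linarith⟩, ?_⟩
  rw [← freeFlow_add, pgap, gap, torusDist_eq, key2]
  refine (norm_sec_proj_le _).trans_lt ?_
  refine lt_of_pow_lt_pow_left₀ 2 hε.le ?_
  rw [key]
  have : -(s - (t - r)) + s - t = -r := by ring
  rw [this]
  have : inner ℝ (impact ε x w) w = -b := by rw [hb]; ring
  rw [this]
  nlinarith

lemma good.step_notMem_penBack (hε : 0 < ε) (hR : 0 ≤ R) (hs : 0 ≤ s)
    (hs' : ε + 4 * R * s < 1 / 2)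
    {Z : Config d N} (hZ : Z ∈ good ε s R) {p q : Pair N} (hp : Z ∈ pen ε s p) (hpq : p ≠ q) :
    step ε s Z ∉ penBack ε s q := by
  rw [good.step_of_pen hR hs hZ hp]
  rintro ⟨u, hu, h⟩
  rw [← freeFlow_add] at h
  exact (good.gap_other hε hR hs hs' hZ hp hpq (v := -u + s) (by linarith [hu.2]) (by linarith [hu.1])).not_gt h

lemma step_notMem_penBack_of_not_pen {Z : Config d N} (h : ∀ p, Z ∉ pen ε s p) (q : Pair N) :
    step ε s Z ∉ penBack ε s q := by
  rw [step_of_not_pen h]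
  rintro ⟨u, hu, h'⟩
  rw [← freeFlow_add] at h'
  exact h q ⟨-u + s, ⟨by linarith [hu.2], by linarith [hu.1]⟩, h'⟩

/-- Bounds on the separate pieces add up without a multiplicity factor because the images fall into
disjoint sets. -/
lemma measure_le_of_pieces {α ι : Type*} [MeasurableSpace α] {μ : Measure α} [Finite ι]
    {G : Set α} {T : α → α} (P D : ι → Set α) (hcov : G ⊆ ⋃ i, P i) (hD : ∀ i, MeasurableSet (D i))
    (hdis : Pairwise (Function.onFun Disjoint D)) {A : Set α} (hA : MeasurableSet A)
    (h : ∀ i, μ (G ∩ P i ∩ T ⁻¹' A) ≤ μ (A ∩ D i)) : μ (G ∩ T ⁻¹' A) ≤ μ A := by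
  have := Fintype.ofFinite ι
  calc μ (G ∩ T ⁻¹' A) ≤ μ (⋃ i, (G ∩ P i ∩ T ⁻¹' A)) := by
        refine measure_mono fun x hx => ?_
        obtain ⟨i, hi⟩ := Set.mem_iUnion.1 (hcov hx.1)
        exact Set.mem_iUnion.2 ⟨i, ⟨hx.1, hi⟩, hx.2⟩
    _ ≤ ∑ i, μ (G ∩ P i ∩ T ⁻¹' A) := by
        rw [← tsum_fintype (L := .unconditional _)]; exact measure_iUnion_le _
    _ ≤ ∑ i, μ (A ∩ D i) := Finset.sum_le_sum fun i _ => h i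
    _ = μ (⋃ i, A ∩ D i) := by
        rw [measure_iUnion, tsum_fintype]
        · exact fun i j hij => (hdis hij).mono Set.inter_subset_right Set.inter_subset_right
        · exact fun i => hA.inter (hD i)
    _ ≤ μ A := measure_mono (Set.iUnion_subset fun i => Set.inter_subset_left)

/-- The transition map is volume nonincreasing on good configurations. -/
lemma volume_good_inter_preimage_step_le (hε : 0 < ε) (hR : 0 ≤ R) (hs : 0 ≤ s)
    (hs' : ε + 4 * R * s < 1 / 2) {A : Set (Config d N)} (hA : MeasurableSet A) :
    volume (good ε s R ∩ step ε s ⁻¹' A) ≤ volume A := by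
  -- The pieces record which pair collides, `none` standing for no collision; their images are
  -- separated by the pair that penetrates backwards.
  let P : Option (Pair N) → Set (Config d N) := fun o => o.elim (⋂ q, (pen ε s q)ᶜ) (pen ε s)
  let D : Option (Pair N) → Set (Config d N) := fun o =>
    o.elim (⋂ q, (penBack ε s q)ᶜ) fun p => penBack ε s p \ ⋃ q, ⋃ _ : q ≠ p, penBack ε s q
  refine measure_le_of_pieces P D ?_ ?_ ?_ hA ?_
  · intro Z _
    by_cases h : ∃ p, Z ∈ pen ε s p
    · obtain ⟨p, hp⟩ := h
      exact Set.mem_iUnion.2 ⟨some p, hp⟩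
    · exact Set.mem_iUnion.2 ⟨none, Set.mem_iInter.2 fun p hp => h ⟨p, hp⟩⟩
  · rintro (_ | p)
    · exact MeasurableSet.iInter fun q => (isOpen_penBack ε s q).measurableSet.compl
    · exact (isOpen_penBack ε s p).measurableSet.diff (MeasurableSet.iUnion fun q =>
        MeasurableSet.iUnion fun _ => (isOpen_penBack ε s q).measurableSet)
  · rintro (_ | p) (_ | q) hpq
    · exact absurd rfl hpq
    · exact Set.disjoint_left.2 fun Z h1 h2 => Set.mem_iInter.1 h1 q h2.1
    · exact Set.disjoint_left.2 fun Z h1 h2 => Set.mem_iInter.1 h2 p h1.1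
    · refine Set.disjoint_left.2 fun Z h1 h2 => h2.2 ?_
      exact Set.mem_iUnion₂.2 ⟨p, fun h => hpq (by rw [h]), h1.1⟩
  · rintro (_ | p)
    · have hm : MeasurableSet (A ∩ D none) := hA.inter
        (MeasurableSet.iInter fun q => (isOpen_penBack ε s q).measurableSet.compl)
      rw [← (measurePreserving_freeFlow s).measure_preimage hm.nullMeasurableSet]
      refine measure_mono ?_
      rintro Z ⟨⟨-, h1⟩, h2⟩
      have h3 : ∀ p, Z ∉ pen ε s p := fun p => Set.mem_iInter.1 h1 p
      have h4 : step ε s Z ∈ A ∩ D none :=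
        ⟨h2, Set.mem_iInter.2 fun q => step_notMem_penBack_of_not_pen h3 q⟩
      rwa [step_of_not_pen h3] at h4
    · have hm : MeasurableSet (A ∩ D (some p)) := hA.inter
        ((isOpen_penBack ε s p).measurableSet.diff (MeasurableSet.iUnion fun q =>
        MeasurableSet.iUnion fun _ => (isOpen_penBack ε s q).measurableSet))
      rw [← (measurePreserving_freeFlow s).measure_preimage hm.nullMeasurableSet]
      have hm2 := (measurePreserving_freeFlow (d := d) (N := N) s).measurable hm
      refine le_trans ?_ (map_collide_restrict_le (d := d) (s := s) (R := R) hε (by nlinarith) p.2.ne _)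
      rw [Measure.map_apply (measurable_collide ε _ _) hm2,
        Measure.restrict_apply (measurable_collide ε _ _ hm2)]
      refine measure_mono ?_
      rintro Z ⟨⟨hZ, hp⟩, h2⟩
      obtain ⟨hd, ht0, hts⟩ := good.entry hε hR hs' hZ hp
      refine ⟨?_, hd, ⟨ht0.le, hts.le⟩, norm_relVel_le hR hZ.2.1 _ _⟩
      have h4 : step ε s Z ∈ A ∩ D (some p) := by
        refine ⟨h2, good.step_mem_penBack hε hR hs hs' hZ hp, fun h => ?_⟩
        obtain ⟨q, hq, h⟩ := Set.mem_iUnion₂.1 h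
        exact good.step_notMem_penBack hε hR hs hs' hZ hp (Ne.symm hq) h
      rwa [good.step_of_pen hR hs hZ hp] at h4

end Step

/-! ### Trajectories on bounded intervals: gluing and uniqueness. -/

section Trajectories

variable {d N : ℕ}

/-- The collision law of `IsTrajectory` at time `t`. -/
def CollisionAt (ε : ℝ) (Y : ℝ → Config d N) (t : ℝ) : Prop :=
  ∃ i j, i ≠ j ∧
    (∀ k l, k ≠ l → torusDist (Y t k).1 (Y t l).1 = ε → (k = i ∧ l = j) ∨ (k = j ∧ l = i)) ∧
    ∃ n : EuclideanSpace ℝ (Fin d), ‖n‖ = ε ∧ proj n = (Y t i).1 - (Y t j).1 ∧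
      ∀ s, 0 ≤ s → s < t → (∀ u, s < u → u < t → ¬ InContact ε (Y u)) →
        (Y t i).2 = (Y s i).2 - (1 / ε ^ 2 * inner ℝ ((Y s i).2 - (Y s j).2) n) • n ∧
        (Y t j).2 = (Y s j).2 + (1 / ε ^ 2 * inner ℝ ((Y s i).2 - (Y s j).2) n) • n ∧
        ∀ k, k ≠ i → k ≠ j → (Y t k).2 = (Y s k).2

/-- Trajectories on the time interval `[0, T]`. -/
structure IsTrajOn (ε T : ℝ) (Y : ℝ → Config d N) : Prop where
  exclusion : ∀ t, 0 ≤ t → t ≤ T → ∀ i j, i ≠ j → ε ≤ torusDist (Y t i).1 (Y t j).1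
  finite_contact : {t | 0 ≤ t ∧ t ≤ T ∧ InContact ε (Y t)}.Finite
  free_pos : ∀ s t, 0 ≤ s → s ≤ t → t ≤ T → (∀ u, s < u → u < t → ¬ InContact ε (Y u)) →
    ∀ i, (Y t i).1 = (Y s i).1 + proj ((t - s) • (Y s i).2)
  free_vel : ∀ s t, 0 ≤ s → s ≤ t → t ≤ T → (∀ u, s < u → u ≤ t → ¬ InContact ε (Y u)) →
    ∀ i, (Y t i).2 = (Y s i).2
  collision : ∀ t, 0 < t → t ≤ T → InContact ε (Y t) → CollisionAt ε Y t

lemma IsTrajectory.isTrajOn {ε : ℝ} {Y : ℝ → Config d N} (h : IsTrajectory ε Y) (T : ℝ) :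
    IsTrajOn ε T Y :=
  ⟨fun t ht _ => h.exclusion t ht, h.finite_contact T, fun s t hs hst _ => h.free_pos s t hs hst,
    fun s t hs hst _ => h.free_vel s t hs hst, fun t ht _ => h.collision t ht⟩

lemma isTrajectory_of_forall_isTrajOn {ε : ℝ} {Y : ℝ → Config d N} (h : ∀ T, IsTrajOn ε T Y) :
    IsTrajectory ε Y :=
  ⟨fun t ht => (h t).exclusion t ht le_rfl, fun T => (h T).finite_contact,
    fun s t hs hst => (h t).free_pos s t hs hst le_rfl,
    fun s t hs hst => (h t).free_vel s t hs hst le_rfl,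
    fun t ht => (h t).collision t ht le_rfl⟩

lemma CollisionAt.congr {ε : ℝ} {Y Y' : ℝ → Config d N} {t : ℝ}
    (h : ∀ u, 0 ≤ u → u ≤ t → Y u = Y' u) (ht : 0 ≤ t) (hc : CollisionAt ε Y t) :
    CollisionAt ε Y' t := by
  obtain ⟨i, j, hij, h1, n, hn, hn', h2⟩ := hc
  rw [CollisionAt, ← h t ht le_rfl]
  refine ⟨i, j, hij, h1, n, hn, hn', fun s hs hst hfree => ?_⟩
  rw [← h s hs hst.le]
  exact h2 s hs hst fun u hsu hut => by rw [h u (hs.trans hsu.le) hut.le]; exact hfree u hsu hut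

lemma IsTrajOn.congr {ε T : ℝ} {Y Y' : ℝ → Config d N} (h : ∀ u, 0 ≤ u → u ≤ T → Y u = Y' u)
    (hY : IsTrajOn ε T Y) : IsTrajOn ε T Y' where
  exclusion t ht htT := by rw [← h t ht htT]; exact hY.exclusion t ht htT
  finite_contact := by
    refine hY.finite_contact.subset ?_
    rintro t ⟨h1, h2, h3⟩
    exact ⟨h1, h2, by rwa [h t h1 h2]⟩
  free_pos s t hs hst htT hf := by
    rw [← h t (hs.trans hst) htT, ← h s hs (hst.trans htT)]
    exact hY.free_pos s t hs hst htT fun u h1 h2 => by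
      rw [h u (hs.trans h1.le) (h2.le.trans htT)]; exact hf u h1 h2
  free_vel s t hs hst htT hf := by
    rw [← h t (hs.trans hst) htT, ← h s hs (hst.trans htT)]
    exact hY.free_vel s t hs hst htT fun u h1 h2 => by
      rw [h u (hs.trans h1.le) (h2.trans htT)]; exact hf u h1 h2
  collision t ht htT hc := by
    rw [← h t ht.le htT] at hc
    exact (hY.collision t ht htT hc).congr (fun u h1 h2 => h u h1 (h2.trans htT)) ht.le

lemma IsTrajOn.mono {ε T T' : ℝ} {Y : ℝ → Config d N} (h : T' ≤ T) (hY : IsTrajOn ε T Y) :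
    IsTrajOn ε T' Y where
  exclusion t ht htT := hY.exclusion t ht (htT.trans h)
  finite_contact := hY.finite_contact.subset fun _ ⟨h1, h2, h3⟩ => ⟨h1, h2.trans h, h3⟩
  free_pos s t hs hst htT := hY.free_pos s t hs hst (htT.trans h)
  free_vel s t hs hst htT := hY.free_vel s t hs hst (htT.trans h)
  collision t ht htT := hY.collision t ht (htT.trans h)

/-- Trajectories can be glued at times without contact. -/
lemma IsTrajOn.concat {ε a b : ℝ} {Y Y' : ℝ → Config d N} (ha : 0 ≤ a) (hY : IsTrajOn ε a Y)
    (hY' : IsTrajOn ε b Y') (h0 : Y' 0 = Y a) (hc : ¬ InContact ε (Y a)) :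
    IsTrajOn ε (a + b) fun u => if u ≤ a then Y u else Y' (u - a) := by
  set W : ℝ → Config d N := fun u => if u ≤ a then Y u else Y' (u - a) with hW
  have W1 : ∀ u, u ≤ a → W u = Y u := fun u hu => if_pos hu
  have W2 : ∀ u, a ≤ u → W u = Y' (u - a) := fun u hu => by
    rcases hu.eq_or_lt with rfl | hu
    · rw [W1 a le_rfl, sub_self, h0]
    · exact if_neg (not_le.2 hu)
  have hv1 : ∀ s, 0 ≤ s → s ≤ a → (∀ u, s < u → u < a → ¬ InContact ε (W u)) →
      ∀ i, (W s i).2 = (W a i).2 := fun s hs hsa hf i => by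
    rw [W1 s hsa, W1 a le_rfl]
    refine (hY.free_vel s a hs hsa le_rfl (fun u h1 h2 => ?_) i).symm
    rcases h2.eq_or_lt with rfl | h2
    · exact hc
    · rw [← W1 u h2.le]; exact hf u h1 h2
  constructor
  · intro t ht htT
    rcases le_total t a with h | h
    · rw [W1 t h]; exact hY.exclusion t ht h
    · rw [W2 t h]; exact hY'.exclusion _ (by linarith) (by linarith)
  · refine ((hY.finite_contact).union ((hY'.finite_contact).image fun u => u + a)).subset ?_
    rintro t ⟨h1, h2, h3⟩
    rcases le_total t a with h | h
    · rw [W1 t h] at h3; exact Or.inl ⟨h1, h, h3⟩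
    · rw [W2 t h] at h3
      exact Or.inr ⟨t - a, ⟨by linarith, by linarith, h3⟩, by simp⟩
  · intro s t hs hst htT hf i
    rcases le_total t a with h | h
    · rw [W1 t h, W1 s (hst.trans h)]
      exact hY.free_pos s t hs hst h (fun u h1 h2 => by
        rw [← W1 u (h2.le.trans h)]; exact hf u h1 h2) i
    · have key : ∀ r, a ≤ r → r ≤ t → (∀ u, r < u → u < t → ¬ InContact ε (W u)) →
          (W t i).1 = (W r i).1 + proj ((t - r) • (W r i).2) := fun r hr hrt hf' => by
        rw [W2 t h, W2 r hr]
        have := hY'.free_pos (r - a) (t - a) (by linarith) (by linarith) (by linarith)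
          (fun u h1 h2 => by
            have := hf' (u + a) (by linarith) (by linarith)
            rwa [W2 _ (by linarith), add_sub_cancel_right] at this) i
        rwa [sub_sub_sub_cancel_right] at this
      rcases le_total s a with h' | h'
      · rw [key a le_rfl h fun u h1 h2 => hf u (by linarith) h2]
        have hv := hv1 s hs h' (fun u h1 h2 => hf u h1 (by linarith)) i
        have hp := hY.free_pos s a hs h' le_rfl (fun u h1 h2 => by
          rw [← W1 u h2.le]; exact hf u h1 (by linarith)) i
        rw [← hv, W1 s h', W1 a le_rfl, hp, add_assoc, ← proj_add, ← add_smul]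
        congr 3
        ring
      · exact key s h' hst hf
  · intro s t hs hst htT hf i
    rcases le_total t a with h | h
    · rw [W1 t h, W1 s (hst.trans h)]
      exact hY.free_vel s t hs hst h (fun u h1 h2 => by
        rw [← W1 u (h2.trans h)]; exact hf u h1 h2) i
    · have key : ∀ r, a ≤ r → r ≤ t → (∀ u, r < u → u ≤ t → ¬ InContact ε (W u)) →
          (W t i).2 = (W r i).2 := fun r hr hrt hf' => by
        rw [W2 t h, W2 r hr]
        exact hY'.free_vel (r - a) (t - a) (by linarith) (by linarith) (by linarith)
          (fun u h1 h2 => by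
            have := hf' (u + a) (by linarith) (by linarith)
            rwa [W2 _ (by linarith), add_sub_cancel_right] at this) i
      rcases le_total s a with h' | h'
      · rw [key a le_rfl h fun u h1 h2 => hf u (by linarith) h2]
        exact (hv1 s hs h' (fun u h1 h2 => hf u h1 (by linarith)) i).symm
      · exact key s h' hst hf
  · intro t ht htT hct
    rcases le_or_gt t a with h | h
    · rw [W1 t h] at hct
      exact (hY.collision t ht h hct).congr (fun u h1 h2 => (W1 u (h2.trans h)).symm) ht.le
    · rw [W2 t h.le] at hct
      obtain ⟨i, j, hij, h1, n, hn, hn', h2⟩ := hY'.collision (t - a) (by linarith) (by linarith) hct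
      rw [CollisionAt, W2 t h.le]
      refine ⟨i, j, hij, h1, n, hn, hn', fun s hs hst hf => ?_⟩
      have key : ∀ r, a ≤ r → r < t → (∀ u, r < u → u < t → ¬ InContact ε (W u)) → _ :=
        fun r hr hrt hf' => h2 (r - a) (by linarith) (by linarith) (fun u h1 h2 => by
            have := hf' (u + a) (by linarith) (by linarith)
            rwa [W2 _ (by linarith), add_sub_cancel_right] at this)
      rcases le_total s a with h' | h'
      · have hv := hv1 s hs h' (fun u h1 h2 => hf u h1 (by linarith))
        have := key a le_rfl h (fun u h1 h2 => hf u (by linarith) h2)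
        rw [← W2 a le_rfl] at this
        simp only [hv]
        exact this
      · have := key s h' hst hf
        rw [← W2 s h'] at this
        exact this

/-- A vector of norm ε < 1/2 is determined by its projection to the torus, so the collision law
leaves no freedom except the exchange of i and j. The exchange turns n into -n and gives the same
reflected velocities. -/
lemma CollisionAt.vel_eq {ε : ℝ} (hε : ε < 1 / 2) {Y Y' : ℝ → Config d N} {a b : ℝ} (ha : 0 ≤ a)
    (hab : a < b) (h : CollisionAt ε Y b) (h' : CollisionAt ε Y' b)
    (hpos : ∀ i, (Y b i).1 = (Y' b i).1) (ha' : Y a = Y' a)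
    (hf : ∀ u, a < u → u < b → ¬ InContact ε (Y u))
    (hf' : ∀ u, a < u → u < b → ¬ InContact ε (Y' u)) (k : Fin N) :
    (Y b k).2 = (Y' b k).2 := by
  obtain ⟨i, j, hij, h1, n, hn, hn', h2⟩ := h
  obtain ⟨i', j', hij', h1', m, hm, hm', h2'⟩ := h'
  obtain ⟨e1, e2, e3⟩ := h2 a ha hab hf
  obtain ⟨e1', e2', e3'⟩ := h2' a ha hab hf'
  have hnl : sec (proj n) = n := sec_proj_of_norm_lt (hn.trans_lt hε)
  have hml : sec (proj m) = m := sec_proj_of_norm_lt (hm.trans_lt hε)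
  have hd : torusDist (Y' b i).1 (Y' b j).1 = ε := by
    rw [← hpos, ← hpos, torusDist_eq, ← hn', hnl, hn]
  rw [← ha'] at e1' e2' e3'
  rw [← hpos, ← hpos] at hm'
  rcases h1' i j hij hd with ⟨rfl, rfl⟩ | ⟨rfl, rfl⟩
  · have hnm : n = m := by rw [← hnl, ← hml, hn', hm']
    subst hnm
    by_cases hki : k = i
    · subst hki; rw [e1, e1']
    · by_cases hkj : k = j
      · subst hkj; rw [e2, e2']
      · rw [e3 k hki hkj, e3' k hki hkj]
  · have hnm : m = -n := by
      have : proj m = proj (-n) := by rw [hm', proj_neg, hn']; abel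
      rw [← hml, this, sec_proj_of_norm_lt (by rw [norm_neg]; exact hn.trans_lt hε)]
    subst hnm
    have hin : (inner ℝ ((Y a j).2 - (Y a i).2) (-n) : ℝ) = inner ℝ ((Y a i).2 - (Y a j).2) n := by
      rw [inner_neg_right, ← inner_neg_left, neg_sub]
    rw [hin, smul_neg] at e1' e2'
    by_cases hki : k = i
    · subst hki; rw [e1, e2']; abel
    · by_cases hkj : k = j
      · subst hkj; rw [e2, e1']; abel
      · rw [e3 k hki hkj, e3' k hkj hki]

/-- Trajectories are determined by their initial configuration. -/
lemma IsTrajOn.unique {ε T : ℝ} (hε : ε < 1 / 2) {Y Y' : ℝ → Config d N} (hY : IsTrajOn ε T Y)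
    (hY' : IsTrajOn ε T Y') (h0 : Y 0 = Y' 0) : ∀ t, 0 ≤ t → t ≤ T → Y t = Y' t := by
  set F : Set ℝ := {t | 0 ≤ t ∧ t ≤ T ∧ InContact ε (Y t)} ∪ {t | 0 ≤ t ∧ t ≤ T ∧ InContact ε (Y' t)}
  have hF : F.Finite := hY.finite_contact.union hY'.finite_contact
  -- Induction on the number of contact times of either trajectory after a; each round passes the
  -- first of them.
  suffices H : ∀ n : ℕ, ∀ a, 0 ≤ a → Y a = Y' a → (F ∩ Set.Ioi a).ncard = n →
      ∀ t, a ≤ t → t ≤ T → Y t = Y' t from fun t ht htT => H _ 0 le_rfl h0 rfl t ht htT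
  intro n
  induction n using Nat.strong_induction_on with
  | _ n ih =>
  intro a ha haa hn
  have hfin : (F ∩ Set.Ioi a).Finite := hF.subset Set.inter_subset_left
  have free : ∀ t, a ≤ t → t ≤ T → (∀ u, a < u → u ≤ t → u ∉ F) → Y t = Y' t := by
    intro t hat htT hu
    have c1 : ∀ u, a < u → u ≤ t → ¬ InContact ε (Y u) := fun u h1 h2 h3 =>
      hu u h1 h2 (Or.inl ⟨by linarith, by linarith, h3⟩)
    have c2 : ∀ u, a < u → u ≤ t → ¬ InContact ε (Y' u) := fun u h1 h2 h3 =>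
      hu u h1 h2 (Or.inr ⟨by linarith, by linarith, h3⟩)
    funext i
    ext1
    · rw [hY.free_pos a t ha hat htT (fun u h1 h2 => c1 u h1 h2.le),
        hY'.free_pos a t ha hat htT (fun u h1 h2 => c2 u h1 h2.le), haa]
    · rw [hY.free_vel a t ha hat htT c1, hY'.free_vel a t ha hat htT c2, haa]
  rcases (F ∩ Set.Ioi a).eq_empty_or_nonempty with hemp | hne
  · intro t hat htT
    refine free t hat htT fun u h1 h2 h3 => ?_
    have : u ∈ F ∩ Set.Ioi a := ⟨h3, h1⟩
    rw [hemp] at this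
    exact this
  · obtain ⟨b, hb, hbmin⟩ := hfin.exists_minimalFor id _ hne
    have hmin : ∀ u, a < u → u < b → u ∉ F := fun u h1 h2 h3 => by
      have := hbmin (j := u) ⟨h3, h1⟩ h2.le
      simp only [id] at this
      linarith
    have hab : a < b := hb.2
    have hb0 : 0 ≤ b ∧ b ≤ T := by
      rcases hb.1 with h | h
      · exact ⟨h.1, h.2.1⟩
      · exact ⟨h.1, h.2.1⟩
    have c1 : ∀ u, a < u → u < b → ¬ InContact ε (Y u) := fun u h1 h2 h3 =>
      hmin u h1 h2 (Or.inl ⟨by linarith, by linarith, h3⟩)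
    have c2 : ∀ u, a < u → u < b → ¬ InContact ε (Y' u) := fun u h1 h2 h3 =>
      hmin u h1 h2 (Or.inr ⟨by linarith, by linarith, h3⟩)
    have hpos : ∀ i, (Y b i).1 = (Y' b i).1 := fun i => by
      rw [hY.free_pos a b ha hab.le hb0.2 c1, hY'.free_pos a b ha hab.le hb0.2 c2, haa]
    have hcc : InContact ε (Y b) ↔ InContact ε (Y' b) := by simp only [InContact, hpos]
    have hcb : InContact ε (Y b) := by
      rcases hb.1 with h | h
      · exact h.2.2
      · exact hcc.2 h.2.2
    have hbb : Y b = Y' b := by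
      funext i
      ext1
      · exact hpos i
      · exact CollisionAt.vel_eq hε ha hab (hY.collision b (by linarith) hb0.2 hcb)
          (hY'.collision b (by linarith) hb0.2 (hcc.1 hcb)) hpos haa c1 c2 i
    intro t hat htT
    rcases lt_or_ge t b with h | h
    · exact free t hat htT fun u h1 h2 => hmin u h1 (h2.trans_lt h)
    · refine ih _ ?_ b hb0.1 hbb rfl t h htT
      rw [← hn]
      refine Set.ncard_lt_ncard ?_ hfin
      refine ⟨fun u hu => ⟨hu.1, hab.trans hu.2⟩, fun hsub => ?_⟩
      exact lt_irrefl b (hsub hb).2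

end Trajectories

/-! ### The step map follows an actual trajectory. -/

section OneStep

variable {d N : ℕ} {ε s R : ℝ}

lemma exists_pair {i j : Fin N} (hij : i ≠ j) :
    ∃ p : Pair N, (p.1.1 = i ∧ p.1.2 = j) ∨ (p.1.1 = j ∧ p.1.2 = i) := by
  rcases lt_or_gt_of_ne hij with h | h
  · exact ⟨⟨(i, j), h⟩, Or.inl ⟨rfl, rfl⟩⟩
  · exact ⟨⟨(j, i), h⟩, Or.inr ⟨rfl, rfl⟩⟩

lemma gap_eq_pgap (Z : Config d N) {p : Pair N} {i j : Fin N}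
    (h : (p.1.1 = i ∧ p.1.2 = j) ∨ (p.1.1 = j ∧ p.1.2 = i)) : gap Z i j = pgap Z p := by
  rcases h with ⟨rfl, rfl⟩ | ⟨rfl, rfl⟩
  · rfl
  · exact gap_comm _ _ _

lemma not_inContact_of_admissible {Z : Config d N} (hZ : Z ∈ admissible d ε N) :
    ¬ InContact ε Z := by
  rintro ⟨i, j, hij, h⟩
  exact (hZ i j hij).ne' h

/-- If only the pair `p` can be in contact in `Z`, then the pair `p` describes all contacts. -/
lemma contact_unique {Z : Config d N} {p : Pair N} (h : ∀ q, q ≠ p → pgap Z q ≠ ε) :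
    ∀ k l, k ≠ l → torusDist (Z k).1 (Z l).1 = ε →
      (k = p.1.1 ∧ l = p.1.2) ∨ (k = p.1.2 ∧ l = p.1.1) := by
  intro k l hkl hd
  obtain ⟨q, hq⟩ := exists_pair hkl
  have h1 : pgap Z q = ε := by rw [← gap_eq_pgap Z hq]; exact hd
  have h2 : q = p := by by_contra hne; exact h q hne h1
  subst h2
  rcases hq with ⟨rfl, rfl⟩ | ⟨rfl, rfl⟩
  · exact Or.inl ⟨rfl, rfl⟩
  · exact Or.inr ⟨rfl, rfl⟩

lemma exists_pgap_eq_of_inContact {Z : Config d N} (h : InContact ε Z) : ∃ p, pgap Z p = ε := by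
  obtain ⟨i, j, hij, h⟩ := h
  obtain ⟨q, hq⟩ := exists_pair hij
  exact ⟨q, by rw [← gap_eq_pgap Z hq]; exact h⟩

/-- Contact at an interior time without penetration is a local minimum of the distance. -/
lemma inner_eq_zero_of_graze {V : Type*} [NormedAddCommGroup V] [InnerProductSpace ℝ V]
    {x w : V} (hε : 0 ≤ ε) {u : ℝ} (hu : u ∈ Set.Ioo 0 s) (h : ‖x + u • w‖ = ε)
    (hge : ∀ v ∈ Set.Ioo 0 s, ε ≤ ‖x + v • w‖) : inner ℝ (x + u • w) w = 0 := by
  have hmin : IsLocalMin (fun v : ℝ => ‖x‖ ^ 2 + 2 * v * inner ℝ x w + v ^ 2 * ‖w‖ ^ 2) u := by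
    filter_upwards [isOpen_Ioo.mem_nhds hu] with v hv
    rw [← norm_add_smul_sq, ← norm_add_smul_sq, h]
    exact pow_le_pow_left₀ hε (hge v hv) 2
  have hd : HasDerivAt (fun v : ℝ => ‖x‖ ^ 2 + 2 * v * inner ℝ x w + v ^ 2 * ‖w‖ ^ 2)
      (2 * 1 * inner ℝ x w + 2 * u ^ 1 * 1 * ‖w‖ ^ 2) u := by
    have h1 := (((hasDerivAt_id u).const_mul 2).mul_const (inner ℝ x w : ℝ)).const_add (‖x‖ ^ 2)
    have h2 := ((hasDerivAt_id u).pow 2).mul_const (‖w‖ ^ 2)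
    exact (h1.add h2).congr_deriv (by simp)
  have := hmin.hasDerivAt_eq_zero hd
  rw [inner_add_smul_right]
  linarith

lemma norm_relPos_add_lt (hR : 0 ≤ R) (hs' : ε + 4 * R * s < 1 / 2) {Z : Config d N}
    (hE : energy Z ≤ R ^ 2) {p : Pair N} (hg : pgap Z p ≤ ε + 2 * R * s) {u : ℝ} (hu : 0 ≤ u)
    (hus : u ≤ s) :
    ‖(relState (Z p.1.1 - Z p.1.2)).1 + u • (relState (Z p.1.1 - Z p.1.2)).2‖ < 1 / 2 := by
  rw [pgap, gap_eq] at hg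
  refine lt_of_le_of_lt (b := (ε + 2 * R * s) + 2 * R * s) ((norm_add_le _ _).trans ?_)
    (by linarith)
  rw [norm_smul, Real.norm_eq_abs, abs_of_nonneg hu, mul_comm]
  have h1 := norm_relVel_le hR hE p.1.1 p.1.2
  exact add_le_add hg (mul_le_mul h1 hus hu (by linarith))

/-- Without penetration the spheres may still touch tangentially, and `IsTrajectory` treats this as
a collision. The normal velocity vanishes there, so the reflection is trivial and free transport
obeys the collision law. Contacts at the endpoints are excluded by admissibility. -/
lemma inContact_freeFlow_graze (hε : 0 < ε) (hR : 0 ≤ R) (hs : 0 ≤ s) (hs' : ε + 4 * R * s < 1 / 2)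
    {Z : Config d N} (hZ : Z ∈ good ε s R) (hpen : ∀ p, Z ∉ pen ε s p)
    (hend : freeFlow s Z ∈ admissible d ε N) {u : ℝ} (hu : 0 ≤ u) (hus : u ≤ s)
    (hc : InContact ε (freeFlow u Z)) :
    ∃ p : Pair N, pgap Z p ≤ ε + 4 * R * s ∧ pgap (freeFlow u Z) p = ε ∧ 
      (relState (Z p.1.1 - Z p.1.2)).2 ≠ 0 ∧
      ‖(relState (Z p.1.1 - Z p.1.2)).1 + u • (relState (Z p.1.1 - Z p.1.2)).2‖ = ε ∧
      inner ℝ ((relState (Z p.1.1 - Z p.1.2)).1 + u • (relState (Z p.1.1 - Z p.1.2)).2)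
        (relState (Z p.1.1 - Z p.1.2)).2 = 0 := by
  obtain ⟨p, hp⟩ := exists_pgap_eq_of_inContact hc
  have hRs := mul_nonneg hR hs
  have hg : pgap Z p ≤ ε + 2 * R * s := by
    have := gap_le_gap_freeFlow_add hR hZ.2.1 p.1.1 p.1.2 hu hus
    unfold pgap at hp ⊢
    linarith
  have hlift : ∀ v, 0 ≤ v → v ≤ s → pgap (freeFlow v Z) p =
      ‖(relState (Z p.1.1 - Z p.1.2)).1 + v • (relState (Z p.1.1 - Z p.1.2)).2‖ :=
    fun v hv hvs => gap_freeFlow_eq (norm_relPos_add_lt hR hs' hZ.2.1 hg hv hvs)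
  have hu1 : ‖(relState (Z p.1.1 - Z p.1.2)).1 + u • (relState (Z p.1.1 - Z p.1.2)).2‖ = ε := by
    rw [← hlift u hu hus, hp]
  have hx : ε < ‖(relState (Z p.1.1 - Z p.1.2)).1‖ := by
    rw [← gap_eq]; exact hZ.1 _ _ p.2.ne
  have hu0 : u ≠ 0 := by
    rintro rfl
    rw [zero_smul, add_zero] at hu1
    linarith
  have hus' : u ≠ s := by
    rintro rfl
    exact (hend _ _ p.2.ne).ne' hp
  refine ⟨p, by linarith, hp, ?_, hu1, ?_⟩
  · intro h0
    rw [h0, smul_zero, add_zero] at hu1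
    linarith
  · refine inner_eq_zero_of_graze hε.le ⟨lt_of_le_of_ne hu hu0.symm, lt_of_le_of_ne hus hus'⟩ hu1 ?_
    intro v hv
    rw [← hlift v hv.1.le hv.2.le]
    by_contra hcon
    exact hpen p ⟨v, hv, not_le.1 hcon⟩

/-- Free transport is a trajectory if no pair penetrates. -/
lemma isTrajOn_freeFlow (hε : 0 < ε) (hR : 0 ≤ R) (hs : 0 ≤ s) (hs' : ε + 4 * R * s < 1 / 2)
    {Z : Config d N} (hZ : Z ∈ good ε s R) (hpen : ∀ p, Z ∉ pen ε s p)
    (hend : freeFlow s Z ∈ admissible d ε N) : IsTrajOn ε s fun u => freeFlow u Z := by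
  have graze := fun (u : ℝ) (hu : 0 ≤ u) (hus : u ≤ s) (hc : InContact ε (freeFlow u Z)) =>
    inContact_freeFlow_graze hε hR hs hs' hZ hpen hend hu hus hc
  have hpos : ∀ a b (i : Fin N), (freeFlow b Z i).1 =
      (freeFlow a Z i).1 + proj ((b - a) • (freeFlow a Z i).2) := fun a b i => by
    simp only [freeFlow]
    rw [add_assoc, ← proj_add, ← add_smul]
    congr 3
    ring
  refine ⟨?_, ?_, ?_, ?_, ?_⟩
  · intro t ht hts i j hij
    rcases ht.eq_or_lt with rfl | ht
    · rw [freeFlow_zero]; exact (hZ.1 i j hij).le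
    · rcases hts.eq_or_lt with rfl | hts
      · exact (hend i j hij).le
      · obtain ⟨q, hq⟩ := exists_pair hij
        have := gap_eq_pgap (freeFlow t Z) hq
        rw [gap] at this
        rw [this]
        by_contra hcon
        exact hpen q ⟨t, ⟨ht, hts⟩, not_le.1 hcon⟩
  -- Only one pair is close, and its grazing time is the unique zero of an affine function of slope
  -- ‖w‖² ≠ 0.
  · refine Set.Subsingleton.finite ?_
    rintro t ⟨ht0, hts, htc⟩ t' ⟨ht0', hts', htc'⟩
    obtain ⟨p, hp, -, hw, -, hin⟩ := graze t ht0 hts htc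
    obtain ⟨p', hp', -, -, -, hin'⟩ := graze t' ht0' hts' htc'
    obtain rfl : p = p' := hZ.2.2 p p' hp hp'
    rw [inner_add_smul_right] at hin hin'
    have hw2 : ‖(relState (Z p.1.1 - Z p.1.2)).2‖ ^ 2 ≠ 0 := by positivity
    exact mul_right_cancel₀ hw2 (by linarith)
  · exact fun a b _ _ _ _ i => hpos a b i
  · exact fun a b _ _ _ _ i => rfl
  · intro t ht hts hc
    obtain ⟨p, hp, hpg, hw, hn, hin⟩ := graze t ht.le hts hc
    refine ⟨p.1.1, p.1.2, p.2.ne, contact_unique fun q hq hqg => hq ?_,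
      _, hn, (freeFlow_sub_fst t Z _ _).symm, ?_⟩
    · obtain ⟨p', hp'⟩ : ∃ p' : Pair N, p' = p := ⟨p, rfl⟩
      have := gap_le_gap_freeFlow_add hR hZ.2.1 q.1.1 q.1.2 ht.le hts
      have hRs := mul_nonneg hR hs
      unfold pgap at hqg
      refine hZ.2.2 q p ?_ hp
      unfold pgap
      linarith
    · intro a ha hat _
      have h0 : (inner ℝ ((freeFlow a Z p.1.1).2 - (freeFlow a Z p.1.2).2)
        ((relState (Z p.1.1 - Z p.1.2)).1 + t • (relState (Z p.1.1 - Z p.1.2)).2) : ℝ) = 0 := by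
        rw [real_inner_comm]; exact hin
      rw [h0]
      simp [freeFlow]

/-- Continuity of the positions at the collision: the position offset in `jump` cancels the velocity
change at the entry time. -/
lemma freeFlow_collide_entry_fst {i j : Fin N} (hij : i ≠ j) (Z : Config d N) (k : Fin N) :
    (freeFlow (entryTime ε (relState (Z i - Z j)).1 (relState (Z i - Z j)).2)
      (collide ε i j Z) k).1 =
    (freeFlow (entryTime ε (relState (Z i - Z j)).1 (relState (Z i - Z j)).2) Z k).1 := by
  by_cases h1 : k = i
  · subst h1
    simp only [freeFlow, collide_left ε hij, Prod.fst_add, Prod.snd_add, jump, smul_add, smul_neg,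
      proj_add, proj_neg]
    abel
  · by_cases h2 : k = j
    · subst h2
      simp only [freeFlow, collide_right ε hij, Prod.fst_sub, Prod.snd_sub, jump, smul_sub,
        smul_neg, proj_sub, proj_neg]
      abel
    · simp only [freeFlow, collide_of_ne ε h1 h2]

/-- The trajectory with one collision. -/
lemma isTrajOn_collide (hε : 0 < ε) (hR : 0 ≤ R) (hs : 0 ≤ s) (hs' : ε + 4 * R * s < 1 / 2)
    {Z : Config d N} (hZ : Z ∈ good ε s R) {p : Pair N} (hp : Z ∈ pen ε s p) :
    IsTrajOn ε s fun u =>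
      if u < entryTime ε (relState (Z p.1.1 - Z p.1.2)).1 (relState (Z p.1.1 - Z p.1.2)).2
      then freeFlow u Z else freeFlow u (collide ε p.1.1 p.1.2 Z) := by
  obtain ⟨hd, ht0, hts⟩ := good.entry hε hR hs' hZ hp
  have hother := fun (q : Pair N) (hpq : p ≠ q) (v : ℝ) (hv : 0 ≤ v) (hvs : v ≤ s) =>
    good.gap_other hε hR hs hs' hZ hp hpq hv hvs
  have hsub := freeFlow_collide_sub_fst hε p.2.ne hd
  have hcont := freeFlow_collide_entry_fst (ε := ε) p.2.ne Z
  have hg := pgap_le_of_pen hR hZ.2.1 hp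
  have hRs := mul_nonneg hR hs
  have hlift : ∀ v, 0 ≤ v → v ≤ s → pgap (freeFlow v Z) p =
      ‖(relState (Z p.1.1 - Z p.1.2)).1 + v • (relState (Z p.1.1 - Z p.1.2)).2‖ :=
    fun v hv hvs => gap_freeFlow_eq (norm_relPos_add_lt hR hs' hZ.2.1 hg hv hvs)
  have hkick : kick ε (Z p.1.1 - Z p.1.2) = (1 / ε ^ 2 * inner ℝ
      (impact ε (relState (Z p.1.1 - Z p.1.2)).1 (relState (Z p.1.1 - Z p.1.2)).2)
      (relState (Z p.1.1 - Z p.1.2)).2) •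
      impact ε (relState (Z p.1.1 - Z p.1.2)).1 (relState (Z p.1.1 - Z p.1.2)).2 := rfl
  have hwn : ‖(relState (Z p.1.1 - Z p.1.2)).2‖ ≤ 2 * R := norm_relVel_le hR hZ.2.1 _ _
  have hwdef : (relState (Z p.1.1 - Z p.1.2)).2 = (Z p.1.1).2 - (Z p.1.2).2 := rfl
  set x := (relState (Z p.1.1 - Z p.1.2)).1
  set w := (relState (Z p.1.1 - Z p.1.2)).2
  set t := entryTime ε x w with ht
  set C := collide ε p.1.1 p.1.2 Z with hC
  set y := impact ε x w with hy
  have hyn : ‖y‖ = ε := norm_impact hε hd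
  have hin : inner ℝ y w < 0 := inner_impact_neg hd
  set Y : ℝ → Config d N := fun u => if u < t then freeFlow u Z else freeFlow u C with hYdef
  have Y1 : ∀ u, u < t → Y u = freeFlow u Z := fun u hu => if_pos hu
  have Y2 : ∀ u, t ≤ u → Y u = freeFlow u C := fun u hu => if_neg (not_lt.2 hu)
  have gap1 : ∀ u, 0 ≤ u → u < t → ∀ q, ε < pgap (Y u) q := by
    intro u hu hut q
    rw [Y1 u hut]
    by_cases hq : p = q
    · subst hq
      rw [hlift u hu (by linarith)]
      have e : x + u • w = y + (u - t) • w := by rw [hy, impact]; module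
      rw [e]
      refine lt_of_pow_lt_pow_left₀ 2 (norm_nonneg _) ?_
      rw [norm_add_smul_sq, hyn]
      have h1 : 0 < (t - u) * -(inner ℝ y w) := mul_pos (by linarith) (by linarith)
      have h2 : 0 ≤ (u - t) ^ 2 * ‖w‖ ^ 2 := by positivity
      linarith
    · have h1 := gap_le_gap_freeFlow_add hR hZ.2.1 q.1.1 q.1.2 hu (show u ≤ s by linarith)
      have h2 : ε + 4 * R * s < pgap Z q := by
        by_contra hcon
        exact hq (good.pen_unique hR hs hZ hp (not_lt.1 hcon))
      unfold pgap at h2 ⊢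
      linarith
  have gap2 : ∀ u, t < u → u ≤ s → ε < pgap (Y u) p := by
    intro u hu hus
    rw [Y2 u hu.le, pgap, gap, torusDist_eq, hsub]
    rw [sec_proj_of_norm_lt]
    · refine lt_of_pow_lt_pow_left₀ 2 (norm_nonneg _) ?_
      rw [norm_impact_add_smul_sq hε hd]
      have h1 : 0 < (u - t) * -(inner ℝ y w) := mul_pos (by linarith) (by linarith)
      have h2 : 0 ≤ (u - t) ^ 2 * ‖w‖ ^ 2 := by positivity
      linarith
    · refine lt_of_le_of_lt (b := ε + s * (2 * R)) ((norm_add_le _ _).trans ?_) (by nlinarith)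
      rw [norm_smul, norm_reflect hε hyn, hyn, Real.norm_eq_abs, abs_of_pos (by linarith)]
      have : (u - t) * ‖w‖ ≤ s * (2 * R) := mul_le_mul (by linarith) hwn (norm_nonneg _) hs
      linarith
  have gapt : pgap (Y t) p = ε := by
    rw [Y2 t le_rfl, pgap, gap, torusDist_eq, hsub, sub_self, zero_smul, add_zero,
      sec_proj_of_norm_lt (by rw [hyn]; linarith), hyn]
  have gapo : ∀ q, p ≠ q → ∀ u, t ≤ u → u ≤ s → ε < pgap (Y u) q := fun q hpq u hu hus => by
    rw [Y2 u hu]; exact hother q hpq u (by linarith) hus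
  have hct : InContact ε (Y t) := ⟨p.1.1, p.1.2, p.2.ne, gapt⟩
  have hnc : ∀ u, 0 ≤ u → u ≤ s → InContact ε (Y u) → u = t := by
    intro u hu hus hc
    obtain ⟨q, hq⟩ := exists_pgap_eq_of_inContact hc
    rcases lt_trichotomy u t with h | h | h
    · exact absurd hq (gap1 u hu h q).ne'
    · exact h
    · by_cases hpq : p = q
      · subst hpq; exact absurd hq (gap2 u h hus).ne'
      · exact absurd hq (gapo q hpq u h.le hus).ne'
  have hpos : ∀ (W : Config d N) (a b : ℝ) (i : Fin N), (freeFlow b W i).1 =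
      (freeFlow a W i).1 + proj ((b - a) • (freeFlow a W i).2) := fun W a b i => by
    simp only [freeFlow]
    rw [add_assoc, ← proj_add, ← add_smul]
    congr 3
    ring
  refine ⟨?_, ?_, ?_, ?_, ?_⟩
  · intro u hu hus i j hij
    obtain ⟨q, hq⟩ := exists_pair hij
    have := gap_eq_pgap (Y u) hq
    rw [gap] at this
    rw [this]
    rcases lt_trichotomy u t with h | h | h
    · exact (gap1 u hu h q).le
    · by_cases hpq : p = q
      · subst hpq; rw [h, gapt]
      · exact (gapo q hpq u h.ge hus).le
    · by_cases hpq : p = q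
      · subst hpq; exact (gap2 u h hus).le
      · exact (gapo q hpq u h.le hus).le
  · exact (Set.finite_singleton t).subset fun u hu => hnc u hu.1 hu.2.1 hu.2.2
  · intro a b ha hab hbs hf i
    rcases lt_or_ge a t with h | h
    · have hbt : b ≤ t := by
        by_contra hcon
        exact hf t h (not_le.1 hcon) hct
      rw [Y1 a h]
      rcases hbt.eq_or_lt with hbt | hbt
      · rw [hbt, Y2 t le_rfl, hcont, ← hpos]
      · rw [Y1 b hbt]; exact hpos Z a b i
    · rw [Y2 a h, Y2 b (h.trans hab)]; exact hpos C a b i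
  · intro a b ha hab hbs hf i
    rcases lt_or_ge a t with h | h
    · have hbt : b < t := by
        by_contra hcon
        exact hf t h (not_lt.1 hcon) hct
      rw [Y1 a h, Y1 b hbt]; rfl
    · rw [Y2 a h, Y2 b (h.trans hab)]; rfl
  · intro u hu hus hc
    obtain rfl := hnc u hu.le hus hc
    refine ⟨p.1.1, p.1.2, p.2.ne, contact_unique fun q hq hqg => ?_, y, hyn, ?_, ?_⟩
    · exact absurd hqg (gapo q hq.symm _ le_rfl hus).ne'
    · have := hsub t
      rw [sub_self, zero_smul, add_zero] at this
      rw [Y2 t le_rfl, this]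
    · intro a ha hat _
      rw [Y1 a hat, Y2 t le_rfl]
      have h0 : (inner ℝ ((freeFlow a Z p.1.1).2 - (freeFlow a Z p.1.2).2) y : ℝ) =
          inner ℝ y w := by
        rw [real_inner_comm]; rfl
      rw [h0, ← hkick]
      simp only [freeFlow]
      refine ⟨?_, ?_, fun k hk1 hk2 => ?_⟩
      · rw [hC, collide_left ε p.2.ne]
        exact (sub_eq_add_neg _ _).symm
      · rw [hC, collide_right ε p.2.ne]
        exact sub_neg_eq_add _ _
      · rw [hC, collide_of_ne ε hk1 hk2]

/-- The transition map follows a trajectory. -/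
lemma exists_isTrajOn_step (hε : 0 < ε) (hR : 0 ≤ R) (hs : 0 ≤ s) (hs' : ε + 4 * R * s < 1 / 2)
    {Z : Config d N} (hZ : Z ∈ good ε s R) (hend : step ε s Z ∈ admissible d ε N) :
    ∃ Y : ℝ → Config d N, IsTrajOn ε s Y ∧ Y 0 = Z ∧ Y s = step ε s Z := by
  by_cases h : ∃ p, Z ∈ pen ε s p
  · obtain ⟨p, hp⟩ := h
    obtain ⟨hd, ht0, hts⟩ := good.entry hε hR hs' hZ hp
    refine ⟨_, isTrajOn_collide hε hR hs hs' hZ hp, ?_, ?_⟩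
    · rw [if_pos ht0, freeFlow_zero]
    · rw [if_neg (not_lt.2 hts.le), good.step_of_pen hR hs hZ hp]
  · push Not at h
    rw [step_of_not_pen h] at hend ⊢
    exact ⟨_, isTrajOn_freeFlow hε hR hs hs' hZ h hend, freeFlow_zero Z, rfl⟩

lemma energy_step (hε : 0 < ε) (hR : 0 ≤ R) (hs : 0 ≤ s) (hs' : ε + 4 * R * s < 1 / 2)
    {Z : Config d N} (hZ : Z ∈ good ε s R) : energy (step ε s Z) = energy Z := by
  by_cases h : ∃ p, Z ∈ pen ε s p
  · obtain ⟨p, hp⟩ := h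
    rw [good.step_of_pen hR hs hZ hp, energy_freeFlow,
      energy_collide hε.ne' p.2.ne Z (good.entry hε hR hs' hZ hp).1]
  · push Not at h
    rw [step_of_not_pen h, energy_freeFlow]

/-- Penetration is only ruled out at times before s, so the endpoint is reached by a limit and
contact there remains possible. -/
lemma le_gap_step (hε : 0 < ε) (hR : 0 ≤ R) (hs : 0 < s) (hs' : ε + 4 * R * s < 1 / 2)
    {Z : Config d N} (hZ : Z ∈ good ε s R) (i j : Fin N) (hij : i ≠ j) :
    ε ≤ gap (step ε s Z) i j := by
  obtain ⟨q, hq⟩ := exists_pair hij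
  rw [gap_eq_pgap _ hq]
  by_cases h : ∃ p, Z ∈ pen ε s p
  · obtain ⟨p, hp⟩ := h
    have hY := isTrajOn_collide hε hR hs.le hs' hZ hp
    have h2 := hY.exclusion s hs.le le_rfl q.1.1 q.1.2 q.2.ne
    rw [if_neg (not_lt.2 (good.entry hε hR hs' hZ hp).2.2.le)] at h2
    rw [good.step_of_pen hR hs.le hZ hp]
    exact h2
  · push Not at h
    rw [step_of_not_pen h]
    have hcont : Continuous fun u : ℝ => pgap (freeFlow u Z) q := by
      refine continuous_torusDist_comp ?_ ?_ <;>
      exact continuous_const.add (continuous_proj.comp (by fun_prop))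
    have hev : ∀ᶠ u in 𝓝[<] s, ε ≤ pgap (freeFlow u Z) q := by
      filter_upwards [Ioo_mem_nhdsLT hs] with u hu
      by_contra hcon
      exact h q ⟨u, hu, not_le.1 hcon⟩
    exact ge_of_tendsto (hcont.continuousAt.tendsto.mono_left nhdsWithin_le_nhds) hev

end OneStep

/-! ### Volume of the configurations where a step fails. -/

section BadSets

variable {d N : ℕ} {ε s R : ℝ}

/-- Admissible configurations of bounded energy. -/
def shell (d : ℕ) (ε : ℝ) (N : ℕ) (R : ℝ) : Set (Config d N) :=
  {Z | Z ∈ admissible d ε N ∧ energy Z ≤ R ^ 2}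

lemma measurableSet_admissible (d : ℕ) (ε : ℝ) (N : ℕ) : MeasurableSet (admissible d ε N) := by
  have : admissible d ε N = ⋂ i, ⋂ j, ⋂ _ : i ≠ j, {Z : Config d N | ε < gap Z i j} := by
    ext; simp [admissible, gap]
  rw [this]
  exact MeasurableSet.iInter fun i => MeasurableSet.iInter fun j => MeasurableSet.iInter fun _ =>
      (isOpen_lt continuous_const (continuous_gap i j)).measurableSet

lemma measurableSet_shell : MeasurableSet (shell d ε N R) :=
  (measurableSet_admissible d ε N).inter (measurableSet_le measurable_energy measurable_const)

lemma volume_energy_lt_top (hR : 0 ≤ R) : volume {Z : Config d N | energy Z ≤ R ^ 2} < ⊤ := by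
  have hsub : {Z : Config d N | energy Z ≤ R ^ 2} ⊆ Set.univ.pi fun _ : Fin N =>
      (Set.univ : Set (UnitAddTorus (Fin d))) ×ˢ
        Metric.closedBall (0 : EuclideanSpace ℝ (Fin d)) R := by
    intro Z hZ k _
    exact ⟨trivial, mem_closedBall_zero_iff.2 (norm_vel_le hR hZ k)⟩
  refine (measure_mono hsub).trans_lt ?_
  rw [volume_pi, Measure.pi_pi]
  refine ENNReal.prod_lt_top fun k _ => ?_
  rw [Measure.volume_eq_prod, Measure.prod_prod]
  exact ENNReal.mul_lt_top (measure_lt_top _ _) measure_closedBall_lt_top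

/-- The relative position of two particles is uniformly distributed, independently of anything
that does not depend on the position of one of them. -/
lemma volume_inter_relPos {B : Set (Config d N)} (hB : MeasurableSet B) {i j : Fin N} (hij : i ≠ j)
    (hinv : ∀ (Z : Config d N) (a : UnitAddTorus (Fin d)), 
      Z + Pi.single i ((a, 0) : Particle d) ∈ B ↔ Z ∈ B)
    {S : Set (UnitAddTorus (Fin d))} (hS : MeasurableSet S) :
    volume (B ∩ {Z | (Z i).1 - (Z j).1 ∈ S}) = volume S * volume B := by
  have hmeas : MeasurableSet {Z : Config d N | (Z i).1 - (Z j).1 ∈ S} :=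
    ((measurable_pi_apply i).fst.sub (measurable_pi_apply j).fst) hS
  -- Translating particle i by a preserves volume and B; averaging over a replaces the indicator of
  -- S by its volume.
  have key : ∀ a : UnitAddTorus (Fin d), volume (B ∩ {Z | (Z i).1 - (Z j).1 ∈ S}) =
      ∫⁻ Z : Config d N, B.indicator 1 Z * S.indicator 1 ((Z i).1 - (Z j).1 + a) := by
    intro a
    rw [← lintegral_indicator_one (hB.inter hmeas),
      ← lintegral_add_right_eq_self _ (Pi.single i ((a, 0) : Particle d))]
    refine lintegral_congr fun Z => ?_
    rw [Set.inter_indicator_one, Pi.mul_apply]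
    congr 1
    · by_cases h : Z ∈ B
      · rw [Set.indicator_of_mem h, Set.indicator_of_mem ((hinv Z a).2 h)]; rfl
      · rw [Set.indicator_of_notMem h, Set.indicator_of_notMem (fun h' => h ((hinv Z a).1 h'))]
    · have : ((Z + Pi.single i ((a, 0) : Particle d) : Config d N) i).1 -
          ((Z + Pi.single i ((a, 0) : Particle d) : Config d N) j).1 = (Z i).1 - (Z j).1 + a := by
        simp [hij.symm]
        abel
      rw [← this]
      rfl
  have hm : Measurable fun p : UnitAddTorus (Fin d) × Config d N =>
      (B.indicator 1 p.2 * S.indicator 1 ((p.2 i).1 - (p.2 j).1 + p.1) : ENNReal) := by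
    refine Measurable.mul ?_ ?_
    · exact (measurable_one.indicator hB).comp measurable_snd
    · refine (measurable_one.indicator hS).comp ?_
      exact ((((measurable_pi_apply i).comp measurable_snd).fst).sub
        (((measurable_pi_apply j).comp measurable_snd).fst)).add measurable_fst
  calc volume (B ∩ {Z | (Z i).1 - (Z j).1 ∈ S})
      = ∫⁻ _a : UnitAddTorus (Fin d), volume (B ∩ {Z | (Z i).1 - (Z j).1 ∈ S}) := by simp
    _ = ∫⁻ a : UnitAddTorus (Fin d), ∫⁻ Z : Config d N,
          B.indicator 1 Z * S.indicator 1 ((Z i).1 - (Z j).1 + a) := lintegral_congr fun a => key a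
    _ = ∫⁻ Z : Config d N, ∫⁻ a : UnitAddTorus (Fin d),
          B.indicator 1 Z * S.indicator 1 ((Z i).1 - (Z j).1 + a) :=
        lintegral_lintegral_swap hm.aemeasurable
    _ = ∫⁻ Z : Config d N, B.indicator 1 Z * volume S := by
        refine lintegral_congr fun Z => ?_
        have h1 : Measurable fun a : UnitAddTorus (Fin d) =>
            (S.indicator 1 ((Z i).1 - (Z j).1 + a) : ENNReal) :=
          (measurable_one.indicator hS).comp (measurable_const_add _)
        rw [lintegral_const_mul _ h1, lintegral_add_left_eq_self (S.indicator 1) ((Z i).1 - (Z j).1),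
          lintegral_indicator_one hS]
    _ = volume S * volume B := by
        rw [lintegral_mul_const _ (measurable_one.indicator hB), lintegral_indicator_one hB,
          mul_comm]

lemma energy_add_single (Z : Config d N) (i : Fin N) (a : UnitAddTorus (Fin d)) :
    energy (Z + Pi.single i ((a, 0) : Particle d)) = energy Z := by
  refine Finset.sum_congr rfl fun k _ => ?_
  by_cases h : k = i
  · subst h; simp
  · simp [h]

lemma gap_add_single (Z : Config d N) {i k l : Fin N} (hk : k ≠ i) (hl : l ≠ i)
    (a : UnitAddTorus (Fin d)) :
    gap (Z + Pi.single i ((a, 0) : Particle d)) k l = gap Z k l := by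
  simp [gap, hk, hl]

lemma volume_gap_eq (hε : 0 < ε) {i j : Fin N} (hij : i ≠ j) :
    volume {Z : Config d N | gap Z i j = ε} = 0 := by
  have h := volume_inter_relPos (d := d) MeasurableSet.univ hij (fun Z a => by simp)
    (measurable_sec.norm (measurableSet_singleton ε))
  have h2 : volume ((fun x : UnitAddTorus (Fin d) => ‖sec x‖) ⁻¹' {ε}) = 0 := volume_norm_sec_eq hε
  rw [h2, zero_mul, Set.univ_inter] at h
  rw [← h]
  congr 1
  ext Z
  simp [gap, torusDist_eq]

/-- Two different pairs are unlikely to be close simultaneously. -/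
lemma volume_two_gaps {S : Set ℝ} (hS : MeasurableSet S) {p q : Pair N} (hpq : p ≠ q) :
    volume {Z : Config d N | energy Z ≤ R ^ 2 ∧ pgap Z p ∈ S ∧ pgap Z q ∈ S} =
      volume {x : UnitAddTorus (Fin d) | ‖sec x‖ ∈ S} ^ 2 *
        volume {Z : Config d N | energy Z ≤ R ^ 2} := by
  -- A pair q ≠ p has a particle m outside p; moving m alone does not affect the pair p, so the two
  -- gaps are independent.
  obtain ⟨m, l, hml, hq, h1, h2⟩ : ∃ m l, m ≠ l ∧ ((q.1.1 = m ∧ q.1.2 = l) ∨ (q.1.1 = l ∧ q.1.2 = m)) ∧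
      p.1.1 ≠ m ∧ p.1.2 ≠ m := by
    by_cases h : p.1.1 ≠ q.1.1 ∧ p.1.2 ≠ q.1.1
    · exact ⟨q.1.1, q.1.2, q.2.ne, Or.inl ⟨rfl, rfl⟩, h⟩
    · refine ⟨q.1.2, q.1.1, q.2.ne', Or.inr ⟨rfl, rfl⟩, ?_⟩
      have hp2 := p.2
      have hq2 := q.2
      by_contra hcon
      rcases p with ⟨⟨a, b⟩, hab⟩
      rcases q with ⟨⟨c, e⟩, hce⟩
      simp only [ne_eq, not_and_or, not_not, Subtype.mk.injEq, Prod.mk.injEq] at *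
      omega
  have hS' : MeasurableSet {x : UnitAddTorus (Fin d) | ‖sec x‖ ∈ S} := measurable_sec.norm hS
  have hE : MeasurableSet {Z : Config d N | energy Z ≤ R ^ 2} :=
    measurableSet_le measurable_energy measurable_const
  have e1 := volume_inter_relPos hE p.2.ne (fun Z a => by
    simp [energy_add_single]) hS'
  have hB : MeasurableSet ({Z : Config d N | energy Z ≤ R ^ 2} ∩
      {Z | (Z p.1.1).1 - (Z p.1.2).1 ∈ {x : UnitAddTorus (Fin d) | ‖sec x‖ ∈ S}}) := 
    hE.inter (((measurable_pi_apply _).fst.sub (measurable_pi_apply _).fst) hS')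
  have e2 := volume_inter_relPos hB hml (fun Z a => by
    have := gap_add_single Z h1 h2 a
    simp only [gap, torusDist_eq] at this
    simp only [Set.mem_inter_iff, Set.mem_ofPred_eq, energy_add_single, this]) hS'
  rw [sq (volume _), mul_assoc, ← e1, ← e2]
  congr 1
  ext Z
  have h3 : gap Z m l = pgap Z q := gap_eq_pgap Z hq
  have h4 : pgap Z p = gap Z p.1.1 p.1.2 := rfl
  simp only [Set.mem_inter_iff, Set.mem_ofPred_eq, ← h3, h4, gap, torusDist_eq, and_assoc]

/-- The configurations to which the transition map applies. -/
def goodStep (ε s R : ℝ) : Set (Config d N) := good ε s R ∩ step ε s ⁻¹' admissible d ε N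

lemma measurableSet_goodStep : MeasurableSet (goodStep ε s R : Set (Config d N)) :=
  (measurableSet_good ε s R).inter (measurable_step ε s (measurableSet_admissible d ε N))

/-- Two close pairs cost the square of a shell volume of order s. The other defect, contact exactly
at time s, is null because a step does not increase volume. The constant may depend on ε, N and R,
as only s tends to 0. -/
lemma volume_shell_sdiff_goodStep_le (hd : 1 ≤ d) (hε : 0 < ε) (hε' : ε < 1 / 2) (hR : 0 ≤ R) :
    ∃ C : ℝ, 0 ≤ C ∧ ∀ s, 0 < s → ε + 4 * R * s < 1 / 2 →
      volume (shell d ε N R \ goodStep ε s R) ≤ ENNReal.ofReal (C * s ^ 2) := by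
  obtain ⟨C, hC, hCs⟩ := volume_shell_le hd hε (by linarith : ε ≤ 1)
  set b := volume {Z : Config d N | energy Z ≤ R ^ 2} with hb
  have hbt : b < ⊤ := volume_energy_lt_top hR
  refine ⟨Fintype.card (Pair N × Pair N) * ((C * (4 * R)) ^ 2 * b.toReal), by positivity, ?_⟩
  intro s hs hs'
  have hRs : 0 ≤ 4 * R * s := by positivity
  set S := Set.Ioc ε (ε + 4 * R * s)
  have hsub : shell d ε N R \ goodStep ε s R ⊆
      (⋃ r : Pair N × Pair N, ⋃ _ : r.1 ≠ r.2,
        {Z : Config d N | energy Z ≤ R ^ 2 ∧ pgap Z r.1 ∈ S ∧ pgap Z r.2 ∈ S}) ∪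
      (⋃ r : Pair N, good ε s R ∩ step ε s ⁻¹' {Z : Config d N | gap Z r.1.1 r.1.2 = ε}) := by
    rintro Z ⟨⟨h1, h2⟩, h3⟩
    by_cases hg : Z ∈ good ε s R
    · right
      have h4 : step ε s Z ∉ admissible d ε N := fun h => h3 ⟨hg, h⟩
      simp only [admissible, Set.mem_ofPred_eq, not_forall] at h4
      obtain ⟨i, j, hij, h4⟩ := h4
      obtain ⟨q, hq⟩ := exists_pair hij
      refine Set.mem_iUnion.2 ⟨q, hg, ?_⟩
      have h5 : gap (step ε s Z) i j = ε := le_antisymm (not_lt.1 h4) (le_gap_step hε hR hs hs' hg i j hij)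
      rw [gap_eq_pgap _ hq] at h5
      exact h5
    · left
      have h4 : ¬ ∀ p q : Pair N, pgap Z p ≤ ε + 4 * R * s → pgap Z q ≤ ε + 4 * R * s → p = q :=
        fun h => hg ⟨h1, h2, h⟩
      push Not at h4
      obtain ⟨p, q, hp, hq, hpq⟩ := h4
      exact Set.mem_iUnion₂.2 ⟨(p, q), hpq, h2, ⟨h1 _ _ p.2.ne, hp⟩, ⟨h1 _ _ q.2.ne, hq⟩⟩
  have hnull : volume (⋃ r : Pair N, good ε s R ∩
      step ε s ⁻¹' {Z : Config d N | gap Z r.1.1 r.1.2 = ε}) = 0 := by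
    refine measure_iUnion_null fun r => le_antisymm ?_ bot_le
    exact (volume_good_inter_preimage_step_le hε hR hs.le hs'
      ((continuous_gap _ _).measurable (measurableSet_singleton ε))).trans_eq
        (volume_gap_eq hε r.2.ne)
  have hshell : volume {x : UnitAddTorus (Fin d) | ‖sec x‖ ∈ S} ≤
      ENNReal.ofReal (C * (4 * R * s)) := hCs _ hRs (by linarith)
  calc volume (shell d ε N R \ goodStep ε s R) ≤ _ := measure_mono hsub
    _ ≤ _ := measure_union_le _ _
    _ ≤ ∑ r : Pair N × Pair N, volume (⋃ _ : r.1 ≠ r.2,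
        {Z : Config d N | energy Z ≤ R ^ 2 ∧ pgap Z r.1 ∈ S ∧ pgap Z r.2 ∈ S}) := by
        rw [hnull, add_zero, ← tsum_fintype (L := .unconditional _)]
        exact measure_iUnion_le _
    _ ≤ ∑ r : Pair N × Pair N, ENNReal.ofReal ((C * (4 * R * s)) ^ 2 * b.toReal) := by
        refine Finset.sum_le_sum fun r _ => ?_
        by_cases hr : r.1 ≠ r.2
        · simp only [hr, ne_eq, not_false_eq_true, Set.iUnion_true]
          rw [volume_two_gaps measurableSet_Ioc hr, ENNReal.ofReal_mul (by positivity),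
            ENNReal.ofReal_toReal hbt.ne, ENNReal.ofReal_pow (by positivity)]
          gcongr
        · simp [hr]
    _ = ENNReal.ofReal (Fintype.card (Pair N × Pair N) * ((C * (4 * R)) ^ 2 * b.toReal) * s ^ 2) := by
        rw [Finset.sum_const, Finset.card_univ, nsmul_eq_mul, ← ENNReal.ofReal_natCast,
          ← ENNReal.ofReal_mul (by positivity)]
        congr 1
        ring

end BadSets

/-! ### Iterating the step map. -/

section Iteration

variable {d N : ℕ} {ε s R : ℝ}

/-- The configurations to which the transition map can be applied `k` times. -/
def orbitSet (ε s R : ℝ) (k : ℕ) : Set (Config d N) :=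
  {Z | ∀ j < k, (step ε s)^[j] Z ∈ goodStep ε s R}

lemma measurableSet_orbitSet (k : ℕ) : MeasurableSet (orbitSet ε s R k : Set (Config d N)) := by
  have : (orbitSet ε s R k : Set (Config d N)) =
      ⋂ j, ⋂ _ : j < k, (step ε s)^[j] ⁻¹' goodStep ε s R := by ext; simp [orbitSet]
  rw [this]
  exact MeasurableSet.iInter fun j => MeasurableSet.iInter fun _ =>
    ((measurable_step ε s).iterate j) measurableSet_goodStep

lemma volume_orbitSet_inter_le (hε : 0 < ε) (hR : 0 ≤ R) (hs : 0 ≤ s) (hs' : ε + 4 * R * s < 1 / 2)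
    (k : ℕ) {A : Set (Config d N)} (hA : MeasurableSet A) :
    volume (orbitSet ε s R k ∩ (step ε s)^[k] ⁻¹' A) ≤ volume A := by
  induction k generalizing A with
  | zero => exact measure_mono fun Z hZ => hZ.2
  | succ k ih =>
    calc volume (orbitSet ε s R (k + 1) ∩ (step ε s)^[k + 1] ⁻¹' A)
        ≤ volume (orbitSet ε s R k ∩ (step ε s)^[k] ⁻¹' (good ε s R ∩ step ε s ⁻¹' A)) := by
          refine measure_mono fun Z hZ => ⟨fun j hj => hZ.1 j (by omega), (hZ.1 k (by omega)).1, ?_⟩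
          have := hZ.2
          rwa [Set.mem_preimage, Function.iterate_succ_apply'] at this
      _ ≤ volume (good ε s R ∩ step ε s ⁻¹' A) :=
          ih ((measurableSet_good ε s R).inter (measurable_step ε s hA))
      _ ≤ volume A := volume_good_inter_preimage_step_le hε hR hs hs' hA

lemma iterate_mem_shell (hε : 0 < ε) (hR : 0 ≤ R) (hs : 0 ≤ s) (hs' : ε + 4 * R * s < 1 / 2)
    {k : ℕ} {Z : Config d N} (hZ : Z ∈ shell d ε N R) (h : Z ∈ orbitSet ε s R k) :
    (step ε s)^[k] Z ∈ shell d ε N R ∧ energy ((step ε s)^[k] Z) = energy Z := by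
  induction k with
  | zero => exact ⟨hZ, rfl⟩
  | succ k ih =>
    obtain ⟨h1, h2⟩ := ih fun j hj => h j (by omega)
    have h3 := h k (by omega)
    have h4 := energy_step hε hR hs hs' h3.1
    rw [Function.iterate_succ_apply']
    exact ⟨⟨h3.2, h4.le.trans h1.2⟩, h4.trans h2⟩

/-- At the first failure the orbit enters the one-step bad set, whose preimage under the preceding
good steps is no larger than the set itself. -/
lemma volume_shell_sdiff_orbitSet_le (hε : 0 < ε) (hR : 0 ≤ R) (hs : 0 ≤ s)
    (hs' : ε + 4 * R * s < 1 / 2) (k : ℕ) :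
    volume (shell d ε N R \ orbitSet ε s R k) ≤ k * volume (shell d ε N R \ goodStep ε s R) := by
  induction k with
  | zero => simp [orbitSet]
  | succ k ih =>
    have hsub : shell d ε N R \ orbitSet ε s R (k + 1) ⊆ (shell d ε N R \ orbitSet ε s R k) ∪
        (orbitSet ε s R k ∩ (step ε s)^[k] ⁻¹' (shell d ε N R \ goodStep ε s R)) := by
      rintro Z ⟨h1, h2⟩
      by_cases h : Z ∈ orbitSet ε s R k
      · refine Or.inr ⟨h, (iterate_mem_shell hε hR hs hs' h1 h).1, fun h3 => h2 fun j hj => ?_⟩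
        rcases Nat.lt_succ_iff_lt_or_eq.1 hj with hj | rfl
        · exact h j hj
        · exact h3
      · exact Or.inl ⟨h1, h⟩
    refine (measure_mono hsub).trans ((measure_union_le _ _).trans ?_)
    push_cast
    rw [add_mul, one_mul]
    exact add_le_add ih (volume_orbitSet_inter_le hε hR hs hs' k
      (measurableSet_shell.diff measurableSet_goodStep))

lemma exists_isTrajOn_iterate (hε : 0 < ε) (hR : 0 ≤ R) (hs : 0 ≤ s) (hs' : ε + 4 * R * s < 1 / 2)
    {k : ℕ} {Z : Config d N} (hZ : Z ∈ shell d ε N R) (h : Z ∈ orbitSet ε s R k) :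
    ∃ Y : ℝ → Config d N, IsTrajOn ε (k * s) Y ∧ Y 0 = Z ∧ Y (k * s) = (step ε s)^[k] Z := by
  induction k with
  | zero =>
    have hc := not_inContact_of_admissible hZ.1
    refine ⟨fun _ => Z, ⟨fun t _ _ i j hij => (hZ.1 i j hij).le, ?_, ?_, fun _ _ _ _ _ _ _ => rfl,
      fun t _ _ h => absurd h hc⟩, rfl, rfl⟩
    · convert Set.finite_empty
      ext t
      simp [hc]
    · intro a b ha hab hb _ i
      have : a = 0 ∧ b = 0 := by
        simp only [Nat.cast_zero, zero_mul] at hb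
        constructor <;> linarith
      simp [this.1, this.2, proj_zero]
  | succ k ih =>
    have hk : Z ∈ orbitSet ε s R k := fun j hj => h j (by omega)
    obtain ⟨Y, hY, hY0, hYk⟩ := ih hk
    have h3 := h k (by omega)
    obtain ⟨Y', hY', hY0', hYs'⟩ := exists_isTrajOn_step hε hR hs hs' h3.1 h3.2
    have hk0 : 0 ≤ (k : ℝ) * s := by positivity
    have hadm := (iterate_mem_shell hε hR hs hs' hZ hk).1.1
    have hc := hY.concat hk0 hY' (by rw [hY0', hYk]) (by
      rw [hYk]; exact not_inContact_of_admissible hadm)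
    have e : ((k + 1 : ℕ) : ℝ) * s = k * s + s := by push_cast; ring
    refine ⟨_, by rw [e]; exact hc, ?_, ?_⟩
    · rw [if_pos hk0, hY0]
    · rw [e, Function.iterate_succ_apply', ← hYs']
      split_ifs with h5
      · have hs0 : s = 0 := by linarith
        have h6 : Y' s = Y' 0 := by rw [hs0]
        rw [h6, hY0', ← hYk]
        congr 1
        linarith
      · rw [add_sub_cancel_left]

end Iteration

/-! ### Alexander's theorem: the flow exists almost everywhere and preserves the weighted volume. -/

section Alexander

variable {d N : ℕ} {ε R : ℝ}

lemma flow_eq_of_isTrajectory (hε : ε < 1 / 2) {Z : Config d N} {Y : ℝ → Config d N}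
    (hZ : ∃ Y : ℝ → Config d N, IsTrajectory ε Y ∧ Y 0 = Z) {T : ℝ} (hY : IsTrajOn ε T Y)
    (h0 : Y 0 = Z) {t : ℝ} (ht : 0 ≤ t) (htT : t ≤ T) : flow ε Z t = Y t := by
  rw [flow, dif_pos hZ]
  exact (hZ.choose_spec.1.isTrajOn T).unique hε hY (hZ.choose_spec.2.trans h0.symm) t ht htT

/-- The configurations that have a trajectory up to the time `t` made of `2 ^ n` good steps. -/
def dyadicSet (d : ℕ) (ε : ℝ) (N : ℕ) (R t : ℝ) (n : ℕ) : Set (Config d N) :=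
  shell d ε N R ∩ orbitSet ε (t / 2 ^ n) R (2 ^ n)

lemma eventually_step_small (hε' : ε < 1 / 2) (t : ℝ) :
    ∀ᶠ n : ℕ in atTop, ε + 4 * R * (t / 2 ^ n) < 1 / 2 := by
  have h : Tendsto (fun n : ℕ => ε + 4 * R * (t / 2 ^ n)) atTop (𝓝 (ε + 4 * R * 0)) := by
    refine tendsto_const_nhds.add (Tendsto.const_mul _ ?_)
    have := (tendsto_pow_atTop_nhds_zero_of_lt_one (r := (1 / 2 : ℝ)) (by norm_num)
      (by norm_num)).const_mul t
    simpa [div_eq_mul_inv] using this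
  exact h.eventually (gt_mem_nhds (by simpa using hε'))

/-- There are 2^n steps, each losing at most C (t/2^n)², for a total of C t² / 2^n. -/
lemma tendsto_volume_shell_sdiff_dyadicSet (hd : 1 ≤ d) (hε : 0 < ε) (hε' : ε < 1 / 2)
    (hR : 0 ≤ R) {t : ℝ} (ht : 0 < t) :
    Tendsto (fun n => volume (shell d ε N R \ dyadicSet d ε N R t n)) atTop (𝓝 0) := by
  obtain ⟨C, hC, hCs⟩ := volume_shell_sdiff_goodStep_le (N := N) hd hε hε' hR
  have hlim : Tendsto (fun n : ℕ => ENNReal.ofReal (C * t ^ 2 * (1 / 2) ^ n)) atTop (𝓝 0) := by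
    rw [← ENNReal.ofReal_zero]
    refine (ENNReal.continuous_ofReal.tendsto 0).comp ?_
    have := (tendsto_pow_atTop_nhds_zero_of_lt_one (r := (1 / 2 : ℝ)) (by norm_num)
      (by norm_num)).const_mul (C * t ^ 2)
    simpa using this
  refine tendsto_of_tendsto_of_tendsto_of_le_of_le' tendsto_const_nhds hlim
    (Eventually.of_forall fun _ => bot_le) ?_
  filter_upwards [eventually_step_small (R := R) hε' t] with n hn
  have hs : 0 < t / 2 ^ n := by positivity
  have e : shell d ε N R \ dyadicSet d ε N R t n =
      shell d ε N R \ orbitSet ε (t / 2 ^ n) R (2 ^ n) := by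
    ext Z; simp [dyadicSet]
  rw [e]
  refine (volume_shell_sdiff_orbitSet_le hε hR hs.le hn _).trans ?_
  refine (mul_le_mul_right (hCs _ hs hn) _).trans ?_
  rw [← ENNReal.ofReal_natCast, ← ENNReal.ofReal_mul (by positivity)]
  apply ENNReal.ofReal_le_ofReal
  apply le_of_eq
  push_cast
  rw [div_pow, one_div, inv_pow]
  have : (2 : ℝ) ^ n ≠ 0 := by positivity
  field_simp

lemma exists_isTrajOn_of_mem_dyadicSet (hε : 0 < ε) (hR : 0 ≤ R) {t : ℝ} (ht : 0 < t) {n : ℕ}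
    (hn : ε + 4 * R * (t / 2 ^ n) < 1 / 2) {Z : Config d N} (hZ : Z ∈ dyadicSet d ε N R t n) :
    ∃ Y : ℝ → Config d N, IsTrajOn ε t Y ∧ Y 0 = Z ∧ Y t = (step ε (t / 2 ^ n))^[2 ^ n] Z := by
  have := exists_isTrajOn_iterate hε hR (by positivity) hn hZ.1 hZ.2
  have e : ((2 ^ n : ℕ) : ℝ) * (t / 2 ^ n) = t := by push_cast; field_simp
  rwa [e] at this

lemma ae_shell_exists_isTrajOn (hd : 1 ≤ d) (hε : 0 < ε) (hε' : ε < 1 / 2) (hR : 0 ≤ R) {t : ℝ}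
    (ht : 0 < t) : ∀ᵐ Z ∂(volume : Measure (Config d N)), Z ∈ shell d ε N R →
      ∃ Y : ℝ → Config d N, IsTrajOn ε t Y ∧ Y 0 = Z := by
  rw [ae_iff]
  refine le_antisymm (ge_of_tendsto (tendsto_volume_shell_sdiff_dyadicSet (N := N) hd hε hε' hR ht) ?_) bot_le
  filter_upwards [eventually_step_small (R := R) hε' t] with n hn
  refine measure_mono fun Z hZ => ?_
  simp only [Set.mem_ofPred_eq, Classical.not_imp] at hZ
  refine ⟨hZ.1, fun h => hZ.2 ?_⟩
  obtain ⟨Y, h1, h2, -⟩ := exists_isTrajOn_of_mem_dyadicSet hε hR ht hn h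
  exact ⟨Y, h1, h2⟩

lemma mem_shell_of_admissible {Z : Config d N} (hZ : Z ∈ admissible d ε N) :
    ∃ n : ℕ, Z ∈ shell d ε N n := by
  obtain ⟨n, hn⟩ := exists_nat_ge (energy Z)
  have hE : 0 ≤ energy Z := Finset.sum_nonneg fun _ _ => by positivity
  refine ⟨n, hZ, ?_⟩
  rcases Nat.eq_zero_or_pos n with rfl | h
  · simpa using hn
  · have : (1 : ℝ) ≤ n := by exact_mod_cast h
    nlinarith

/-- Trajectories exist for almost every initial configuration. -/
theorem ae_exists_isTrajectory (hd : 1 ≤ d) (hε : 0 < ε) (hε' : ε < 1 / 2) :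
    ∀ᵐ Z ∂(volume : Measure (Config d N)), Z ∈ admissible d ε N →
      ∃ Y : ℝ → Config d N, IsTrajectory ε Y ∧ Y 0 = Z := by
  have h : ∀ᵐ Z ∂(volume : Measure (Config d N)), ∀ n T : ℕ, Z ∈ shell d ε N n →
      ∃ Y : ℝ → Config d N, IsTrajOn ε (T + 1) Y ∧ Y 0 = Z :=
    ae_all_iff.2 fun n => ae_all_iff.2 fun T =>
      ae_shell_exists_isTrajOn hd hε hε' (Nat.cast_nonneg n) (by positivity)
  filter_upwards [h] with Z hZ hadm
  obtain ⟨n, hn⟩ := mem_shell_of_admissible hadm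
  choose Y hY hY0 using fun T => hZ n T hn
  have huniq : ∀ T T' : ℕ, ∀ u : ℝ, 0 ≤ u → u ≤ T + 1 → u ≤ T' + 1 → Y T u = Y T' u := by
    intro T T' u hu h1 h2
    exact ((hY T).mono h1).unique hε' ((hY T').mono h2) (by rw [hY0, hY0]) u hu le_rfl
  -- The trajectories on the intervals [0, T + 1] agree by uniqueness; the ceiling selects one that
  -- is defined at u.
  refine ⟨fun u => Y ⌈u⌉₊ u, ?_, hY0 _⟩
  refine isTrajectory_of_forall_isTrajOn fun T => ?_
  have hT : T ≤ (⌈T⌉₊ : ℝ) + 1 := (Nat.le_ceil T).trans (by linarith)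
  refine ((hY ⌈T⌉₊).mono hT).congr fun u hu huT => ?_
  exact huniq _ _ u hu (huT.trans hT) ((Nat.le_ceil u).trans (by linarith))

lemma flow_zero {Z : Config d N} : flow ε Z 0 = Z := by
  rw [flow]
  split_ifs with h
  · exact h.choose_spec.2
  · rfl

lemma ae_dyadicSet_flow_eq (hd : 1 ≤ d) (hε : 0 < ε) (hε' : ε < 1 / 2) (hR : 0 ≤ R) {t : ℝ}
    (ht : 0 < t) {n : ℕ} (hn : ε + 4 * R * (t / 2 ^ n) < 1 / 2) :
    ∀ᵐ Z ∂(volume : Measure (Config d N)), Z ∈ dyadicSet d ε N R t n →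
      flow ε Z t = (step ε (t / 2 ^ n))^[2 ^ n] Z ∧ flow ε Z t ∈ shell d ε N R ∧
        energy (flow ε Z t) = energy Z := by
  filter_upwards [ae_exists_isTrajectory hd hε hε'] with Z hZ hmem
  obtain ⟨Y, h1, h2, h3⟩ := exists_isTrajOn_of_mem_dyadicSet hε hR ht hn hmem
  have h4 := flow_eq_of_isTrajectory hε' (hZ hmem.1.1) h1 h2 ht.le le_rfl
  have h5 := iterate_mem_shell hε hR (by positivity) hn hmem.1 hmem.2
  rw [h4, h3]
  exact ⟨rfl, h5⟩

lemma measurableSet_dyadicSet (t : ℝ) (n : ℕ) : MeasurableSet (dyadicSet d ε N R t n) :=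
  measurableSet_shell.inter (measurableSet_orbitSet _)

lemma ae_shell_mem_dyadicSet (hd : 1 ≤ d) (hε : 0 < ε) (hε' : ε < 1 / 2) (hR : 0 ≤ R) {t : ℝ}
    (ht : 0 < t) : ∃ n₀, ∀ᵐ Z ∂(volume : Measure (Config d N)), Z ∈ shell d ε N R →
      ∃ n, n₀ ≤ n ∧ Z ∈ dyadicSet d ε N R t n ∧ ε + 4 * R * (t / 2 ^ n) < 1 / 2 := by
  obtain ⟨n₀, hn₀⟩ := eventually_atTop.1 (eventually_step_small (R := R) hε' t)
  refine ⟨n₀, ?_⟩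
  rw [ae_iff]
  refine le_antisymm (ge_of_tendsto (tendsto_volume_shell_sdiff_dyadicSet (N := N) hd hε hε' hR ht) ?_) bot_le
  filter_upwards [eventually_ge_atTop n₀] with n hn
  refine measure_mono fun Z hZ => ?_
  simp only [Set.mem_ofPred_eq, Classical.not_imp] at hZ
  exact ⟨hZ.1, fun h => hZ.2 ⟨n, hn, h, hn₀ n hn⟩⟩

lemma ae_shell_energy_flow (hd : 1 ≤ d) (hε : 0 < ε) (hε' : ε < 1 / 2) (hR : 0 ≤ R) {t : ℝ}
    (ht : 0 < t) : ∀ᵐ Z ∂(volume : Measure (Config d N)), Z ∈ shell d ε N R →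
      flow ε Z t ∈ shell d ε N R ∧ energy (flow ε Z t) = energy Z := by
  obtain ⟨n₀, h⟩ := ae_shell_mem_dyadicSet (N := N) hd hε hε' hR ht
  have h2 : ∀ᵐ Z ∂(volume : Measure (Config d N)), ∀ n : ℕ, ε + 4 * R * (t / 2 ^ n) < 1 / 2 →
      Z ∈ dyadicSet d ε N R t n → _ := ae_all_iff.2 fun n =>
    if hn : ε + 4 * R * (t / 2 ^ n) < 1 / 2 then
      (ae_dyadicSet_flow_eq hd hε hε' hR ht hn).mono fun Z h _ => h
    else ae_of_all _ fun Z h' => absurd h' hn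
  filter_upwards [h, h2] with Z h1 h2 hZ
  obtain ⟨n, -, h3, h4⟩ := h1 hZ
  exact (h2 n h4 h3).2

lemma aemeasurable_flow_shell (hd : 1 ≤ d) (hε : 0 < ε) (hε' : ε < 1 / 2) (hR : 0 ≤ R) {t : ℝ}
    (ht : 0 < t) :
    AEMeasurable (fun Z : Config d N => flow ε Z t) (volume.restrict (shell d ε N R)) := by
  obtain ⟨n₀, h⟩ := ae_shell_mem_dyadicSet (N := N) hd hε hε' hR ht
  let A : ℕ → Set (Config d N) := fun n =>
    if ε + 4 * R * (t / 2 ^ n) < 1 / 2 then dyadicSet d ε N R t n else ∅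
  have hA : AEMeasurable (fun Z : Config d N => flow ε Z t) (volume.restrict (⋃ n, A n)) := by
    rw [aemeasurable_iUnion_iff]
    intro n
    by_cases hn : ε + 4 * R * (t / 2 ^ n) < 1 / 2
    · simp only [A, if_pos hn]
      refine ⟨(step ε (t / 2 ^ n))^[2 ^ n], (measurable_step ε _).iterate _, ?_⟩
      rw [EventuallyEq, ae_restrict_iff' (measurableSet_dyadicSet t n)]
      exact (ae_dyadicSet_flow_eq hd hε hε' hR ht hn).mono fun Z h hm => (h hm).1
    · simp only [A, if_neg hn, Measure.restrict_empty]
      exact aemeasurable_zero_measure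
  refine hA.mono_ac (Measure.absolutelyContinuous_of_le ?_)
  refine Measure.le_iff.2 fun s hs => ?_
  rw [Measure.restrict_apply hs, Measure.restrict_apply hs]
  refine measure_mono_ae ?_
  filter_upwards [h] with Z hZ hmem
  obtain ⟨n, -, h3, h4⟩ := hZ hmem.2
  refine ⟨hmem.1, Set.mem_iUnion.2 ⟨n, ?_⟩⟩
  simp only [A, if_pos h4]
  exact h3

/-- Outside a set of vanishing volume the flow is an iterated step, hence the push-forward is at
most the original measure. Both are finite with the same mass, so they coincide; the inverse flow is
never needed. -/
lemma map_flow_shell (hd : 1 ≤ d) (hε : 0 < ε) (hε' : ε < 1 / 2) (hR : 0 ≤ R) {t : ℝ}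
    (ht : 0 < t) : (volume.restrict (shell d ε N R)).map (fun Z : Config d N => flow ε Z t) =
      volume.restrict (shell d ε N R) := by
  have hm := aemeasurable_flow_shell (N := N) hd hε hε' hR ht
  have hfin : IsFiniteMeasure (volume.restrict (shell d ε N R)) := by
    refine ⟨?_⟩
    rw [Measure.restrict_apply_univ]
    exact (measure_mono fun Z hZ => hZ.2).trans_lt (volume_energy_lt_top (d := d) (N := N) hR)
  have hle : (volume.restrict (shell d ε N R)).map (fun Z : Config d N => flow ε Z t) ≤
      volume.restrict (shell d ε N R) := by
    refine Measure.le_iff.2 fun A hA => ?_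
    rw [Measure.map_apply_of_aemeasurable hm hA]
    have hlim : Tendsto (fun n => volume (A ∩ shell d ε N R) +
        volume (shell d ε N R \ dyadicSet d ε N R t n)) atTop (𝓝 (volume (A ∩ shell d ε N R) + 0)) :=
      tendsto_const_nhds.add (tendsto_volume_shell_sdiff_dyadicSet hd hε hε' hR ht)
    rw [add_zero] at hlim
    rw [Measure.restrict_apply hA]
    refine ge_of_tendsto hlim ?_
    filter_upwards [eventually_step_small (R := R) hε' t] with n hn
    rw [Measure.restrict_apply' measurableSet_shell]
    have hAs : MeasurableSet (A ∩ shell d ε N R) := hA.inter measurableSet_shell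
    calc volume ((fun Z : Config d N => flow ε Z t) ⁻¹' A ∩ shell d ε N R)
        ≤ volume ((orbitSet ε (t / 2 ^ n) R (2 ^ n) ∩
            (step ε (t / 2 ^ n))^[2 ^ n] ⁻¹' (A ∩ shell d ε N R)) ∪
            (shell d ε N R \ dyadicSet d ε N R t n)) := by
          refine measure_mono_ae ?_
          filter_upwards [ae_dyadicSet_flow_eq hd hε hε' hR ht hn] with Z h hZ
          by_cases hmem : Z ∈ dyadicSet d ε N R t n
          · obtain ⟨h1, h2, -⟩ := h hmem
            refine Or.inl ⟨hmem.2, ?_⟩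
            rw [Set.mem_preimage, ← h1]
            exact ⟨hZ.1, h2⟩
          · exact Or.inr ⟨hZ.2, hmem⟩
      _ ≤ _ := measure_union_le _ _
      _ ≤ _ := by
          exact add_le_add_left (volume_orbitSet_inter_le hε hR (by positivity) hn _ hAs) _
  refine Measure.eq_of_le_of_measure_univ_eq hle ?_
  rw [Measure.map_apply_of_aemeasurable hm MeasurableSet.univ, Set.preimage_univ]

lemma iUnion_shell : ⋃ n : ℕ, shell d ε N n = admissible d ε N := by
  ext Z
  rw [Set.mem_iUnion]
  exact ⟨fun ⟨n, h⟩ => h.1, mem_shell_of_admissible⟩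

/-- **Alexander's theorem**: the hard sphere flow preserves the volume. -/
theorem measurePreserving_flow_volume (hd : 1 ≤ d) (hε : 0 < ε) (hε' : ε < 1 / 2) {t : ℝ}
    (ht : 0 < t) :
    AEMeasurable (fun Z : Config d N => flow ε Z t) (volume.restrict (admissible d ε N)) ∧
    (volume.restrict (admissible d ε N)).map (fun Z : Config d N => flow ε Z t) =
      volume.restrict (admissible d ε N) := by
  have hm : AEMeasurable (fun Z : Config d N => flow ε Z t)
      (volume.restrict (admissible d ε N)) := by
    rw [← iUnion_shell, aemeasurable_iUnion_iff]
    exact fun n => aemeasurable_flow_shell hd hε hε' (Nat.cast_nonneg n) ht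
  refine ⟨hm, ?_⟩
  have hdir : Directed (· ⊆ ·) fun n : ℕ => shell d ε N n := by
    refine Monotone.directed_le (f := fun n : ℕ => shell d ε N n) fun a b hab Z hZ => ⟨hZ.1, hZ.2.trans ?_⟩
    have : (a : ℝ) ≤ b := by exact_mod_cast hab
    gcongr
  ext A hA
  rw [Measure.map_apply_of_aemeasurable hm hA]
  -- The exhaustion by shells below is applied to a measurable set, so the preimage under the flow
  -- is replaced by one for a measurable version.
  have e1 : (fun Z : Config d N => flow ε Z t) ⁻¹' A =ᵐ[volume.restrict (admissible d ε N)]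
      hm.mk _ ⁻¹' A := by
    filter_upwards [hm.ae_eq_mk] with Z hZ
    exact congrArg (fun W => W ∈ A) hZ
  have hg := hm.measurable_mk hA
  rw [measure_congr e1]
  generalize hG : (hm.mk _ ⁻¹' A) = G at e1 hg
  rw [← iUnion_shell, Measure.restrict_iUnion_apply_eq_iSup hdir hg,
    Measure.restrict_iUnion_apply_eq_iSup hdir hA]
  congr 1
  funext n
  have h1 : shell d ε N n ⊆ admissible d ε N := fun Z hZ => hZ.1
  conv_rhs => rw [← map_flow_shell hd hε hε' (Nat.cast_nonneg n) ht]
  rw [Measure.map_apply_of_aemeasurable (aemeasurable_flow_shell hd hε hε' (Nat.cast_nonneg n) ht) hA]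
  exact (measure_congr (ae_mono (Measure.restrict_mono h1 le_rfl) e1)).symm

lemma ae_energy_flow (hd : 1 ≤ d) (hε : 0 < ε) (hε' : ε < 1 / 2) {t : ℝ} (ht : 0 < t) :
    ∀ᵐ Z ∂(volume.restrict (admissible d ε N)),
      flow ε Z t ∈ admissible d ε N ∧ energy (flow ε Z t) = energy Z := by
  rw [ae_restrict_iff' (measurableSet_admissible d ε N)]
  have h : ∀ᵐ Z ∂(volume : Measure (Config d N)), ∀ n : ℕ, Z ∈ shell d ε N n → _ :=
    ae_all_iff.2 fun n => ae_shell_energy_flow hd hε hε' (Nat.cast_nonneg n) ht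
  filter_upwards [h] with Z hZ hadm
  obtain ⟨n, hn⟩ := mem_shell_of_admissible hadm
  exact ⟨(hZ n hn).1.1, (hZ n hn).2⟩

lemma measurePreserving_withDensity {α : Type*} [MeasurableSpace α] {m : Measure α} {f : α → α}
    (hf : AEMeasurable f m) (hmap : m.map f = m) {φ : α → ENNReal} (hφ : Measurable φ)
    (hinv : ∀ᵐ x ∂m, φ (f x) = φ x) :
    AEMeasurable f (m.withDensity φ) ∧ (m.withDensity φ).map f = m.withDensity φ := by
  have hf' : AEMeasurable f (m.withDensity φ) := hf.mono_ac (withDensity_absolutelyContinuous m φ)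
  refine ⟨hf', ?_⟩
  have hg := hf.ae_eq_mk
  have hgm := hf.measurable_mk
  rw [Measure.map_congr ((withDensity_absolutelyContinuous m φ).ae_eq hg)]
  have hgmap : m.map (hf.mk f) = m := by rw [← Measure.map_congr hg, hmap]
  ext A hA
  rw [Measure.map_apply hgm hA, withDensity_apply _ (hgm hA), withDensity_apply _ hA]
  conv_rhs => rw [← hgmap]
  rw [setLIntegral_map hA hφ hgm]
  refine lintegral_congr_ae (ae_restrict_of_ae ?_)
  filter_upwards [hg, hinv] with x h1 h2
  rw [← h1, h2]

lemma prod_maxwellian (Z : Config d N) : ∏ i, maxwellian (Z i).2 =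
    (1 / (2 * Real.pi) ^ ((d : ℝ) / 2)) ^ N * Real.exp (-energy Z / 2) := by
  simp only [maxwellian, Finset.prod_mul_distrib, Finset.prod_const, Finset.card_univ,
    Fintype.card_fin, ← Real.exp_sum, energy]
  congr 2
  rw [neg_div, Finset.sum_div, ← Finset.sum_neg_distrib]
  exact Finset.sum_congr rfl fun k _ => by ring

/-- The flow preserves the `N`-particle equilibrium measure. -/
theorem measurePreserving_flow_weight (hd : 1 ≤ d) (hε : 0 < ε) (hε' : ε < 1 / 2) {t : ℝ}
    (ht : 0 ≤ t) :
    AEMeasurable (fun Z : Config d N => flow ε Z t) (weight d ε N) ∧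
      (weight d ε N).map (fun Z : Config d N => flow ε Z t) = weight d ε N := by
  rcases ht.eq_or_lt with rfl | ht
  · simp only [flow_zero]
    exact ⟨aemeasurable_id', Measure.map_id'⟩
  · obtain ⟨h1, h2⟩ := measurePreserving_flow_volume (N := N) hd hε hε' ht
    have hφ : Measurable fun Z : Config d N => ENNReal.ofReal (∏ i, maxwellian (Z i).2) := by
      simp only [prod_maxwellian]
      have := measurable_energy (d := d) (N := N)
      fun_prop
    obtain ⟨h3, h4⟩ := measurePreserving_withDensity h1 h2 hφ (by
      filter_upwards [ae_energy_flow hd hε hε' ht] with Z hZ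
      rw [prod_maxwellian, prod_maxwellian, hZ.2])
    refine ⟨?_, ?_⟩
    · exact h3.smul_measure _
    · rw [weight, Measure.map_smul, h4]

end Alexander

/-! ### The grand canonical hard-core gas and Mecke's formula. -/

section Gas

variable {X : Type*}

/-- Finite configurations of points of `X`. -/
abbrev PointConf (X : Type*) : Type _ := Σ N : ℕ, Fin N → X

open Classical in
/-- The indicator function of the points `z` which are not in conflict with `x`. -/
def free (R : X → X → Prop) (x z : X) : ℝ := if R x z then 0 else 1

lemma free_nonneg (R : X → X → Prop) (x z : X) : 0 ≤ free R x z := by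
  unfold free; split_ifs <;> norm_num

lemma free_le_one (R : X → X → Prop) (x z : X) : free R x z ≤ 1 := by
  unfold free; split_ifs <;> norm_num

lemma prod_free_eq {R : X → X → Prop} (x : X) {n : ℕ} (Z : Fin n → X) :
    ∏ i, free R x (Z i) = Set.indicator {Z : Fin n → X | ∀ j, ¬ R x (Z j)} (fun _ => 1) Z := by
  by_cases h : Z ∈ {Z : Fin n → X | ∀ j, ¬ R x (Z j)}
  · rw [Set.indicator_of_mem h]
    exact Finset.prod_eq_one fun i _ => by simp [free, h i]
  · rw [Set.indicator_of_notMem h]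
    simp only [Set.mem_ofPred_eq] at h
    push Not at h
    obtain ⟨j, hj⟩ := h
    exact Finset.prod_eq_zero (Finset.mem_univ j) (by simp [free, hj])

/-- Configurations without any pair of points related by `R`. -/
def hardCore (R : X → X → Prop) (N : ℕ) : Set (Fin N → X) :=
  {Z | ∀ i j, i ≠ j → ¬ R (Z i) (Z j)}

lemma mem_hardCore_succ {R : X → X → Prop} (hs : ∀ x y, R x y → R y x) {n : ℕ}
    (i : Fin (n + 1)) (Z : Fin (n + 1) → X) :
    Z ∈ hardCore R (n + 1) ↔
      (fun j => Z (i.succAbove j)) ∈ hardCore R n ∧ ∀ j, ¬ R (Z i) (Z (i.succAbove j)) := by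
  refine ⟨fun h => ⟨fun j k hjk => h _ _ fun e => hjk (Fin.succAbove_right_injective e),
    fun j => h _ _ (Fin.succAbove_ne i j).symm⟩, fun ⟨h1, h2⟩ a b hab => ?_⟩
  rcases Fin.eq_self_or_eq_succAbove i a with rfl | ⟨j, rfl⟩
  · rcases Fin.eq_self_or_eq_succAbove a b with rfl | ⟨k, rfl⟩
    · exact absurd rfl hab
    · exact h2 k
  · rcases Fin.eq_self_or_eq_succAbove i b with rfl | ⟨k, rfl⟩
    · exact fun h => h2 j (hs _ _ h)
    · exact h1 j k fun e => hab (by rw [e])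

variable [MeasurableSpace X]

lemma measurable_sigma {β : Type*} [MeasurableSpace β] {f : PointConf X → β}
    (h : ∀ N, Measurable fun Z : Fin N → X => f ⟨N, Z⟩) : Measurable f := fun s hs => by
  rw [Sigma.instMeasurableSpace, MeasurableSpace.measurableSet_iInf]
  exact fun N => h N hs

lemma measurable_sigma_mk (N : ℕ) :
    Measurable (fun Z : Fin N → X => (⟨N, Z⟩ : PointConf X)) := fun s hs => by
  rw [Sigma.instMeasurableSpace, MeasurableSpace.measurableSet_iInf] at hs
  exact hs N

lemma measurable_number {β : Type*} [MeasurableSpace β] (f : ℕ → β) :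
    Measurable fun Z : PointConf X => f Z.1 :=
  measurable_sigma fun N => (measurable_const : Measurable fun _ : Fin N → X => f N)

/-- The unnormalized `N`-particle law of the hard-core gas with intensity `ν` and forbidden
relation `R`. -/
def gasLevel (ν : Measure X) (R : X → X → Prop) (N : ℕ) : Measure (Fin N → X) :=
  (N.factorial : ENNReal)⁻¹ • (Measure.pi fun _ => ν).restrict (hardCore R N)

/-- The unnormalized grand canonical hard-core gas. -/
def gas (ν : Measure X) (R : X → X → Prop) : Measure (PointConf X) :=
  Measure.sum fun N => (gasLevel ν R N).map (Sigma.mk N)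

variable {ν : Measure X} {R : X → X → Prop}

lemma measurable_free (hR : MeasurableSet {p : X × X | R p.1 p.2}) :
    Measurable fun p : X × X => free R p.1 p.2 :=
  Measurable.ite hR measurable_const measurable_const

lemma measurable_free_right (hR : MeasurableSet {p : X × X | R p.1 p.2}) (x : X) :
    Measurable (free R x) :=
  (measurable_free hR).comp (measurable_const.prodMk measurable_id)

lemma measurable_free_prod (hR : MeasurableSet {p : X × X | R p.1 p.2}) (n : ℕ) :
    Measurable fun p : X × (Fin n → X) => ∏ i, free R p.1 (p.2 i) := by
  refine Finset.measurable_prod _ fun i _ => ?_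
  exact (measurable_free hR).comp
    (measurable_fst.prodMk ((measurable_pi_apply i).comp measurable_snd))

lemma measurableSet_hardCore (hR : MeasurableSet {p : X × X | R p.1 p.2}) (N : ℕ) :
    MeasurableSet (hardCore R N) := by
  have : hardCore R N = ⋂ i, ⋂ j, ⋂ _ : i ≠ j, {Z | ¬ R (Z i) (Z j)} := by
    ext Z; simp [hardCore]
  rw [this]
  refine MeasurableSet.iInter fun i => MeasurableSet.iInter fun j => MeasurableSet.iInter fun _ => ?_
  exact (hR.preimage ((measurable_pi_apply (X := fun _ => X) i).prodMk (measurable_pi_apply j))).compl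

lemma gasLevel_le [IsFiniteMeasure ν] (N : ℕ) :
    gasLevel ν R N Set.univ ≤ ENNReal.ofReal (ν.real Set.univ ^ N / N.factorial) := by
  rw [gasLevel, Measure.smul_apply, smul_eq_mul, ENNReal.ofReal_div_of_pos (by positivity),
    ENNReal.ofReal_pow measureReal_nonneg, measureReal_def,
    ENNReal.ofReal_toReal (measure_ne_top _ _), ENNReal.ofReal_natCast, div_eq_mul_inv, mul_comm]
  gcongr
  refine (Measure.restrict_apply_le _ _).trans ?_
  rw [Measure.pi_univ]
  simp

instance [IsFiniteMeasure ν] (N : ℕ) : IsFiniteMeasure (gasLevel ν R N) :=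
  ⟨(gasLevel_le N).trans_lt ENNReal.ofReal_lt_top⟩

lemma lintegral_gas {f : PointConf X → ENNReal} (hf : Measurable f) :
    ∫⁻ Z, f Z ∂(gas ν R) = ∑' N, ∫⁻ Z, f ⟨N, Z⟩ ∂(gasLevel ν R N) := by
  rw [gas, lintegral_sum_measure]
  exact tsum_congr fun N => lintegral_map hf (measurable_sigma_mk N)

/-- The factor 1/N! gives the number of points every exponential moment, which makes all the
functionals below integrable. -/
lemma lintegral_gas_pow_lt_top [IsFiniteMeasure ν] {A : ℝ} (hA : 0 ≤ A) :
    ∫⁻ Z, ENNReal.ofReal (A ^ Z.1) ∂(gas ν R) < ⊤ := by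
  rw [lintegral_gas (measurable_number fun n => ENNReal.ofReal (A ^ n))]
  have h1 : ∀ N : ℕ, ∫⁻ _, ENNReal.ofReal (A ^ N) ∂(gasLevel ν R N) ≤
      ENNReal.ofReal ((A * ν.real Set.univ) ^ N / N.factorial) := fun N => by
    rw [lintegral_const, mul_pow, mul_div_assoc, ENNReal.ofReal_mul (by positivity)]
    gcongr
    exact gasLevel_le N
  refine (ENNReal.tsum_le_tsum h1).trans_lt ?_
  rw [← ENNReal.ofReal_tsum_of_nonneg (fun n => by positivity) (Real.summable_pow_div_factorial _)]
  exact ENNReal.ofReal_lt_top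

lemma integrable_gas [IsFiniteMeasure ν] {f : PointConf X → ℝ} (hf : Measurable f)
    {A C : ℝ} (hA : 0 ≤ A) (hb : ∀ Z, |f Z| ≤ C * A ^ Z.1) : Integrable f (gas ν R) := by
  have h : Integrable (fun Z : PointConf X => C * A ^ Z.1) (gas ν R) := by
    refine Integrable.const_mul ⟨(measurable_number fun n => A ^ n).aestronglyMeasurable,
      ?_⟩ C
    have := lintegral_gas_pow_lt_top (ν := ν) (R := R) hA
    refine lt_of_eq_of_lt (lintegral_congr fun Z => ?_) this
    exact Real.enorm_of_nonneg (by positivity)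
  exact h.mono' hf.aestronglyMeasurable (ae_of_all _ hb)

instance [IsFiniteMeasure ν] : IsFiniteMeasure (gas ν R) := by
  have := lintegral_gas_pow_lt_top (ν := ν) (R := R) zero_le_one
  simp only [one_pow, ENNReal.ofReal_one, lintegral_one] at this
  exact ⟨this⟩

lemma hasSum_integral_gas {f : PointConf X → ℝ} (hf : Measurable f)
    (hi : Integrable f (gas ν R)) :
    HasSum (fun N => ∫ Z, f ⟨N, Z⟩ ∂(gasLevel ν R N)) (∫ Z, f Z ∂(gas ν R)) := by
  have e : (fun N => ∫ Z, f ⟨N, Z⟩ ∂(gasLevel ν R N)) =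
      fun N => ∫ Z, f Z ∂((gasLevel ν R N).map (Sigma.mk N)) := funext fun N =>
    (integral_map (measurable_sigma_mk N).aemeasurable hf.aestronglyMeasurable).symm
  rw [e]
  exact hasSum_integral_measure hi

/-- Isolating the i-th point: 1/(n+1)! leaves a factor 1/(n+1), which the n + 1 choices of i
compensate in Mecke's formula. -/
lemma map_gasLevel_succ [SigmaFinite ν] (hR : MeasurableSet {p : X × X | R p.1 p.2})
    (hs : ∀ x y, R x y → R y x) {n : ℕ} (i : Fin (n + 1)) :
    (gasLevel ν R (n + 1)).map (MeasurableEquiv.piFinSuccAbove (fun _ => X) i) =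
      ((n + 1 : ℕ) : ENNReal)⁻¹ • (ν.prod (gasLevel ν R n)).restrict
        {p | ∀ j, ¬ R p.1 (p.2 j)} := by
  have hC : MeasurableSet {p : X × (Fin n → X) | ∀ j, ¬ R p.1 (p.2 j)} := by
    rw [Set.ofPred_forall]
    exact MeasurableSet.iInter fun j => (hR.preimage (measurable_fst.prodMk
      ((measurable_pi_apply j).comp measurable_snd))).compl
  set e := MeasurableEquiv.piFinSuccAbove (fun _ : Fin (n + 1) => X) i with he
  have hpre : e ⁻¹' ((Set.univ ×ˢ hardCore R n) ∩ {p | ∀ j, ¬ R p.1 (p.2 j)}) =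
      hardCore R (n + 1) := by
    ext Z
    rw [mem_hardCore_succ hs i]
    simp only [Set.mem_preimage, Set.mem_inter_iff, Set.mem_prod, Set.mem_univ, true_and]
    rfl
  have hmp := (measurePreserving_piFinSuccAbove (fun _ : Fin (n + 1) => ν) i).restrict_preimage
    (((MeasurableSet.univ (α := X)).prod (measurableSet_hardCore hR n)).inter hC)
  rw [hpre] at hmp
  rw [gasLevel, Measure.map_smul, hmp.map_eq, gasLevel, Measure.prod_smul_right,
    Measure.restrict_smul, smul_smul]
  have hprod : ν.prod ((Measure.pi fun _ : Fin n => ν).restrict (hardCore R n)) =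
      (ν.prod (Measure.pi fun _ : Fin n => ν)).restrict (Set.univ ×ˢ hardCore R n) := by
    rw [← Measure.prod_restrict, Measure.restrict_univ]
  rw [hprod, Measure.restrict_restrict hC, Set.inter_comm]
  congr 1
  rw [Nat.factorial_succ, Nat.cast_mul, ENNReal.mul_inv (by simp) (by simp)]

lemma measurable_removeNth {β : Type*} [MeasurableSpace β] {n : ℕ} {G : X → (Fin n → X) → β}
    (hG : Measurable fun p : X × (Fin n → X) => G p.1 p.2) (i : Fin (n + 1)) :
    Measurable fun Z : Fin (n + 1) → X => G (Z i) (fun j => Z (i.succAbove j)) :=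
  hG.comp (MeasurableEquiv.piFinSuccAbove (fun _ : Fin (n + 1) => X) i).measurable

/-- Mecke's inequality. -/
lemma lintegral_gas_le [IsFiniteMeasure ν] (hR : MeasurableSet {p : X × X | R p.1 p.2})
    (hs : ∀ x y, R x y → R y x) {F : PointConf X → ENNReal}
    {G : ∀ n, X → (Fin n → X) → ENNReal} (hF : Measurable F)
    (hG : ∀ n, Measurable fun p : X × (Fin n → X) => G n p.1 p.2)
    (h0 : ∀ Z, F ⟨0, Z⟩ = 0)
    (hS : ∀ n Z, F ⟨n + 1, Z⟩ ≤ ∑ i, G n (Z i) (fun j => Z (i.succAbove j))) :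
    ∫⁻ Z, F Z ∂(gas ν R) ≤ ∫⁻ x, ∫⁻ Z, G Z.1 x Z.2 ∂(gas ν R) ∂ν := by
  have h1 : ∀ n, ∫⁻ Z, F ⟨n + 1, Z⟩ ∂(gasLevel ν R (n + 1)) ≤
      ∫⁻ x, ∫⁻ Z, G n x Z ∂(gasLevel ν R n) ∂ν := fun n => by
    calc _ ≤ ∫⁻ Z, ∑ i, G n (Z i) (fun j => Z (i.succAbove j)) ∂(gasLevel ν R (n + 1)) :=
          lintegral_mono (hS n)
      _ = ∑ i, ∫⁻ Z, G n (Z i) (fun j => Z (i.succAbove j)) ∂(gasLevel ν R (n + 1)) :=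
          lintegral_finsetSum _ fun i _ => measurable_removeNth (hG n) i
      _ ≤ ∑ _i : Fin (n + 1), ((n + 1 : ℕ) : ENNReal)⁻¹ *
            ∫⁻ x, ∫⁻ Z, G n x Z ∂(gasLevel ν R n) ∂ν := by
          refine Finset.sum_le_sum fun i _ => ?_
          have := lintegral_map (μ := gasLevel ν R (n + 1)) (hG n)
            (MeasurableEquiv.piFinSuccAbove (fun _ : Fin (n + 1) => X) i).measurable
          rw [map_gasLevel_succ hR hs i, lintegral_smul_measure] at this
          refine this.symm.le.trans ?_
          rw [smul_eq_mul]
          gcongr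
          refine (setLIntegral_le_lintegral _ _).trans ?_
          rw [lintegral_prod _ (hG n).aemeasurable]
      _ = _ := by
          rw [Finset.sum_const, Finset.card_univ, Fintype.card_fin, nsmul_eq_mul, ← mul_assoc,
            ENNReal.mul_inv_cancel (by simp) (by simp), one_mul]
  have hGs : ∀ x, Measurable fun Z : PointConf X => G Z.1 x Z.2 := fun x =>
    measurable_sigma fun n => (hG n).comp (measurable_const.prodMk measurable_id)
  rw [lintegral_gas hF, tsum_eq_zero_add' ENNReal.summable]
  simp only [h0, lintegral_zero, zero_add]
  refine (ENNReal.tsum_le_tsum h1).trans ?_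
  rw [← lintegral_tsum fun n => ((hG n).lintegral_prod_right').aemeasurable]
  exact lintegral_mono fun x => (lintegral_gas (hGs x)).ge

/-- Mecke's formula. -/
lemma integral_gas_eq [IsFiniteMeasure ν] (hR : MeasurableSet {p : X × X | R p.1 p.2})
    (hs : ∀ x y, R x y → R y x) {F : PointConf X → ℝ}
    {G : ∀ n, X → (Fin n → X) → ℝ} (hF : Measurable F)
    (hG : ∀ n, Measurable fun p : X × (Fin n → X) => G n p.1 p.2)
    (h0 : ∀ Z, F ⟨0, Z⟩ = 0)
    (hS : ∀ n Z, F ⟨n + 1, Z⟩ = ∑ i, G n (Z i) (fun j => Z (i.succAbove j)))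
    {A C : ℝ} (hA : 1 ≤ A) (hC : 0 ≤ C) (hb : ∀ n x Z, |G n x Z| ≤ C * A ^ n) :
    ∫ Z, F Z ∂(gas ν R) = ∫ x, ∫ Z, G Z.1 x Z.2 * ∏ i, free R x (Z.2 i) ∂(gas ν R) ∂ν := by
  set G' : ∀ n, X → (Fin n → X) → ℝ := fun n x Z => G n x Z * ∏ i, free R x (Z i) with hG'
  have hG'm : ∀ n, Measurable fun p : X × (Fin n → X) => G' n p.1 p.2 := fun n =>
    (hG n).mul (measurable_free_prod hR n)
  have hG'b : ∀ n x Z, |G' n x Z| ≤ C * A ^ n := fun n x Z => by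
    rw [hG']
    simp only [abs_mul]
    refine (mul_le_of_le_one_right (abs_nonneg _) ?_).trans (hb n x Z)
    rw [abs_of_nonneg (Finset.prod_nonneg fun i _ => free_nonneg R x (Z i))]
    exact Finset.prod_le_one (fun i _ => free_nonneg R x (Z i)) fun i _ => free_le_one R x (Z i)
  have hGs : ∀ x, Measurable fun Z : PointConf X => G' Z.1 x Z.2 := fun x =>
    measurable_sigma fun n => (hG'm n).comp (measurable_const.prodMk measurable_id)
  have hG'i : ∀ n, Integrable (fun p : X × (Fin n → X) => G' n p.1 p.2)
      (ν.prod (gasLevel ν R n)) := fun n =>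
    (integrable_const (C * A ^ n)).mono' (hG'm n).aestronglyMeasurable
      (ae_of_all _ fun p => hG'b n p.1 p.2)
  have h1 : ∀ n, ∫ Z, F ⟨n + 1, Z⟩ ∂(gasLevel ν R (n + 1)) =
      ∫ x, ∫ Z, G' n x Z ∂(gasLevel ν R n) ∂ν := fun n => by
    have hi : ∀ i : Fin (n + 1), ∫ Z, G n (Z i) (fun j => Z (i.succAbove j))
        ∂(gasLevel ν R (n + 1)) =
        ((n : ℝ) + 1)⁻¹ * ∫ x, ∫ Z, G' n x Z ∂(gasLevel ν R n) ∂ν := fun i => by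
      have := integral_map_equiv (μ := gasLevel ν R (n + 1))
        (MeasurableEquiv.piFinSuccAbove (fun _ : Fin (n + 1) => X) i)
        (fun p => G n p.1 p.2)
      rw [map_gasLevel_succ hR hs i, integral_smul_measure] at this
      refine this.symm.trans ?_
      have hC : MeasurableSet {p : X × (Fin n → X) | ∀ j, ¬ R p.1 (p.2 j)} := by
        rw [Set.ofPred_forall]
        exact MeasurableSet.iInter fun j => (hR.preimage (measurable_fst.prodMk
          ((measurable_pi_apply j).comp measurable_snd))).compl
      rw [← integral_indicator hC, ← integral_prod _ (hG'i n), smul_eq_mul, ENNReal.toReal_inv,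
        ENNReal.toReal_natCast, Nat.cast_add_one]
      congr 1
      refine integral_congr_ae (ae_of_all _ fun p => ?_)
      simp only [hG', prod_free_eq]
      by_cases hp : ∀ j, ¬ R p.1 (p.2 j)
      · rw [Set.indicator_of_mem (Set.mem_ofPred_eq ▸ hp),
          Set.indicator_of_mem (Set.mem_ofPred_eq ▸ hp), mul_one]
      · rw [Set.indicator_of_notMem (Set.mem_ofPred_eq ▸ hp),
          Set.indicator_of_notMem (Set.mem_ofPred_eq ▸ hp), mul_zero]
    have hint : ∀ i : Fin (n + 1), Integrable (fun Z : Fin (n + 1) → X =>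
        G n (Z i) (fun j => Z (i.succAbove j))) (gasLevel ν R (n + 1)) := fun i =>
      (integrable_const (C * A ^ n)).mono' (measurable_removeNth (hG n) i).aestronglyMeasurable
        (ae_of_all _ fun Z => hb n _ _)
    simp only [hS]
    rw [integral_finsetSum _ fun i _ => hint i]
    simp only [hi, Finset.sum_const, Finset.card_univ, Fintype.card_fin, nsmul_eq_mul]
    push_cast
    field_simp
  have hFb : ∀ Z : PointConf X, |F Z| ≤ C * (2 * A) ^ Z.1 := by
    rintro ⟨_ | n, Z⟩
    · simp [h0, hC]
    · rw [hS]
      refine (Finset.abs_sum_le_sum_abs _ _).trans ((Finset.sum_le_sum fun i _ =>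
        hb n _ _).trans ?_)
      rw [Finset.sum_const, Finset.card_univ, Fintype.card_fin, nsmul_eq_mul, mul_pow]
      have h2 : ((n + 1 : ℕ) : ℝ) ≤ 2 ^ (n + 1) := by exact_mod_cast (Nat.lt_two_pow_self).le
      have h3 : A ^ n ≤ A ^ (n + 1) := pow_le_pow_right₀ hA (Nat.le_succ n)
      calc ((n + 1 : ℕ) : ℝ) * (C * A ^ n) = C * (((n + 1 : ℕ) : ℝ) * A ^ n) := by ring
        _ ≤ C * (2 ^ (n + 1) * A ^ (n + 1)) := by gcongr
  have hFi := integrable_gas (ν := ν) (R := R) hF (by positivity) hFb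
  have e1 := (hasSum_nat_add_iff' 1).2 (hasSum_integral_gas hF hFi)
  simp only [Finset.range_one, Finset.sum_singleton, h0, integral_zero, sub_zero, h1] at e1
  -- Sum over n and integral over x are exchanged by domination with an exponential series.
  have e2 : HasSum (fun n => ∫ x, ∫ Z, G' n x Z ∂(gasLevel ν R n) ∂ν)
      (∫ x, ∑' n, ∫ Z, G' n x Z ∂(gasLevel ν R n) ∂ν) := by
    refine hasSum_integral_of_summable_integral_norm (fun n => (hG'i n).integral_prod_left) ?_
    refine Summable.of_nonneg_of_le (fun n => integral_nonneg fun x => norm_nonneg _)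
      (fun n => ?_) ((Real.summable_pow_div_factorial (A * ν.real Set.univ)).mul_left
        (C * ν.real Set.univ))
    have hb1 : ∀ x, ‖∫ Z, G' n x Z ∂(gasLevel ν R n)‖ ≤
        C * A ^ n * (ν.real Set.univ ^ n / n.factorial) := fun x => by
      refine (norm_integral_le_of_norm_le_const (ae_of_all _ fun Z => hG'b n x Z)).trans ?_
      gcongr
      exact ENNReal.toReal_le_of_le_ofReal (by positivity) (gasLevel_le n)
    calc _ ≤ ∫ _, C * A ^ n * (ν.real Set.univ ^ n / n.factorial) ∂ν :=
          integral_mono_of_nonneg (ae_of_all _ fun x => norm_nonneg _) (integrable_const _)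
            (ae_of_all _ hb1)
      _ = _ := by rw [integral_const, smul_eq_mul, mul_pow]; ring
  rw [e1.unique e2]
  refine integral_congr_ae (ae_of_all _ fun x => ?_)
  exact (hasSum_integral_gas (hGs x) (integrable_gas (hGs x) (by positivity)
    fun Z => hG'b Z.1 x Z.2)).tsum_eq

end Gas

/-! ### Weighted gas integrals and their derivatives. -/

section GasMean

variable {X : Type*}

lemma abs_add_sum_le {h : X → ℝ} {a H : ℝ} (hh : ∀ x, |h x| ≤ H) {n : ℕ} (Z : Fin n → X) :
    |a + ∑ i, h (Z i)| ≤ |a| + n * H := by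
  refine (abs_add_le _ _).trans ?_
  gcongr
  refine (Finset.abs_sum_le_sum_abs _ _).trans ((Finset.sum_le_sum fun i _ => hh _).trans ?_)
  simp

lemma abs_prod_le {w : X → ℝ} {A : ℝ} (hw : ∀ x, |w x| ≤ A) {ι : Type*} (s : Finset ι)
    (Z : ι → X) : |∏ i ∈ s, w (Z i)| ≤ A ^ s.card := by
  rw [Finset.abs_prod]
  exact (Finset.prod_le_prod (fun i _ => abs_nonneg _) fun i _ => hw _).trans (by simp)

variable [MeasurableSpace X] {ν : Measure X} {R : X → X → Prop}

lemma prod_erase_succAbove {n : ℕ} (i : Fin (n + 1)) (f : Fin (n + 1) → ℝ) :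
    ∏ j ∈ Finset.univ.erase i, f j = ∏ j, f (i.succAbove j) := by
  rw [Fin.univ_succAbove n i, Finset.erase_cons, Finset.prod_map]
  rfl

variable (ν R) in
/-- The integral of `(a + ∑ h(z_i)) ∏ w(z_i)` against the hard-core gas. -/
def gasInt (a : ℝ) (h w : X → ℝ) : ℝ :=
  ∫ Z, (a + ∑ i, h (Z.2 i)) * ∏ i, w (Z.2 i) ∂(gas ν R)

lemma measurable_sum_conf {h : X → ℝ} (hh : Measurable h) :
    Measurable fun Z : PointConf X => ∑ i, h (Z.2 i) :=
  measurable_sigma fun N => by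
    have : Measurable fun Z : Fin N → X => ∑ i, h (Z i) :=
      Finset.measurable_sum _ fun i _ => hh.comp (measurable_pi_apply i)
    exact this

lemma measurable_prod_conf {w : X → ℝ} (hw : Measurable w) :
    Measurable fun Z : PointConf X => ∏ i, w (Z.2 i) :=
  measurable_sigma fun N => by
    have : Measurable fun Z : Fin N → X => ∏ i, w (Z i) :=
      Finset.measurable_prod _ fun i _ => hw.comp (measurable_pi_apply i)
    exact this

lemma integrable_gasInt [IsFiniteMeasure ν] {a A H : ℝ} {h w : X → ℝ} (hh : Measurable h)
    (hw : Measurable w) (hhb : ∀ x, |h x| ≤ H) (hwb : ∀ x, |w x| ≤ A) (hA : 0 ≤ A) (hH : 0 ≤ H) :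
    Integrable (fun Z : PointConf X => (a + ∑ i, h (Z.2 i)) * ∏ i, w (Z.2 i)) (gas ν R) := by
  refine integrable_gas (A := 2 * A) (C := |a| + H)
    ((measurable_const.add (measurable_sum_conf hh)).mul (measurable_prod_conf hw))
    (by positivity) fun Z => ?_
  rw [abs_mul, mul_pow, ← mul_assoc]
  refine mul_le_mul ((abs_add_sum_le hhb Z.2).trans ?_)
    ((abs_prod_le hwb _ _).trans (by simp)) (abs_nonneg _) (by positivity)
  have h2 : (Z.1 : ℝ) ≤ 2 ^ Z.1 := by exact_mod_cast (Nat.lt_two_pow_self).le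
  have h1 : (1 : ℝ) ≤ 2 ^ Z.1 := one_le_pow₀ (by norm_num)
  nlinarith [abs_nonneg a]

/-- The derivative of `gasInt` along an affine path of weights. -/
lemma hasDerivAt_gasInt [IsFiniteMeasure ν] (hR : MeasurableSet {p : X × X | R p.1 p.2})
    (hs : ∀ x y, R x y → R y x) {a A H s : ℝ} {h w k : X → ℝ} (hh : Measurable h)
    (hw : Measurable w) (hk : Measurable k) (hhb : ∀ x, |h x| ≤ H) (hwb : ∀ x, |w x + s * k x| ≤ A)
    (hkb : ∀ x, |k x| ≤ A) (hA : 1 ≤ A) (hH : 0 ≤ H) :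
    HasDerivAt (fun u => gasInt ν R a h fun y => w y + u * k y)
      (∫ x, k x * gasInt ν R (a + h x) h (fun y => (w y + s * k y) * free R x y) ∂ν) s := by
  have hA0 : 0 ≤ A := zero_le_one.trans hA
  set F' : ℝ → PointConf X → ℝ := fun u Z => (a + ∑ i, h (Z.2 i)) *
    ∑ i, (∏ j ∈ Finset.univ.erase i, (w (Z.2 j) + u * k (Z.2 j))) * k (Z.2 i) with hF'
  have hF'm : Measurable (F' s) := by
    refine (measurable_const.add (measurable_sum_conf hh)).mul (measurable_sigma fun N => ?_)
    have : Measurable fun Z : Fin N → X =>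
        ∑ i, (∏ j ∈ Finset.univ.erase i, (w (Z j) + s * k (Z j))) * k (Z i) := by
      refine Finset.measurable_sum _ fun i _ => (Finset.measurable_prod _ fun j _ => ?_).mul
        (hk.comp (measurable_pi_apply i))
      exact (hw.comp (measurable_pi_apply j)).add
        (measurable_const.mul (hk.comp (measurable_pi_apply j)))
    exact this
  have hwm : ∀ u, Measurable fun y => w y + u * k y := fun u => hw.add (measurable_const.mul hk)
  have hball : ∀ u ∈ Metric.ball s 1, ∀ x, |w x + u * k x| ≤ 2 * A := fun u hu x => by
    rw [Metric.mem_ball, Real.dist_eq] at hu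
    have e : w x + u * k x = (w x + s * k x) + (u - s) * k x := by ring
    rw [e, two_mul]
    refine (abs_add_le _ _).trans (add_le_add (hwb x) ?_)
    rw [abs_mul]
    exact (mul_le_of_le_one_left (abs_nonneg _) hu.le).trans (hkb x)
  have hbound : ∀ (Z : PointConf X), ∀ u ∈ Metric.ball s 1,
      ‖F' u Z‖ ≤ (|a| + H) * A * (8 * A) ^ Z.1 := fun Z u hu => by
    have h2 : (Z.1 : ℝ) ≤ 2 ^ Z.1 := by exact_mod_cast (Nat.lt_two_pow_self).le
    have h1 : (1 : ℝ) ≤ 2 ^ Z.1 := one_le_pow₀ (by norm_num)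
    have b1 : |a + ∑ i, h (Z.2 i)| ≤ (|a| + H) * 2 ^ Z.1 := by
      refine (abs_add_sum_le hhb Z.2).trans ?_
      nlinarith [abs_nonneg a]
    have b2 : |∑ i, (∏ j ∈ Finset.univ.erase i, (w (Z.2 j) + u * k (Z.2 j))) * k (Z.2 i)| ≤
        2 ^ Z.1 * ((2 * A) ^ Z.1 * A) := by
      refine (Finset.abs_sum_le_sum_abs _ _).trans
        ((Finset.sum_le_sum (g := fun _ => (2 * A) ^ Z.1 * A) fun i _ => ?_).trans ?_)
      · rw [abs_mul]
        refine mul_le_mul ((abs_prod_le (w := fun y => w y + u * k y) (hball u hu) _ Z.2).trans ?_)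
          (hkb _) (abs_nonneg _) (by positivity)
        refine pow_le_pow_right₀ (by linarith) ?_
        exact (Finset.card_le_univ _).trans (by simp)
      · rw [Finset.sum_const, Finset.card_univ, Fintype.card_fin, nsmul_eq_mul]
        gcongr
    rw [Real.norm_eq_abs, hF', abs_mul]
    calc _ ≤ ((|a| + H) * 2 ^ Z.1) * (2 ^ Z.1 * ((2 * A) ^ Z.1 * A)) := by gcongr
      _ = _ := by
        rw [show (8 * A) = 2 * (2 * (2 * A)) by ring, mul_pow 2 (2 * (2 * A)),
          mul_pow 2 (2 * A)]
        ring
  have hdiff : ∀ (Z : PointConf X) (u : ℝ), HasDerivAt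
      (fun u => (a + ∑ i, h (Z.2 i)) * ∏ i, (w (Z.2 i) + u * k (Z.2 i))) (F' u Z) u := fun Z u => by
    refine HasDerivAt.const_mul _ ?_
    have := HasDerivAt.fun_finsetProd (u := Finset.univ)
      (f := fun (i : Fin Z.1) u => w (Z.2 i) + u * k (Z.2 i)) (f' := fun i => k (Z.2 i)) (x := u)
      fun i _ => by simpa using ((hasDerivAt_id u).mul_const (k (Z.2 i))).const_add (w (Z.2 i))
    simpa using this
  set F : ℝ → PointConf X → ℝ := fun u Z =>
    (a + ∑ i, h (Z.2 i)) * ∏ i, (w (Z.2 i) + u * k (Z.2 i)) with hF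
  have hFm : ∀ u, AEStronglyMeasurable (F u) (gas ν R) := fun u =>
    ((measurable_const.add (measurable_sum_conf hh)).mul
      (measurable_prod_conf (hwm u))).aestronglyMeasurable
  have hFi : Integrable (F s) (gas ν R) :=
    integrable_gasInt (a := a) (h := h) (w := fun y => w y + s * k y) hh (hwm s) hhb hwb hA0 hH
  have hbi : Integrable (fun Z : PointConf X => (|a| + H) * A * (8 * A) ^ Z.1) (gas ν R) :=
    integrable_gas (measurable_number fun n => (|a| + H) * A * (8 * A) ^ n)
      (A := 8 * A) (C := (|a| + H) * A) (by positivity)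
      fun Z => (abs_of_nonneg (by positivity)).le
  have hD : HasDerivAt (fun u => ∫ Z, F u Z ∂(gas ν R)) (∫ Z, F' s Z ∂(gas ν R)) s :=
    (hasDerivAt_integral_of_dominated_loc_of_deriv_le (Metric.ball_mem_nhds s one_pos)
      (Eventually.of_forall hFm) hFi hF'm.aestronglyMeasurable
      (ae_of_all _ hbound) hbi (ae_of_all _ fun Z u _ => hdiff Z u)).2
  have hG : ∀ n, Measurable fun p : X × (Fin n → X) =>
      (a + h p.1 + ∑ i, h (p.2 i)) * ((∏ j, (w (p.2 j) + s * k (p.2 j))) * k p.1) := fun n => by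
    refine Measurable.mul ?_ (Measurable.mul (Finset.measurable_prod _ fun j _ => ?_)
      (hk.comp measurable_fst))
    · exact (measurable_const.add (hh.comp measurable_fst)).add
        (Finset.measurable_sum _ fun i _ =>
          hh.comp ((measurable_pi_apply i).comp measurable_snd))
    · exact (hwm s).comp ((measurable_pi_apply j).comp measurable_snd)
  -- The differentiated factor is the marked point x. Removing it shifts a to a + h x and multiplies
  -- the remaining weight by the exclusion `free R x`.
  have hM := integral_gas_eq (ν := ν) hR hs (F := F' s)
    (G := fun n x Z => (a + h x + ∑ i, h (Z i)) * ((∏ j, (w (Z j) + s * k (Z j))) * k x))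
    hF'm hG (fun Z => by simp [hF']) (fun n Z => ?_) (A := 2 * A)
    (C := (|a| + H) * A) (by linarith) (by positivity) fun n x Z => ?_
  · have e : ∫ x, k x * gasInt ν R (a + h x) h (fun y => (w y + s * k y) * free R x y) ∂ν =
        ∫ Z, F' s Z ∂(gas ν R) := by
      rw [hM]
      refine integral_congr_ae (ae_of_all _ fun x => ?_)
      simp only [gasInt]
      rw [← integral_const_mul]
      refine integral_congr_ae (ae_of_all _ fun Z => ?_)
      simp only [Finset.prod_mul_distrib]
      ring
    rw [e]
    exact hD
  · simp only [hF', Finset.mul_sum]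
    refine Finset.sum_congr rfl fun i _ => ?_
    rw [prod_erase_succAbove i fun j => w (Z j) + s * k (Z j),
      Fin.sum_univ_succAbove (fun l => h (Z l)) i, add_assoc]
  · rw [abs_mul, abs_mul, mul_pow]
    have h2 : ((n : ℝ) + 1) ≤ 2 ^ n := by exact_mod_cast Nat.lt_two_pow_self
    have h1 : (1 : ℝ) ≤ 2 ^ n := one_le_pow₀ (by norm_num)
    have b1 : |a + h x + ∑ i, h (Z i)| ≤ (|a| + H) * 2 ^ n := by
      refine (abs_add_sum_le hhb Z).trans ?_
      have := abs_add_le a (h x)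
      have := hhb x
      nlinarith [abs_nonneg a]
    have b2 : |∏ j, (w (Z j) + s * k (Z j))| ≤ A ^ n :=
      (abs_prod_le (w := fun y => w y + s * k y) hwb _ Z).trans (by simp)
    calc _ ≤ ((|a| + H) * 2 ^ n) * (A ^ n * A) := by
          gcongr
          exact hkb x
      _ = _ := by ring

end GasMean

/-! ### Stability of the mean in the weight; the subgaussian bound. -/

section GasMean

variable {X : Type*} [MeasurableSpace X] {ν : Measure X} {R : X → X → Prop}

variable (ν R) in
/-- The mean of `∑ h(z_i)` in the hard-core gas with weight `w`. -/
def gasMean (h w : X → ℝ) : ℝ := gasInt ν R 0 h w / gasInt ν R 1 0 w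

lemma gasInt_eq [IsFiniteMeasure ν] {a A H : ℝ} {h w : X → ℝ} (hh : Measurable h)
    (hw : Measurable w) (hhb : ∀ x, |h x| ≤ H) (hwb : ∀ x, |w x| ≤ A) (hA : 0 ≤ A) (hH : 0 ≤ H) :
    gasInt ν R a h w = a * gasInt ν R 1 0 w + gasInt ν R 0 h w := by
  unfold gasInt
  rw [← integral_const_mul, ← integral_add]
  · refine integral_congr_ae (ae_of_all _ fun Z => ?_)
    simp
    ring
  · exact (integrable_gasInt (a := 1) (h := 0) (w := w) measurable_const hw (H := 0) (by simp) hwb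
      hA le_rfl).const_mul a
  · exact integrable_gasInt (a := 0) (h := h) (w := w) hh hw hhb hwb hA hH

/-- Measurable weights with values in `[0, A]`. -/
structure IsWeight (A : ℝ) (w : X → ℝ) : Prop where
  meas : Measurable w
  nonneg : ∀ x, 0 ≤ w x
  le : ∀ x, w x ≤ A

lemma IsWeight.abs_le {A : ℝ} {w : X → ℝ} (hw : IsWeight A w) (x : X) : |w x| ≤ A := by
  rw [abs_of_nonneg (hw.nonneg x)]; exact hw.le x

lemma IsWeight.mul_free {A : ℝ} {w : X → ℝ} (hw : IsWeight A w)
    (hR : MeasurableSet {p : X × X | R p.1 p.2}) (x : X) :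
    IsWeight A fun y => w y * free R x y where
  meas := hw.meas.mul (measurable_free_right hR x)
  nonneg y := mul_nonneg (hw.nonneg y) (free_nonneg R x y)
  le y := (mul_le_of_le_one_right (hw.nonneg y) (free_le_one R x y)).trans (hw.le y)

lemma IsWeight.segment {A s : ℝ} {w w' : X → ℝ} (hw : IsWeight A w) (hw' : IsWeight A w')
    (h0 : 0 ≤ s) (h1 : s ≤ 1) : IsWeight A fun y => w y + s * (w' y - w y) where
  meas := hw.meas.add (measurable_const.mul (hw'.meas.sub hw.meas))
  nonneg y := by nlinarith [hw.nonneg y, hw'.nonneg y]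
  le y := by nlinarith [hw.le y, hw'.le y]

lemma integrable_prod_conf [IsFiniteMeasure ν] {A : ℝ} {w : X → ℝ} (hw : IsWeight A w)
    (hA : 0 ≤ A) : Integrable (fun Z : PointConf X => ∏ i, w (Z.2 i)) (gas ν R) := by
  simpa using integrable_gasInt (ν := ν) (R := R) (a := 1) (h := 0) (w := w) measurable_const
    hw.meas (H := 0) (by simp) hw.abs_le hA le_rfl

/-- The empty configuration alone contributes 1. -/
lemma one_le_gasInt [IsFiniteMeasure ν] {A : ℝ} {w : X → ℝ} (hw : IsWeight A w) (hA : 0 ≤ A) :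
    1 ≤ gasInt ν R 1 0 w := by
  have h1 := hasSum_integral_gas (ν := ν) (R := R) (measurable_prod_conf hw.meas)
    (integrable_prod_conf hw hA)
  have h2 := le_hasSum h1 0 fun N _ => integral_nonneg fun Z =>
    Finset.prod_nonneg fun i _ => hw.nonneg _
  have h3 : ∫ Z : Fin 0 → X, ∏ i, w (Z i) ∂(gasLevel ν R 0) = 1 := by
    have : hardCore R 0 = Set.univ := Set.eq_univ_of_forall fun Z i => i.elim0
    simp [gasLevel, this, measureReal_def]
  unfold gasInt
  simpa using h3.symm.le.trans h2

lemma gasInt_mono [IsFiniteMeasure ν] {A : ℝ} {w w' : X → ℝ} (hw : IsWeight A w)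
    (hw' : IsWeight A w') (hA : 0 ≤ A) (h : ∀ x, w x ≤ w' x) :
    gasInt ν R 1 0 w ≤ gasInt ν R 1 0 w' := by
  have := integral_mono (integrable_prod_conf (ν := ν) (R := R) hw hA)
    (integrable_prod_conf hw' hA) fun Z =>
      Finset.prod_le_prod (fun i _ => hw.nonneg _) fun i _ => h (Z.2 i)
  unfold gasInt
  simpa using this

/-- An a priori bound of no particular size; it only starts the contraction below and disappears in
the limit. -/
lemma exists_abs_gasMean_le [IsFiniteMeasure ν] {A H : ℝ} {h : X → ℝ}
    (hhb : ∀ x, |h x| ≤ H) (hA : 0 ≤ A) (hH : 0 ≤ H) :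
    ∃ K, 0 ≤ K ∧ ∀ w, IsWeight A w → |gasMean ν R h w| ≤ K := by
  refine ⟨∫ Z : PointConf X, H * (2 * A) ^ Z.1 ∂(gas ν R), integral_nonneg fun Z => by positivity,
    fun w hw => ?_⟩
  have hz := one_le_gasInt (ν := ν) (R := R) hw hA
  rw [gasMean, abs_div, abs_of_pos (a := gasInt ν R 1 0 w) (by linarith)]
  refine (div_le_self (abs_nonneg _) hz).trans ?_
  have hi : Integrable (fun Z : PointConf X => H * (2 * A) ^ Z.1) (gas ν R) :=
    integrable_gas (A := 2 * A) (C := H) (measurable_number fun n => H * (2 * A) ^ n)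
      (by positivity) fun Z => (abs_of_nonneg (by positivity)).le
  rw [← Real.norm_eq_abs, gasInt]
  refine norm_integral_le_of_norm_le hi (ae_of_all _ fun Z => ?_)
  rw [Real.norm_eq_abs, abs_mul, mul_pow, ← mul_assoc]
  refine mul_le_mul ((abs_add_sum_le hhb Z.2).trans ?_)
    ((abs_prod_le hw.abs_le _ _).trans (by simp)) (abs_nonneg _) (by positivity)
  have h2 : (Z.1 : ℝ) ≤ 2 ^ Z.1 := by exact_mod_cast (Nat.lt_two_pow_self).le
  simp only [abs_zero, zero_add]
  nlinarith

/-- A bound on the effect of inserting one point gives a Lipschitz bound on the mean. -/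
lemma abs_gasMean_sub_le_of_insert [IsFiniteMeasure ν]
    (hR : MeasurableSet {p : X × X | R p.1 p.2})
    (hs : ∀ x y, R x y → R y x) {A H D : ℝ} {h : X → ℝ} (hh : Measurable h)
    (hhb : ∀ x, |h x| ≤ H) (hA : 1 ≤ A) (hH : 0 ≤ H)
    (hD : ∀ w, IsWeight A w → ∀ x,
      |gasMean ν R h (fun y => w y * free R x y) - gasMean ν R h w| ≤ D)
    {w w' : X → ℝ} (hw : IsWeight A w) (hw' : IsWeight A w') :
    |gasMean ν R h w' - gasMean ν R h w| ≤ (H + D) * ∫ x, |w' x - w x| ∂ν := by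
  have hA0 : 0 ≤ A := zero_le_one.trans hA
  set k : X → ℝ := fun y => w' y - w y with hk
  have hkm : Measurable k := hw'.meas.sub hw.meas
  have hkb : ∀ x, |k x| ≤ A := fun x => by
    rw [hk, abs_le]
    constructor <;> linarith [hw.nonneg x, hw.le x, hw'.nonneg x, hw'.le x]
  have hki : Integrable k ν :=
    (integrable_const A).mono' hkm.aestronglyMeasurable (ae_of_all _ hkb)
  have hder : ∀ s ∈ Set.Icc (0 : ℝ) 1, ∃ m', |m'| ≤ (H + D) * ∫ x, |k x| ∂ν ∧
      HasDerivAt (fun u => gasMean ν R h fun y => w y + u * k y) m' s := by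
    intro s hs01
    set v : X → ℝ := fun y => w y + s * k y with hv
    have hvw : IsWeight A v := hw.segment hw' hs01.1 hs01.2
    have hvb : ∀ x, |w x + s * k x| ≤ A := hvw.abs_le
    set m := gasMean ν R h v with hm
    have d1 := hasDerivAt_gasInt (ν := ν) (a := 1) (h := 0) hR hs measurable_const hw.meas hkm (H := 0)
      (by simp) hvb hkb hA le_rfl
    have d2 := hasDerivAt_gasInt (ν := ν) (a := 0) (h := h) hR hs hh hw.meas hkm hhb hvb hkb hA hH
    -- Freezing the mean m as the constant -m turns the quotient rule into a single integral: the
    -- derivative of the mean is q / z with q = s' - m z'.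
    have d3 := hasDerivAt_gasInt (ν := ν) (a := -m) (h := h) hR hs hh hw.meas hkm hhb hvb hkb hA hH
    set z' := ∫ x, k x * gasInt ν R (1 + (0 : X → ℝ) x) 0
      (fun y => (w y + s * k y) * free R x y) ∂ν
    set s' := ∫ x, k x * gasInt ν R (0 + h x) h (fun y => (w y + s * k y) * free R x y) ∂ν
    set q := ∫ x, k x * gasInt ν R (-m + h x) h (fun y => (w y + s * k y) * free R x y) ∂ν
    have hz := one_le_gasInt (ν := ν) (R := R) hvw hA0
    set z := gasInt ν R 1 0 v with hzdef
    have hz0 : z ≠ 0 := by positivity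
    have hwu : ∀ u x, |w x + u * k x| ≤ A + |u| * A := fun u x => by
      refine (abs_add_le _ _).trans (add_le_add (hw.abs_le x) ?_)
      rw [abs_mul]
      gcongr
      exact hkb x
    have hq : q = -m * z' + s' := by
      refine d3.unique ?_
      refine ((d1.const_mul (-m)).add d2).congr_of_eventuallyEq (Eventually.of_forall fun u => ?_)
      exact gasInt_eq hh (hw.meas.add (measurable_const.mul hkm)) hhb (hwu u) (by positivity) hH
    have hms : gasInt ν R 0 h v = m * z := by
      rw [hm, gasMean, div_mul_cancel₀ _ hz0]
    refine ⟨q / z, ?_, ?_⟩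
    · rw [abs_div, abs_of_pos (by linarith : 0 < z), div_le_iff₀ (by linarith),
        ← integral_const_mul, ← integral_mul_const, ← Real.norm_eq_abs]
      refine norm_integral_le_of_norm_le ((hki.abs.const_mul _).mul_const _)
        (ae_of_all _ fun x => ?_)
      have hvx := hvw.mul_free hR x
      have hzx := one_le_gasInt (ν := ν) (R := R) hvx hA0
      have hzle : gasInt ν R 1 0 (fun y => v y * free R x y) ≤ z :=
        gasInt_mono hvx hvw hA0 fun y =>
          mul_le_of_le_one_right (hvw.nonneg y) (free_le_one R x y)
      have hDx := hD v hvw x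
      rw [gasInt_eq hh hvx.meas hhb hvx.abs_le hA0 hH]
      set zx := gasInt ν R 1 0 (fun y => v y * free R x y) with hzxdef
      have hsx : gasInt ν R 0 h (fun y => v y * free R x y) =
          gasMean ν R h (fun y => v y * free R x y) * zx := by
        rw [gasMean, div_mul_cancel₀ _ (by positivity)]
      rw [hsx, Real.norm_eq_abs, abs_mul, mul_comm (H + D), mul_assoc]
      refine mul_le_mul_of_nonneg_left ?_ (abs_nonneg _)
      -- The response to adding weight at x is h(x) plus the effect of the exclusion around x, at
      -- most H + D; and zx ≤ z because exclusion lowers the weight.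
      have e : (-m + h x) * zx + gasMean ν R h (fun y => v y * free R x y) * zx =
          (h x + (gasMean ν R h (fun y => v y * free R x y) - m)) * zx := by ring
      rw [e, abs_mul, abs_of_pos (by linarith : 0 < zx)]
      refine mul_le_mul ((abs_add_le _ _).trans (add_le_add (hhb x) hDx)) hzle (by linarith) ?_
      exact add_nonneg hH ((abs_nonneg _).trans hDx)
    · have := d2.div d1 hz0
      convert! this using 1
      rw [← hzdef, hms, hq]
      field_simp
      ring
  choose! m' hm1 hm2 using hder
  have := norm_image_sub_le_of_norm_deriv_le_segment_01'
    (f := fun u => gasMean ν R h fun y => w y + u * k y) (f' := m')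
    (C := (H + D) * ∫ x, |k x| ∂ν)
    (fun s hs => (hm2 s hs).hasDerivWithinAt) fun s hs => hm1 s (Set.Ico_subset_Icc_self hs)
  simpa [hk] using this

/-- At low density, inserting one point changes the mean of `∑ h(z_i)` by at most `sup |h|`. -/
lemma abs_gasMean_insert_le [IsFiniteMeasure ν]
    (hR : MeasurableSet {p : X × X | R p.1 p.2})
    (hs : ∀ x y, R x y → R y x) {A H : ℝ} {h : X → ℝ} (hh : Measurable h)
    (hhb : ∀ x, |h x| ≤ H) (hA : 1 ≤ A) (hH : 0 ≤ H) (hκ : ∀ x, A * ν.real {y | R x y} ≤ 1 / 2)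
    {w : X → ℝ} (hw : IsWeight A w) (x : X) :
    |gasMean ν R h (fun y => w y * free R x y) - gasMean ν R h w| ≤ H := by
  have hA0 : 0 ≤ A := zero_le_one.trans hA
  obtain ⟨K, hK0, hK⟩ := exists_abs_gasMean_le (ν := ν) (R := R) hhb hA0 hH
  -- Insertion is an L¹ change of weight of size at most 1/2, so a bound D improves to (H + D)/2.
  -- The fixed point is H, and the initial excess 2K is halved at each round.
  have key : ∀ n : ℕ, ∀ w, IsWeight A w → ∀ x,
      |gasMean ν R h (fun y => w y * free R x y) - gasMean ν R h w| ≤ H + 2 * K / 2 ^ n := by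
    intro n
    induction n with
    | zero =>
      intro w hw x
      refine (abs_sub _ _).trans ?_
      have := hK _ hw
      have := hK _ (hw.mul_free hR x)
      simp only [pow_zero, div_one]
      linarith
    | succ n ih =>
      intro w hw x
      refine (abs_gasMean_sub_le_of_insert hR hs hh hhb hA hH ih hw (hw.mul_free hR x)).trans ?_
      have h1 : ∫ y, |w y * free R x y - w y| ∂ν ≤ 1 / 2 := by
        refine le_trans ?_ (hκ x)
        have hm : MeasurableSet {y | R x y} := hR.preimage (measurable_const.prodMk measurable_id)
        have e : A * ν.real {y | R x y} = ∫ y, Set.indicator {y | R x y} (fun _ => A) y ∂ν := by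
          rw [integral_indicator_const _ hm, smul_eq_mul, mul_comm]
        rw [e]
        refine integral_mono_of_nonneg (ae_of_all _ fun y => abs_nonneg _)
          ((integrable_const A).indicator hm) (ae_of_all _ fun y => ?_)
        by_cases hy : R x y
        · rw [Set.indicator_of_mem (Set.mem_ofPred_eq ▸ hy)]
          simpa [free, hy] using hw.abs_le y
        · rw [Set.indicator_of_notMem (Set.mem_ofPred_eq ▸ hy)]
          simp [free, hy]
      have h2 : 0 ≤ H + (H + 2 * K / 2 ^ n) := by positivity
      refine (mul_le_mul_of_nonneg_left h1 h2).trans (le_of_eq ?_)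
      rw [pow_succ]
      field_simp
      ring
  have hlim : Tendsto (fun n : ℕ => H + 2 * K / 2 ^ n) atTop (𝓝 (H + 0)) :=
    tendsto_const_nhds.add (tendsto_const_nhds.div_atTop
      (tendsto_pow_atTop_atTop_of_one_lt (by norm_num)))
  rw [add_zero] at hlim
  exact ge_of_tendsto' hlim fun n => key n w hw x

lemma abs_gasMean_sub_le [IsFiniteMeasure ν]
    (hR : MeasurableSet {p : X × X | R p.1 p.2})
    (hs : ∀ x y, R x y → R y x) {A H : ℝ} {h : X → ℝ} (hh : Measurable h)
    (hhb : ∀ x, |h x| ≤ H) (hA : 1 ≤ A) (hH : 0 ≤ H) (hκ : ∀ x, A * ν.real {y | R x y} ≤ 1 / 2)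
    {w w' : X → ℝ} (hw : IsWeight A w) (hw' : IsWeight A w') :
    |gasMean ν R h w' - gasMean ν R h w| ≤ 2 * H * ∫ x, |w' x - w x| ∂ν := by
  rw [two_mul]
  exact abs_gasMean_sub_le_of_insert hR hs hh hhb hA hH
    (fun w hw x => abs_gasMean_insert_le hR hs hh hhb hA hH hκ hw x) hw hw'

lemma integrable_exp_sum [IsFiniteMeasure ν] {H : ℝ} {h : X → ℝ} (hh : Measurable h)
    (hhb : ∀ x, |h x| ≤ H) (u : ℝ) :
    Integrable (fun Z : PointConf X => Real.exp (u * ∑ i, h (Z.2 i))) (gas ν R) := by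
  refine integrable_gas ((measurable_const.mul (measurable_sum_conf hh)).exp)
    (A := Real.exp (|u| * H)) (C := 1) (Real.exp_pos _).le fun Z => ?_
  rw [abs_of_pos (Real.exp_pos _), one_mul, ← Real.exp_nat_mul]
  refine Real.exp_le_exp.2 ?_
  refine (le_abs_self _).trans ?_
  rw [abs_mul, mul_left_comm]
  gcongr
  simpa using abs_add_sum_le (a := 0) hhb Z.2

/-- Subgaussian bound for the linear statistics of a low density hard-core gas. -/
theorem integral_exp_gas_le [IsFiniteMeasure ν]
    (hR : MeasurableSet {p : X × X | R p.1 p.2})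
    (hs : ∀ x y, R x y → R y x) {H : ℝ} {h : X → ℝ} (hh : Measurable h)
    (hhb : ∀ x, |h x| ≤ H) (hH : 0 ≤ H) (hκ : ∀ x, 3 * ν.real {y | R x y} ≤ 1 / 2)
    {m : ℝ} (hm : m * (gas ν R).real Set.univ = ∫ Z, ∑ i, h (Z.2 i) ∂(gas ν R))
    {u : ℝ} (hu : |u| * H ≤ 1) :
    ∫ Z, Real.exp (u * ((∑ i, h (Z.2 i)) - m)) ∂(gas ν R) ≤
      (gas ν R).real Set.univ * Real.exp (4 * H ^ 2 * u ^ 2 * ν.real Set.univ) := by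
  set S : PointConf X → ℝ := fun Z => ∑ i, h (Z.2 i) with hS
  have hint : ∀ v, v ∈ interior (ProbabilityTheory.integrableExpSet S (gas ν R)) := fun v => by
    have : ProbabilityTheory.integrableExpSet S (gas ν R) = Set.univ :=
      Set.eq_univ_of_forall fun v => integrable_exp_sum hh hhb v
    rw [this, interior_univ]
    trivial
  -- The condition |u| H ≤ 1 keeps the tilted weights below e < 3, whence the 3 in the low density
  -- hypothesis.
  have hexp : ∀ v : ℝ, |v| ≤ |u| → IsWeight 3 fun x => Real.exp (v * h x) := fun v hv =>
    ⟨(measurable_const.mul hh).exp, fun x => (Real.exp_pos _).le, fun x => by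
      have h1 : v * h x ≤ 1 := by
        refine (le_abs_self _).trans ?_
        rw [abs_mul]
        exact (mul_le_mul hv (hhb x) (abs_nonneg _) (abs_nonneg _)).trans hu
      exact (Real.exp_le_exp.2 h1).trans Real.exp_one_lt_three.le⟩
  have hmgf : ∀ v, ProbabilityTheory.mgf S (gas ν R) v =
      gasInt ν R 1 0 fun x => Real.exp (v * h x) := fun v => by
    simp only [ProbabilityTheory.mgf, gasInt, hS, Finset.mul_sum, Real.exp_sum]
    simp
  -- The derivative of the cumulant generating function is the mean in the tilted gas, so stability
  -- of the mean bounds its increments.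
  have hder : ∀ v, deriv (ProbabilityTheory.cgf S (gas ν R)) v =
      gasMean ν R h fun x => Real.exp (v * h x) := fun v => by
    rw [ProbabilityTheory.deriv_cgf (hint v), hmgf, gasMean]
    congr 1
    simp only [gasInt, hS, Finset.mul_sum, Real.exp_sum, zero_add]
  have h1w : IsWeight (X := X) 3 fun x => Real.exp (0 * h x) := hexp 0 (by simp)
  have hz : gasInt ν R 1 0 (fun x => Real.exp (0 * h x)) = (gas ν R).real Set.univ := by
    simp [gasInt]
  have hpos : 0 < (gas ν R).real Set.univ := by
    rw [← hz]; exact one_pos.trans_le (one_le_gasInt h1w (by norm_num))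
  have hm0 : gasMean ν R h (fun x => Real.exp (0 * h x)) = m := by
    rw [gasMean, hz, div_eq_iff hpos.ne', hm]
    simp [gasInt, hS]
  -- The constant 4 is 2H from the Lipschitz bound times |exp(vh) - 1| ≤ 2|u|H.
  have hbound : ∀ v : ℝ, |v| ≤ |u| →
      |deriv (ProbabilityTheory.cgf S (gas ν R)) v - m| ≤ 4 * H ^ 2 * |u| * ν.real Set.univ := by
    intro v hv
    rw [hder, ← hm0]
    refine (abs_gasMean_sub_le hR hs hh hhb (by norm_num) hH hκ h1w (hexp v hv)).trans ?_
    have : ∫ x, |Real.exp (v * h x) - Real.exp (0 * h x)| ∂ν ≤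
        ∫ _, 2 * (|u| * H) ∂ν := by
      refine integral_mono_of_nonneg (ae_of_all _ fun y => abs_nonneg _) (integrable_const _)
        (ae_of_all _ fun x => ?_)
      have h2 : |v * h x| ≤ |u| * H := by
        rw [abs_mul]; exact mul_le_mul hv (hhb x) (abs_nonneg _) (abs_nonneg _)
      simp only [zero_mul, Real.exp_zero]
      exact (Real.abs_exp_sub_one_le (h2.trans hu)).trans (by linarith)
    rw [integral_const, smul_eq_mul] at this
    calc _ ≤ 2 * H * (ν.real Set.univ * (2 * (|u| * H))) := by gcongr
      _ = _ := by ring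
  have hdiff : ∀ v, DifferentiableAt ℝ (fun v => ProbabilityTheory.cgf S (gas ν R) v - v * m) v :=
    fun v => ((ProbabilityTheory.analyticAt_cgf (hint v)).differentiableAt).sub
      ((differentiableAt_id).mul_const m)
  have hmv := (convex_Icc (-|u|) |u|).norm_image_sub_le_of_norm_deriv_le
    (f := fun v => ProbabilityTheory.cgf S (gas ν R) v - v * m)
    (C := 4 * H ^ 2 * |u| * ν.real Set.univ) (x := 0) (y := u)
    (fun v _ => hdiff v) (fun v hv => by
      have : deriv (fun v => ProbabilityTheory.cgf S (gas ν R) v - v * m) v =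
          deriv (ProbabilityTheory.cgf S (gas ν R)) v - m := by
        have h1 := ((ProbabilityTheory.analyticAt_cgf (hint v)).differentiableAt).hasDerivAt.sub
          ((hasDerivAt_id v).mul_const m)
        rw [one_mul] at h1
        exact h1.deriv
      rw [this]
      exact hbound v (abs_le.2 hv))
    (by simp) (abs_le.1 le_rfl)
  have hfin := (le_abs_self _).trans hmv
  have hc0 : ProbabilityTheory.cgf S (gas ν R) 0 = Real.log ((gas ν R).real Set.univ) := by
    rw [ProbabilityTheory.cgf, hmgf, hz]
  have hmp : 0 < ProbabilityTheory.mgf S (gas ν R) u := by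
    rw [hmgf]; exact one_pos.trans_le (one_le_gasInt (hexp u le_rfl) (by norm_num))
  have e1 : ∫ Z, Real.exp (u * (S Z - m)) ∂(gas ν R) =
      Real.exp (ProbabilityTheory.cgf S (gas ν R) u - u * m) := by
    rw [Real.exp_sub, ProbabilityTheory.cgf, Real.exp_log hmp, ProbabilityTheory.mgf,
      ← integral_div]
    refine integral_congr_ae (ae_of_all _ fun Z => ?_)
    simp only [mul_sub, Real.exp_sub]
  rw [e1]
  simp only [hc0, zero_mul, sub_zero, Real.norm_eq_abs] at hfin
  have e2 : 4 * H ^ 2 * |u| * ν.real Set.univ * |u| = 4 * H ^ 2 * u ^ 2 * ν.real Set.univ := by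
    rw [← sq_abs u]; ring
  rw [e2] at hfin
  calc _ ≤ Real.exp (Real.log ((gas ν R).real Set.univ) +
        4 * H ^ 2 * u ^ 2 * ν.real Set.univ) := Real.exp_le_exp.2 (by linarith)
    _ = _ := by rw [Real.exp_add, Real.exp_log hpos]

end GasMean

/-! ### Densities of product measures. -/

section ProductDensity

lemma pi_smul_measure {X : Type*} [MeasurableSpace X] (m : Measure X) [IsFiniteMeasure m] {c : ENNReal} (hc : c ≠ ⊤) (N : ℕ) :
    Measure.pi (fun _ : Fin N => c • m) = c ^ N • Measure.pi fun _ => m := by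
  have : IsFiniteMeasure (c • m) := Measure.smul_finite m hc
  refine Measure.pi_eq fun s _ => ?_
  simp [Measure.pi_pi, Finset.prod_mul_distrib]

variable {X : Type*} [MeasureSpace X] [SigmaFinite (volume : Measure X)]

lemma pi_withDensity_ofReal {g : X → ℝ} (hg : Integrable g) (hg0 : ∀ x, 0 ≤ g x) (N : ℕ) :
    Measure.pi (fun _ : Fin N => (volume : Measure X).withDensity fun x => ENNReal.ofReal (g x)) =
      (volume : Measure (Fin N → X)).withDensity fun Z => ENNReal.ofReal (∏ i, g (Z i)) := by
  have : IsFiniteMeasure ((volume : Measure X).withDensity fun x => ENNReal.ofReal (g x)) :=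
    isFiniteMeasure_withDensity_ofReal hg.2
  refine Measure.pi_eq fun s hs => ?_
  rw [withDensity_apply _ (MeasurableSet.univ_pi hs), volume_pi, Measure.restrict_pi_pi]
  have hgs : ∀ i, Integrable g (volume.restrict (s i)) := fun i => hg.restrict
  rw [← ofReal_integral_eq_lintegral_ofReal
    (Integrable.fintype_prod_dep (f := fun _ => g) fun i => hgs i)
    (ae_of_all _ fun Z => Finset.prod_nonneg fun i _ => hg0 _),
    integral_fintype_prod_eq_prod (fun _ => g),
    ENNReal.ofReal_prod_of_nonneg fun i _ => integral_nonneg hg0]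
  refine Finset.prod_congr rfl fun i _ => ?_
  rw [withDensity_apply _ (hs i), ofReal_integral_eq_lintegral_ofReal (hgs i) (ae_of_all _ hg0)]

end ProductDensity

/-! ### The equilibrium measure as a hard-core gas, and its invariance. -/

section Equilibrium

variable {d N : ℕ} {ε : ℝ}

lemma maxwellian_nonneg (v : EuclideanSpace ℝ (Fin d)) : 0 ≤ maxwellian v := by
  unfold maxwellian; positivity

lemma measurable_maxwellian :
    Measurable (maxwellian : EuclideanSpace ℝ (Fin d) → ℝ) := by
  unfold maxwellian; fun_prop

lemma integral_exp_norm_sq {b : ℝ} (hb : 0 < b) :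
    ∫ v : EuclideanSpace ℝ (Fin d), Real.exp (-b * ‖v‖ ^ 2) = (Real.pi / b) ^ ((d : ℝ) / 2) := by
  simpa using GaussianFourier.integral_rexp_neg_mul_sq_norm (V := EuclideanSpace ℝ (Fin d)) hb

/-- A non-integrable function would have integral 0 by convention, whereas the Gaussian formula
gives a positive value. -/
lemma integrable_exp_norm_sq {b : ℝ} (hb : 0 < b) :
    Integrable fun v : EuclideanSpace ℝ (Fin d) => Real.exp (-b * ‖v‖ ^ 2) := by
  by_contra h
  have h1 := integral_undef h
  rw [integral_exp_norm_sq hb] at h1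
  have : 0 < (Real.pi / b) ^ ((d : ℝ) / 2) := by positivity
  exact this.ne' h1

lemma maxwellian_eq (v : EuclideanSpace ℝ (Fin d)) :
    maxwellian v = 1 / (2 * Real.pi) ^ ((d : ℝ) / 2) * Real.exp (-(1 / 2) * ‖v‖ ^ 2) := by
  unfold maxwellian
  ring_nf

lemma integrable_maxwellian :
    Integrable (maxwellian : EuclideanSpace ℝ (Fin d) → ℝ) := by
  rw [show (maxwellian : EuclideanSpace ℝ (Fin d) → ℝ) = _ from funext maxwellian_eq]
  exact (integrable_exp_norm_sq (by norm_num)).const_mul _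

lemma integral_maxwellian : ∫ v : EuclideanSpace ℝ (Fin d), maxwellian v = 1 := by
  rw [show (maxwellian : EuclideanSpace ℝ (Fin d) → ℝ) = _ from funext maxwellian_eq,
    integral_const_mul, integral_exp_norm_sq (by norm_num)]
  have : Real.pi / (1 / 2) = 2 * Real.pi := by ring
  rw [this, one_div, inv_mul_cancel₀]
  positivity

/-- The Maxwellian probability measure. -/
def maxwellMeasure (d : ℕ) : Measure (EuclideanSpace ℝ (Fin d)) :=
  volume.withDensity fun v => ENNReal.ofReal (maxwellian v)

instance : IsProbabilityMeasure (maxwellMeasure d) := by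
  constructor
  rw [maxwellMeasure, withDensity_apply _ MeasurableSet.univ, Measure.restrict_univ,
    ← ofReal_integral_eq_lintegral_ofReal integrable_maxwellian (ae_of_all _ maxwellian_nonneg),
    integral_maxwellian, ENNReal.ofReal_one]

/-- The intensity of the particles of the ideal gas. -/
def intensity (d : ℕ) (ε : ℝ) : Measure (Particle d) :=
  ENNReal.ofReal (mu d ε) • (volume : Measure (UnitAddTorus (Fin d))).prod (maxwellMeasure d)

/-- Two particles overlap. -/
def Overlap (d : ℕ) (ε : ℝ) (z z' : Particle d) : Prop := torusDist z.1 z'.1 ≤ ε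

lemma Overlap.symm (z z' : Particle d) (h : Overlap d ε z z') : Overlap d ε z' z := by
  unfold Overlap at *; rwa [torusDist_comm]

lemma measurableSet_overlap (ε : ℝ) :
    MeasurableSet {p : Particle d × Particle d | Overlap d ε p.1 p.2} := by
  unfold Overlap
  refine measurableSet_le ?_ measurable_const
  exact (continuous_torusDist_comp (continuous_fst.comp continuous_fst)
    (continuous_fst.comp continuous_snd)).measurable

instance : IsFiniteMeasure (intensity d ε) := Measure.smul_finite _ ENNReal.ofReal_ne_top

lemma intensity_univ : intensity d ε Set.univ = ENNReal.ofReal (mu d ε) := by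
  simp [intensity]

lemma mu_pos (hε : 0 < ε) : 0 < mu d ε := by unfold mu; positivity

lemma intensity_real_univ (hε : 0 < ε) : (intensity d ε).real Set.univ = mu d ε := by
  rw [measureReal_def, intensity_univ, ENNReal.toReal_ofReal (mu_pos hε).le]

lemma volume_torusDist_le (x : UnitAddTorus (Fin d)) (ρ : ℝ) :
    volume {y : UnitAddTorus (Fin d) | torusDist x y ≤ ρ} ≤ ENNReal.ofReal (2 * ρ) ^ d := by
  refine le_trans (le_of_eq ?_) (volume_norm_sec_le (d := d) ρ)
  have hm : MeasurableSet {y : UnitAddTorus (Fin d) | ‖sec y‖ ≤ ρ} :=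
    measurableSet_le measurable_sec.norm measurable_const
  rw [← (measurePreserving_add_right (volume : Measure (UnitAddTorus (Fin d))) (-x)).measure_preimage
    hm.nullMeasurableSet]
  congr 1
  ext y
  change torusDist x y ≤ ρ ↔ ‖sec (y + -x)‖ ≤ ρ
  rw [torusDist_comm, torusDist_eq, sub_eq_add_neg]

lemma intensity_ball_le (x : UnitAddTorus (Fin d)) (ρ : ℝ) :
    intensity d ε {z | torusDist x z.1 ≤ ρ} ≤
      ENNReal.ofReal (mu d ε) * ENNReal.ofReal (2 * ρ) ^ d := by
  have : {z : Particle d | torusDist x z.1 ≤ ρ} = {y | torusDist x y ≤ ρ} ×ˢ Set.univ := by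
    ext z; simp
  rw [intensity, Measure.smul_apply, smul_eq_mul, this, Measure.prod_prod, measure_univ, mul_one]
  gcongr
  exact volume_torusDist_le x ρ

/-- The factor μ_ε^N and the Maxwellians are absorbed into the one-particle intensity. -/
lemma weight_eq_gasLevel (hε : 0 < ε) (N : ℕ) :
    weight d ε N = gasLevel (intensity d ε) (Overlap d ε) N := by
  have h1 : (volume : Measure (UnitAddTorus (Fin d))).prod (maxwellMeasure d) =
      (volume : Measure (Particle d)).withDensity fun z => ENNReal.ofReal (maxwellian z.2) := by
    rw [maxwellMeasure, prod_withDensity_right measurable_maxwellian.ennreal_ofReal]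
    rfl
  have hi : Integrable fun z : Particle d => maxwellian z.2 :=
    (integrable_maxwellian (d := d)).comp_snd _
  have h2 : hardCore (Overlap d ε) N = admissible d ε N := by
    ext Z; simp [hardCore, admissible, Overlap]
  have : IsFiniteMeasure ((volume : Measure (Particle d)).withDensity
      fun z => ENNReal.ofReal (maxwellian z.2)) := h1 ▸ inferInstance
  rw [gasLevel, intensity, h1, pi_smul_measure _ ENNReal.ofReal_ne_top,
    pi_withDensity_ofReal hi
      (fun z => maxwellian_nonneg _), Measure.restrict_smul, h2,
    restrict_withDensity (measurableSet_admissible d ε N), smul_smul, weight]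
  congr 1
  rw [ENNReal.ofReal_div_of_pos (by positivity), ENNReal.ofReal_natCast, div_eq_mul_inv, mul_comm,
    ENNReal.ofReal_pow (mu_pos hε).le]

lemma partitionFunction_eq (hε : 0 < ε) :
    partitionFunction d ε = gas (intensity d ε) (Overlap d ε) Set.univ := by
  rw [partitionFunction, gas, Measure.sum_apply _ MeasurableSet.univ]
  refine tsum_congr fun N => ?_
  rw [Measure.map_apply (measurable_sigma_mk N) MeasurableSet.univ, Set.preimage_univ,
    weight_eq_gasLevel hε]

lemma eqMeasure_eq (hε : 0 < ε) : eqMeasure d ε =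
    (gas (intensity d ε) (Overlap d ε) Set.univ)⁻¹ • gas (intensity d ε) (Overlap d ε) := by
  rw [eqMeasure, partitionFunction_eq hε]
  simp only [weight_eq_gasLevel hε]
  rfl

lemma gas_univ_pos (d : ℕ) (ε : ℝ) :
    0 < (gas (intensity d ε) (Overlap d ε)).real Set.univ := by
  have h := one_le_gasInt (ν := intensity d ε) (R := Overlap d ε) (A := 1) (w := fun _ => 1)
    ⟨measurable_const, by simp, by simp⟩ zero_le_one
  have h2 : gasInt (intensity d ε) (Overlap d ε) 1 0 (fun _ => 1) =
      (gas (intensity d ε) (Overlap d ε)).real Set.univ := by simp [gasInt]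
  linarith

lemma gas_univ_ne_zero (d : ℕ) (ε : ℝ) : gas (intensity d ε) (Overlap d ε) Set.univ ≠ 0 := fun h => by
  have := gas_univ_pos d ε
  rw [measureReal_def, h] at this
  simp at this

lemma isProbabilityMeasure_eqMeasure (hε : 0 < ε) : IsProbabilityMeasure (eqMeasure d ε) := by
  constructor
  rw [eqMeasure_eq hε, Measure.smul_apply, smul_eq_mul,
    ENNReal.inv_mul_cancel (gas_univ_ne_zero d ε) (measure_ne_top _ _)]

lemma measurableEmbedding_sigma_mk {X : Type*} [MeasurableSpace X] (N : ℕ) :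
    MeasurableEmbedding (fun Z : Fin N → X => (⟨N, Z⟩ : PointConf X)) where
  injective := fun Y Z h => by simpa using h
  measurable := measurable_sigma_mk N
  measurableSet_image' := fun {s} hs => by
    rw [Sigma.instMeasurableSpace, MeasurableSpace.measurableSet_iInf]
    intro M
    change MeasurableSet ((fun Z : Fin M → X => (⟨M, Z⟩ : PointConf X)) ⁻¹' _)
    by_cases h : M = N
    · subst h
      rwa [Set.preimage_image_eq _ fun Y Z h => by simpa using h]
    · convert MeasurableSet.empty
      ext Z
      simp only [Set.mem_preimage, Set.mem_image, Set.mem_empty_iff_false, iff_false]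
      rintro ⟨Y, _, hY⟩
      exact h (congrArg Sigma.fst hY).symm

/-- The hard-sphere flow on the grand canonical phase space. -/
def phaseFlow (ε t : ℝ) (Z : Phase d) : Phase d := ⟨Z.1, flow ε Z.2 t⟩

/-- The equilibrium measure is invariant under the hard-sphere flow. -/
theorem phaseFlow_eqMeasure (hd : 1 ≤ d) (hε : 0 < ε) (hε' : ε < 1 / 2) {t : ℝ} (ht : 0 ≤ t) :
    AEMeasurable (phaseFlow ε t) (eqMeasure d ε) ∧
      (eqMeasure d ε).map (phaseFlow ε t) = eqMeasure d ε := by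
  have hw := fun N => measurePreserving_flow_weight (d := d) (N := N) hd hε hε' ht
  have hN : ∀ N, AEMeasurable (phaseFlow (d := d) ε t) ((weight d ε N).map (Sigma.mk N)) :=
    fun N => by
      refine (measurableEmbedding_sigma_mk N).aemeasurable_map_iff.2 ?_
      exact (measurable_sigma_mk N).comp_aemeasurable (hw N).1
  have hsum : AEMeasurable (phaseFlow (d := d) ε t)
      (Measure.sum fun N => (weight d ε N).map (Sigma.mk N)) :=
    aemeasurable_sum_measure_iff.2 hN
  refine ⟨hsum.smul_measure _, ?_⟩
  rw [eqMeasure, Measure.map_smul, Measure.map_sum hsum]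
  congr 2
  funext N
  rw [AEMeasurable.map_map_of_aemeasurable (hN N) (measurable_sigma_mk N).aemeasurable]
  conv_rhs => rw [← (hw N).2]
  rw [AEMeasurable.map_map_of_aemeasurable (measurable_sigma_mk N).aemeasurable (hw N).1]
  rfl

/-- Allows h, given only up to null sets, to be replaced by a bounded measurable version at every
particle. -/
lemma ae_eqMeasure_of_ae {p : Particle d → Prop} (hp : ∀ᵐ z, p z) :
    ∀ᵐ Z ∂(eqMeasure d ε), ∀ i, p (Z.2 i) := by
  refine Measure.ae_smul_measure ?_ _
  rw [Measure.ae_sum_iff]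
  intro N
  rw [(measurableEmbedding_sigma_mk N).ae_map_iff]
  have h1 : ∀ᵐ Z : Config d N, ∀ i, p (Z i) := by
    rw [volume_pi]
    exact eventually_all.2 fun i => Measure.tendsto_eval_ae_ae.eventually hp
  refine Measure.ae_smul_measure ?_ _
  exact (withDensity_absolutelyContinuous _ _).ae_le (ae_restrict_of_ae h1)

end Equilibrium

/-! ### Exponential moments of the equilibrium field. -/

section Moments

variable {d : ℕ} {ε : ℝ}

/-- The linear statistic `∑ h(z_i)`. -/
def linStat {X : Type*} (h : X → ℝ) (Z : PointConf X) : ℝ := ∑ i, h (Z.2 i)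

/-- Low density in the Boltzmann–Grad scaling: μ_ε (2ε)^d = 2^d ε. -/
lemma intensity_overlap_le (hd : 1 ≤ d) (hε : 0 < ε) (z : Particle d) :
    (intensity d ε).real {z' | Overlap d ε z z'} ≤ 2 ^ d * ε := by
  have h := intensity_ball_le (ε := ε) z.1 ε
  rw [measureReal_def]
  refine ENNReal.toReal_le_of_le_ofReal (by positivity) (h.trans (le_of_eq ?_))
  rw [← ENNReal.ofReal_pow (by positivity), ← ENNReal.ofReal_mul (mu_pos hε).le]
  congr 1
  obtain ⟨n, rfl⟩ : ∃ n, d = n + 1 := ⟨d - 1, by omega⟩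
  rw [mu, mul_pow, Nat.add_sub_cancel, pow_succ ε]
  field_simp

lemma integral_eqMeasure (hε : 0 < ε) (f : Phase d → ℝ) : ∫ Z, f Z ∂(eqMeasure d ε) =
    ((gas (intensity d ε) (Overlap d ε)).real Set.univ)⁻¹ *
      ∫ Z, f Z ∂(gas (intensity d ε) (Overlap d ε)) := by
  rw [eqMeasure_eq hε, integral_smul_measure, ENNReal.toReal_inv]
  rfl

lemma integrable_eqMeasure (hε : 0 < ε) {f : Phase d → ℝ}
    (hf : Integrable f (gas (intensity d ε) (Overlap d ε))) : Integrable f (eqMeasure d ε) := by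
  rw [eqMeasure_eq hε]
  exact hf.smul_measure (ENNReal.inv_ne_top.2 (gas_univ_ne_zero d ε))

lemma integrable_linStat {X : Type*} [MeasurableSpace X] {ν : Measure X} [IsFiniteMeasure ν]
    {R : X → X → Prop} {h : X → ℝ} {H : ℝ} (hh : Measurable h) (hhb : ∀ z, |h z| ≤ H)
    (hH : 0 ≤ H) : Integrable (linStat h) (gas ν R) := by
  have := integrable_gasInt (ν := ν) (R := R) (a := 0) (h := h) (w := fun _ => 1) hh
    measurable_const hhb (A := 1) (by simp) zero_le_one hH
  simp only [zero_add, Finset.prod_const_one, mul_one] at this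
  exact this

/-- By Mecke's formula the one-point density is at most that of the ideal gas, since the exclusion
factor is at most 1. -/
lemma abs_integral_linStat_le {X : Type*} [MeasurableSpace X] {ν : Measure X} [IsFiniteMeasure ν]
    {R : X → X → Prop} (hR : MeasurableSet {p : X × X | R p.1 p.2})
    (hs : ∀ x y, R x y → R y x) {h : X → ℝ} {H : ℝ} (hh : Measurable h) (hhb : ∀ z, |h z| ≤ H)
    (hH : 0 ≤ H) : |∫ Z, linStat h Z ∂(gas ν R)| ≤
      H * (gas ν R).real Set.univ * ν.real Set.univ := by
  rw [integral_gas_eq hR hs (F := linStat h) (G := fun n x Z => h x) (measurable_sum_conf hh)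
    (fun n => hh.comp measurable_fst) (fun Z => by simp [linStat]) (fun n Z => rfl) le_rfl hH
    (fun n x Z => by simpa using hhb x), ← Real.norm_eq_abs]
  refine norm_integral_le_of_norm_le_const (ae_of_all _ fun x => ?_)
  refine norm_integral_le_of_norm_le_const (ae_of_all _ fun Z => ?_)
  rw [Real.norm_eq_abs, abs_mul]
  refine (mul_le_of_le_one_right (abs_nonneg _) ?_).trans (hhb x)
  rw [abs_of_nonneg (Finset.prod_nonneg fun i _ => free_nonneg R x _)]
  exact Finset.prod_le_one (fun i _ => free_nonneg R x _) fun i _ => free_le_one R x _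

/-- Exponential moments of the static fluctuations. -/
lemma exp_static (hd : 1 ≤ d) (hε : 0 < ε) (hκ : 6 * 2 ^ d * ε ≤ 1) {h : Particle d → ℝ} {H : ℝ}
    (hh : Measurable h) (hhb : ∀ z, |h z| ≤ H) (hH : 0 < H) {Y : Phase d → ℝ}
    (hY : ∀ Z, Y Z = Real.sqrt (mu d ε) * (1 / mu d ε * linStat h Z -
      1 / mu d ε * ∫ Z, linStat h Z ∂(eqMeasure d ε))) :
    Integrable (fun Z => Real.exp (|Y Z| / H)) (eqMeasure d ε) ∧
      ∫ Z, Real.exp (|Y Z| / H) ∂(eqMeasure d ε) ≤ 2 * Real.exp 4 := by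
  have := isProbabilityMeasure_eqMeasure (d := d) hε
  have hε1 : ε ≤ 1 := by
    have : (1 : ℝ) ≤ 2 ^ d := one_le_pow₀ (by norm_num)
    nlinarith
  have hmu1 : 1 ≤ mu d ε := by
    unfold mu
    exact (one_le_inv₀ (by positivity)).2 (pow_le_one₀ hε.le hε1)
  have hmu0 := mu_pos (d := d) hε
  set s := Real.sqrt (mu d ε) with hs
  have hs1 : 1 ≤ s := by rw [hs]; exact Real.one_le_sqrt.2 hmu1
  have hss : s * s = mu d ε := Real.mul_self_sqrt hmu0.le
  set m := ∫ Z, linStat h Z ∂(eqMeasure d ε) with hm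
  have hYe : ∀ Z, Y Z / H = 1 / (H * s) * (linStat h Z - m) := fun Z => by
    rw [hY, ← hss]
    field_simp
  have hLm : Measurable (linStat h : Phase d → ℝ) := measurable_sum_conf hh
  -- This choice of u turns the subgaussian exponent 4H²u²μ_ε into 4, whatever the dimension.
  have hexp : ∀ u : ℝ, |u| = 1 / (H * s) →
      Integrable (fun Z => Real.exp (u * (linStat h Z - m))) (eqMeasure d ε) ∧
      ∫ Z, Real.exp (u * (linStat h Z - m)) ∂(eqMeasure d ε) ≤ Real.exp 4 := by
    intro u hu
    constructor
    · refine integrable_eqMeasure hε ?_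
      have e : (fun Z : Phase d => Real.exp (u * (linStat h Z - m))) =
          fun Z => Real.exp (u * ∑ i, h (Z.2 i)) * Real.exp (-(u * m)) := by
        funext Z
        rw [← Real.exp_add, linStat]
        ring_nf
      rw [e]
      exact (integrable_exp_sum hh hhb u).mul_const _
    · rw [integral_eqMeasure hε, inv_mul_le_iff₀ (gas_univ_pos d ε)]
      have hu1 : |u| * H ≤ 1 := by
        rw [hu]
        field_simp
        exact hs1
      refine (integral_exp_gas_le (measurableSet_overlap ε) Overlap.symm hh hhb hH.le
        (fun z => ?_) ?_ hu1).trans (le_of_eq ?_)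
      · have := intensity_overlap_le hd hε z
        linarith
      · rw [hm, integral_eqMeasure hε]
        have := (gas_univ_pos d ε).ne'
        simp only [linStat]
        field_simp
      · rw [intensity_real_univ hε, ← sq_abs u, hu, ← hss]
        congr 2
        field_simp
  obtain ⟨i1, b1⟩ := hexp (1 / (H * s)) (abs_of_pos (by positivity))
  obtain ⟨i2, b2⟩ := hexp (-(1 / (H * s))) (by rw [abs_neg, abs_of_pos (by positivity)])
  have hle : ∀ Z, Real.exp (|Y Z| / H) ≤ Real.exp (1 / (H * s) * (linStat h Z - m)) +
      Real.exp (-(1 / (H * s)) * (linStat h Z - m)) := fun Z => by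
    have e : |Y Z| / H = |1 / (H * s) * (linStat h Z - m)| := by
      rw [← hYe, abs_div, abs_of_pos hH]
    rw [e, neg_mul]
    rcases abs_cases (1 / (H * s) * (linStat h Z - m)) with ⟨h1, _⟩ | ⟨h1, _⟩ <;> rw [h1]
    · exact le_add_of_nonneg_right (Real.exp_pos _).le
    · exact le_add_of_nonneg_left (Real.exp_pos _).le
  have hYm : Measurable Y := by
    rw [show Y = _ from funext hY]
    exact ((hLm.const_mul _).sub_const _).const_mul _
  have hint : Integrable (fun Z => Real.exp (|Y Z| / H)) (eqMeasure d ε) :=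
    (i1.add i2).mono' ((hYm.abs.div_const H).exp).aestronglyMeasurable
      (ae_of_all _ fun Z => by rw [Real.norm_of_nonneg (Real.exp_pos _).le]; exact hle Z)
  refine ⟨hint, (integral_mono hint (i1.add i2) hle).trans ?_⟩
  simp only [Pi.add_apply]
  rw [integral_add i1 i2]
  linarith

lemma exists_bounded_modification {α : Type*} [MeasurableSpace α] {m : Measure α} {h : α → ℝ}
    (hh : MemLp h ⊤ m) : ∃ h' : α → ℝ, Measurable h' ∧
      (∀ z, |h' z| ≤ (eLpNorm h ⊤ m).toReal) ∧ h =ᵐ[m] h' := by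
  set S := (eLpNorm h ⊤ m).toReal with hS
  have hS0 : 0 ≤ S := ENNReal.toReal_nonneg
  have hmk := hh.1.aemeasurable
  refine ⟨fun z => max (-S) (min S (hmk.mk h z)),
    measurable_const.max (measurable_const.min hmk.measurable_mk), fun z => ?_, ?_⟩
  · rw [abs_le]
    exact ⟨le_max_left _ _, max_le (by linarith) (min_le_left _ _)⟩
  · filter_upwards [hmk.ae_eq_mk, ae_le_eLpNormEssSup (f := h) (μ := m)] with z h1 h2
    have h3 : |h z| ≤ S := by
      rw [hS, eLpNorm_exponent_top]
      have := ENNReal.toReal_mono (by simpa using hh.2.ne) h2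
      simpa using this
    rw [← h1, min_eq_right (abs_le.1 h3).2, max_eq_right (abs_le.1 h3).1]

/-- Exponential moments of the equilibrium fluctuation field. -/
theorem zetaEq_exp (hd : 1 ≤ d) (hε : 0 < ε) (hκ : 6 * 2 ^ d * ε ≤ 1) {h : Particle d → ℝ}
    (hh : MemLp h ⊤ volume) {H : ℝ} (hhH : supNorm h ≤ H) (hH : 0 < H) {t : ℝ} (ht : 0 ≤ t) :
    AEStronglyMeasurable (zetaEq ε t h) (eqMeasure d ε) ∧
    Integrable (fun Z => Real.exp (|zetaEq ε t h Z| / H)) (eqMeasure d ε) ∧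
    ∫ Z, Real.exp (|zetaEq ε t h Z| / H) ∂(eqMeasure d ε) ≤ 2 * Real.exp 4 ∧
    Integrable (empirical ε t h) (eqMeasure d ε) ∧
    |∫ Z, empirical ε t h Z ∂(eqMeasure d ε)| ≤ H := by
  have := isProbabilityMeasure_eqMeasure (d := d) hε
  have hmu0 := mu_pos (d := d) hε
  have hε2 : ε < 1 / 2 := by
    have : (2 : ℝ) ^ 1 ≤ 2 ^ d := pow_le_pow_right₀ (by norm_num) hd
    nlinarith
  obtain ⟨h', hm', hb', hae⟩ := exists_bounded_modification hh
  have hb : ∀ z, |h' z| ≤ H := fun z => (hb' z).trans hhH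
  obtain ⟨hΦ, hmap⟩ := phaseFlow_eqMeasure (d := d) hd hε hε2 ht
  have hLm : Measurable (linStat h' : Phase d → ℝ) := measurable_sum_conf hm'
  have hemp : ∀ᵐ Z ∂(eqMeasure d ε),
      empirical ε t h Z = 1 / mu d ε * linStat h' (phaseFlow ε t Z) := by
    -- Invariance pulls the almost sure equality at time 0 back to time t.
    have h1 := ae_eqMeasure_of_ae (ε := ε) hae
    rw [← hmap] at h1
    filter_upwards [ae_of_ae_map hΦ h1] with Z hZ
    rw [empirical, linStat]
    congr 1
    exact Finset.sum_congr rfl fun i _ => hZ i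
  have hLi : Integrable (linStat h') (eqMeasure d ε) :=
    integrable_eqMeasure hε (integrable_linStat hm' hb hH.le)
  have hLΦ : Integrable (fun Z => linStat h' (phaseFlow ε t Z)) (eqMeasure d ε) := by
    rw [← hmap] at hLi
    exact hLi.comp_aemeasurable hΦ
  have hmean : ∫ Z, empirical ε t h Z ∂(eqMeasure d ε) =
      1 / mu d ε * ∫ Z, linStat h' Z ∂(eqMeasure d ε) := by
    rw [integral_congr_ae hemp, integral_const_mul]
    congr 1
    conv_rhs => rw [← hmap]
    exact (integral_map hΦ hLm.aestronglyMeasurable).symm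
  set Y : Phase d → ℝ := fun Z => Real.sqrt (mu d ε) * (1 / mu d ε * linStat h' Z -
      1 / mu d ε * ∫ Z, linStat h' Z ∂(eqMeasure d ε)) with hY
  have hYm : Measurable Y := ((hLm.const_mul _).sub_const _).const_mul _
  have hz : ∀ᵐ Z ∂(eqMeasure d ε), zetaEq ε t h Z = Y (phaseFlow ε t Z) := by
    filter_upwards [hemp] with Z hZ
    rw [zetaEq, fluctuation, hmean, hZ]
  obtain ⟨i1, b1⟩ := exp_static hd hε hκ hm' hb hH (Y := Y) fun Z => rfl
  have hem : Measurable fun Z : Phase d => Real.exp (|Y Z| / H) := (hYm.abs.div_const H).exp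
  have hcongr : (fun Z => Real.exp (|zetaEq ε t h Z| / H)) =ᵐ[eqMeasure d ε]
      fun Z => Real.exp (|Y (phaseFlow ε t Z)| / H) := by
    filter_upwards [hz] with Z hZ
    rw [hZ]
  refine ⟨(hYm.comp_aemeasurable hΦ).aestronglyMeasurable.congr (hz.mono fun _ h => h.symm),
    ?_, ?_, (hLΦ.const_mul (1 / mu d ε)).congr (hemp.mono fun _ h => h.symm), ?_⟩
  · refine Integrable.congr ?_ hcongr.symm
    rw [← hmap] at i1
    exact i1.comp_aemeasurable hΦ
  · rw [integral_congr_ae hcongr]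
    refine le_trans (le_of_eq ?_) b1
    conv_rhs => rw [← hmap]
    exact (integral_map hΦ hem.aestronglyMeasurable).symm
  · rw [hmean, integral_eqMeasure hε, abs_mul, abs_mul, abs_of_pos (one_div_pos.2 hmu0),
      abs_of_pos (inv_pos.2 (gas_univ_pos d ε))]
    have h1 := abs_integral_linStat_le (ν := intensity d ε) (measurableSet_overlap ε) Overlap.symm
      hm' hb hH.le
    rw [intensity_real_univ hε] at h1
    have h2 := gas_univ_pos d ε
    rw [← mul_assoc, one_div, ← mul_inv, inv_mul_le_iff₀ (by positivity)]
    linarith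

end Moments

/-! ### Probability of finding many points in a set. -/

section Counting

variable {X : Type*}

open Classical in
/-- The number of points of a configuration in `B`. -/
def count (B : Set X) {n : ℕ} (Z : Fin n → X) : ℕ := ∑ j, if Z j ∈ B then 1 else 0

lemma count_eq_card (B : Set X) {n : ℕ} (Z : Fin n → X) :
    count B Z = {j | Z j ∈ B}.ncard := by
  classical
  rw [count, ← Finset.sum_filter, Finset.sum_const, smul_eq_mul, mul_one,
    ← Set.ncard_coe_finset]
  congr 1
  ext j; simp

lemma count_succAbove (B : Set X) {n : ℕ} (i : Fin (n + 1)) (Z : Fin (n + 1) → X)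
    (hi : Z i ∈ B) : count B Z = count B (fun j => Z (i.succAbove j)) + 1 := by
  rw [count, Fin.sum_univ_succAbove _ i, if_pos hi, count, add_comm]

variable [MeasurableSpace X] {ν : Measure X} {R : X → X → Prop}

lemma measurable_count {Y : Type*} [MeasurableSpace Y] {B : Y → Set X}
    (hB : MeasurableSet {p : Y × X | p.2 ∈ B p.1}) (n : ℕ) :
    Measurable fun p : Y × (Fin n → X) => count (B p.1) p.2 := by
  unfold count
  refine Finset.measurable_sum _ fun j _ => Measurable.ite ?_ measurable_const measurable_const
  exact (measurable_fst.prodMk ((measurable_pi_apply j).comp measurable_snd) :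
    Measurable fun p : Y × (Fin n → X) => (p.1, p.2 j)) hB

lemma measurableSet_le_count {B : Set X} (hB : MeasurableSet B) (m n : ℕ) :
    MeasurableSet {Z : Fin n → X | m ≤ count B Z} := by
  have := (measurable_count (Y := Unit) (B := fun _ => B) (measurable_snd hB) n).comp
    ((measurable_const (a := ())).prodMk measurable_id)
  exact measurableSet_le measurable_const this

/-- The probability of finding `m` points in `B`. -/
lemma lintegral_count_le [IsFiniteMeasure ν] (hR : MeasurableSet {p : X × X | R p.1 p.2})
    (hs : ∀ x y, R x y → R y x) {B : Set X} (hB : MeasurableSet B) (m : ℕ) :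
    ∫⁻ Z : PointConf X, Set.indicator {Z : PointConf X | m ≤ count B Z.2} 1 Z ∂(gas ν R) ≤
      ν B ^ m * gas ν R Set.univ := by
  have hm : ∀ m, MeasurableSet {Z : PointConf X | m ≤ count B Z.2} := fun m => by
    have : Measurable fun Z : PointConf X => count B Z.2 := by
      refine measurable_sigma fun N => ?_
      exact (measurable_count (Y := Unit) (B := fun _ => B) (measurable_snd hB) N).comp
        ((measurable_const (a := ())).prodMk measurable_id)
    exact measurableSet_le measurable_const this
  induction m with
  | zero => simp
  | succ m ih =>
    -- One point of B is marked, at the cost of a factor ν(B); the other points still include m of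
    -- B.
    have h := lintegral_gas_le (ν := ν) hR hs
      (F := Set.indicator {Z : PointConf X | m + 1 ≤ count B Z.2} 1)
      (G := fun n x Z => Set.indicator B 1 x * Set.indicator {Z : Fin n → X | m ≤ count B Z} 1 Z)
      (measurable_one.indicator (hm _))
      (fun n => ((measurable_one.indicator hB).comp measurable_fst).mul
        ((measurable_one.indicator (measurableSet_le_count hB m n)).comp measurable_snd))
      (fun Z => by simp [count]) (fun n Z => ?_)
    · refine h.trans ?_
      have e : ∀ x, ∫⁻ Z : PointConf X, Set.indicator B (1 : X → ENNReal) x *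
          Set.indicator {Y : Fin Z.1 → X | m ≤ count B Y} 1 Z.2 ∂(gas ν R) ≤
          Set.indicator B 1 x * (ν B ^ m * gas ν R Set.univ) := fun x => by
        rw [lintegral_const_mul]
        · gcongr
          exact ih
        · exact measurable_one.indicator (hm m)
      refine (lintegral_mono e).trans ?_
      rw [lintegral_mul_const _ (measurable_one.indicator hB), lintegral_indicator_one hB, pow_succ,
        ← mul_assoc, mul_comm (ν B)]
    · by_cases hc : m + 1 ≤ count B Z
      · have h1 : ∃ i, Z i ∈ B := by
          by_contra hne
          push Not at hne
          simp [count, hne] at hc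
        obtain ⟨i, hi⟩ := h1
        refine le_trans ?_ (Finset.single_le_sum (f := fun i => Set.indicator B 1 (Z i) *
          Set.indicator {Z : Fin n → X | m ≤ count B Z} (1 : (Fin n → X) → ENNReal)
            (fun j => Z (i.succAbove j))) (fun _ _ => zero_le) (Finset.mem_univ i))
        have h2 : m ≤ count B fun j => Z (i.succAbove j) := by
          rw [count_succAbove B i Z hi] at hc
          omega
        have e1 : Set.indicator B 1 (Z i) * Set.indicator {Z : Fin n → X | m ≤ count B Z}
            (1 : (Fin n → X) → ENNReal) (fun j => Z (i.succAbove j)) = 1 := by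
          rw [Set.indicator_of_mem hi, Set.indicator_of_mem (Set.mem_ofPred_eq ▸ h2)]
          simp
        exact (Set.indicator_le_self' (fun _ _ => zero_le) _).trans e1.ge
      · rw [Set.indicator_of_notMem (by simpa using hc)]
        exact zero_le

end Counting

/-! ### Large clusters force crowding. -/

section Cluster

variable {d N : ℕ}

/-- The particles that can be reached from `i` in at most `k` steps of length at most `r`. -/
def reach (r : ℝ) (Z : Config d N) (i : Fin N) : ℕ → Set (Fin N)
  | 0 => {i}
  | k + 1 => reach r Z i k ∪ {l | ∃ j ∈ reach r Z i k, torusDist (Z j).1 (Z l).1 ≤ r}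

lemma reach_dist {r : ℝ} (hr : 0 ≤ r) (Z : Config d N) (i : Fin N) (k : ℕ) :
    ∀ j ∈ reach r Z i k, torusDist (Z i).1 (Z j).1 ≤ k * r := by
  induction k with
  | zero =>
    rintro j rfl
    simp [torusDist_self]
  | succ k ih =>
    push_cast
    rintro j (hj | ⟨l, hl, hlj⟩)
    · linarith [ih j hj]
    · have := torusDist_triangle (Z i).1 (Z l).1 (Z j).1
      linarith [ih l hl]

lemma cluster_subset_reach {r : ℝ} {Z : Config d N} {i : Fin N} {k : ℕ}
    (h : reach r Z i (k + 1) ⊆ reach r Z i k) : cluster r Z i ⊆ reach r Z i k := by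
  intro j hj
  have hi : ∀ n, i ∈ reach r Z i n := fun n => by
    induction n with
    | zero => rfl
    | succ n ih => exact Or.inl ih
  simp only [cluster, Set.mem_ofPred_eq] at hj
  induction hj with
  | refl => exact hi k
  | tail _ h2 ih => exact h (Or.inr ⟨_, ih, h2⟩)

/-- The reachable set gains a particle at each step until it stabilises, and once stable it contains
the whole cluster. Hence m + 1 particles are reached within m steps, so within distance m r. -/
lemma lt_ncard_reach {r : ℝ} {Z : Config d N} {i : Fin N} {m : ℕ}
    (hm : m < (cluster r Z i).ncard) (k : ℕ) (hk : k ≤ m) : k < (reach r Z i k).ncard := by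
  induction k with
  | zero => simp [reach]
  | succ k ih =>
    have h1 := ih (by omega)
    have hsub : reach r Z i k ⊆ reach r Z i (k + 1) := Set.subset_union_left
    by_cases hs : reach r Z i (k + 1) ⊆ reach r Z i k
    · have h2 := Set.ncard_le_ncard (cluster_subset_reach hs) (Set.toFinite _)
      have h3 := Set.ncard_le_ncard hsub (Set.toFinite _)
      omega
    · have := Set.ncard_lt_ncard (⟨hsub, hs⟩) (Set.toFinite _)
      omega

/-- A large cluster contains many particles close to a given one. -/
lemma le_count_of_lt_ncard_cluster {n : ℕ} {r : ℝ} (hr : 0 ≤ r) {Z : Config d (n + 1)}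
    {i : Fin (n + 1)} {m : ℕ} (hm : m < (cluster r Z i).ncard) :
    m ≤ count {z : Particle d | torusDist (Z i).1 z.1 ≤ m * r} (fun j => Z (i.succAbove j)) := by
  have h1 := lt_ncard_reach hm m le_rfl
  have h2 : reach r Z i m ⊆ {j | Z j ∈ {z : Particle d | torusDist (Z i).1 z.1 ≤ m * r}} :=
    fun j hj => reach_dist hr Z i m j hj
  have h3 := Set.ncard_le_ncard h2 (Set.toFinite _)
  rw [← count_eq_card, count_succAbove _ i Z (by
    simp only [Set.mem_ofPred_eq, torusDist_self]; positivity)] at h3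
  omega

lemma measurableSet_controlled (ε : ℝ) (N : ℕ) :
    MeasurableSet {Z : Config d N | Controlled ε Z} := by
  set r := 3 * Real.sqrt (4 * d) * cutoff ε * delta d ε with hr
  have hadj : Measurable fun Z : Config d N =>
      (fun k l => torusDist (Z k).1 (Z l).1 ≤ r : Fin N → Fin N → Prop) := by
    refine measurable_pi_lambda _ fun k => measurable_pi_lambda _ fun l => ?_
    refine measurableSet_setOfPred.1 (measurableSet_le ?_ measurable_const)
    exact (continuous_torusDist_comp (continuous_fst.comp (continuous_apply k))
      (continuous_fst.comp (continuous_apply l))).measurable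
  -- Cluster sizes depend on Z only through the adjacency relation, which ranges over a finite type.
  have hS : MeasurableSet {A : Fin N → Fin N → Prop |
      ∀ j, {l | Relation.ReflTransGen A j l}.ncard ≤ 4 * d} := (Set.toFinite _).measurableSet
  have hv : MeasurableSet {Z : Config d N | ∀ j, ‖(Z j).2‖ ≤ cutoff ε} := by
    rw [Set.ofPred_forall]
    exact MeasurableSet.iInter fun j => measurableSet_le
      (measurable_snd.comp (measurable_pi_apply j)).norm measurable_const
  exact hv.inter (hadj hS)

end Cluster

/-! ### Static probability of fast particles and of large clusters. -/

section ControlledProbability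

variable {d : ℕ} {ε : ℝ}

/-- First moment method: the expected number of particles carrying a defect is computed by Mecke's
inequality. Around a marked particle, m others within distance m r cost the m-th power of the
intensity of that ball, and integrating over the marked particle gives the factor μ_ε. -/
lemma large_cluster_le (hε : 0 < ε) {r : ℝ} (hr0 : 0 ≤ r) (V : ℝ) (m : ℕ) :
    eqMeasure d ε {Z : Phase d | (∃ i, V < ‖(Z.2 i).2‖) ∨ ∃ i, m < (cluster r Z.2 i).ncard} ≤
      intensity d ε {z | V < ‖z.2‖} + ENNReal.ofReal (mu d ε) *
        (ENNReal.ofReal (mu d ε) * ENNReal.ofReal (2 * (m * r)) ^ d) ^ m := by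
  set B : Particle d → Set (Particle d) := fun x => {z | torusDist x.1 z.1 ≤ m * r} with hB
  have hBm : MeasurableSet {p : Particle d × Particle d | p.2 ∈ B p.1} :=
    measurableSet_overlap (m * r)
  have hVm : MeasurableSet {z : Particle d | V < ‖z.2‖} :=
    measurableSet_lt measurable_const measurable_snd.norm
  set G : ∀ n, Particle d → (Fin n → Particle d) → ENNReal := fun n x Z =>
    Set.indicator {z : Particle d | V < ‖z.2‖} 1 x +
      Set.indicator {p : Particle d × (Fin n → Particle d) | m ≤ count (B p.1) p.2} 1 (x, Z)
    with hG
  have hGm : ∀ n, Measurable fun p : Particle d × (Fin n → Particle d) => G n p.1 p.2 := fun n =>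
    ((measurable_one.indicator hVm).comp measurable_fst).add
      (measurable_one.indicator (measurableSet_le measurable_const (measurable_count hBm n)))
  set F : Phase d → ENNReal := fun Z => match Z with
    | ⟨0, _⟩ => 0
    | ⟨n + 1, Z⟩ => ∑ i, G n (Z i) (fun j => Z (i.succAbove j)) with hF
  have hFm : Measurable F := by
    refine measurable_sigma fun N => ?_
    cases N with
    | zero => exact measurable_const
    | succ n => exact Finset.measurable_sum _ fun i _ => measurable_removeNth (hGm n) i
  have hsub : {Z : Phase d | (∃ i, V < ‖(Z.2 i).2‖) ∨ ∃ i, m < (cluster r Z.2 i).ncard} ⊆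
      {Z | 1 ≤ F Z} := by
    rintro ⟨N, Z⟩ hZ
    cases N with
    | zero => rcases hZ with ⟨i, _⟩ | ⟨i, _⟩ <;> exact i.elim0
    | succ n =>
      have : ∃ i, 1 ≤ G n (Z i) (fun j => Z (i.succAbove j)) := by
        rcases hZ with ⟨i, hi⟩ | ⟨i, hi⟩
        · refine ⟨i, le_add_of_le_left ?_⟩
          rw [Set.indicator_of_mem (Set.mem_ofPred_eq ▸ hi)]
          rfl
        · refine ⟨i, le_add_of_le_right ?_⟩
          rw [Set.indicator_of_mem (Set.mem_ofPred_eq ▸ le_count_of_lt_ncard_cluster hr0 hi)]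
          rfl
      obtain ⟨i, hi⟩ := this
      exact hi.trans (Finset.single_le_sum (f := fun i => G n (Z i) (fun j => Z (i.succAbove j)))
        (fun _ _ => zero_le) (Finset.mem_univ i))
  set g := gas (intensity d ε) (Overlap d ε) with hg
  set b := (ENNReal.ofReal (mu d ε) * ENNReal.ofReal (2 * (m * r)) ^ d) ^ m with hb
  have hin : ∀ x, ∫⁻ Z : Phase d, G Z.1 x Z.2 ∂g ≤
      (Set.indicator {z : Particle d | V < ‖z.2‖} 1 x + b) * g Set.univ := fun x => by
    have hBx : MeasurableSet (B x) := measurable_prodMk_left (x := x) hBm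
    have h1 : intensity d ε (B x) ^ m ≤ b := pow_le_pow_left' (intensity_ball_le x.1 _) m
    have h2 : ∫⁻ Z : Phase d, Set.indicator {Z : Phase d | m ≤ count (B x) Z.2} 1 Z ∂g ≤
        b * g Set.univ :=
      (lintegral_count_le (X := Particle d) (R := Overlap d ε) (ν := intensity d ε)
        (measurableSet_overlap ε) Overlap.symm hBx m).trans (mul_le_mul_left h1 _)
    have h3 : ∫⁻ Z : Phase d, G Z.1 x Z.2 ∂g =
        ∫⁻ Z : Phase d, (Set.indicator {z : Particle d | V < ‖z.2‖} 1 x +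
          Set.indicator {Z : Phase d | m ≤ count (B x) Z.2} 1 Z) ∂g := rfl
    rw [h3, lintegral_add_left measurable_const, lintegral_const, add_mul]
    exact add_le_add le_rfl h2
  have hmain : g {Z : Phase d | (∃ i, V < ‖(Z.2 i).2‖) ∨ ∃ i, m < (cluster r Z.2 i).ncard} ≤
      (intensity d ε {z | V < ‖z.2‖} + ENNReal.ofReal (mu d ε) * b) * g Set.univ := by
    calc _ ≤ g {Z | 1 ≤ F Z} := measure_mono hsub
      _ ≤ ∫⁻ Z, F Z ∂g := by simpa using mul_meas_ge_le_lintegral hFm 1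
      _ ≤ ∫⁻ x, ∫⁻ Z, G Z.1 x Z.2 ∂g ∂(intensity d ε) :=
          lintegral_gas_le (measurableSet_overlap ε) Overlap.symm hFm hGm (fun Z => rfl)
            fun n Z => le_rfl
      _ ≤ ∫⁻ x, (Set.indicator {z : Particle d | V < ‖z.2‖} 1 x + b) * g Set.univ
            ∂(intensity d ε) := lintegral_mono hin
      _ = _ := by
          have hm : Measurable fun x : Particle d =>
              Set.indicator {z : Particle d | V < ‖z.2‖} (1 : Particle d → ENNReal) x + b :=
            (measurable_one.indicator hVm).add measurable_const
          rw [lintegral_mul_const _ hm, lintegral_add_left (measurable_one.indicator hVm), lintegral_indicator_one hVm,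
            lintegral_const, intensity_univ, mul_comm b]
  rw [eqMeasure_eq hε, Measure.smul_apply, smul_eq_mul]
  refine (mul_le_mul_right hmain _).trans (le_of_eq ?_)
  rw [mul_comm _ (g Set.univ), ← mul_assoc,
    ENNReal.inv_mul_cancel (gas_univ_ne_zero d ε) (measure_ne_top _ _), one_mul]

lemma not_controlled_le (hε : 0 < ε) :
    eqMeasure d ε {Z : Phase d | ¬ Controlled ε Z.2} ≤
      intensity d ε {z | cutoff ε < ‖z.2‖} + ENNReal.ofReal (mu d ε) *
        (ENNReal.ofReal (mu d ε) * ENNReal.ofReal (2 * ((4 * d : ℕ) *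
          (3 * Real.sqrt (4 * d) * cutoff ε * delta d ε))) ^ d) ^ (4 * d) := by
  have hr0 : 0 ≤ 3 * Real.sqrt (4 * d) * cutoff ε * delta d ε := by
    have : 0 ≤ delta d ε := Real.rpow_nonneg hε.le _
    have : 0 ≤ cutoff ε := abs_nonneg _
    positivity
  refine (measure_mono fun Z hZ => ?_).trans (large_cluster_le hε hr0 (cutoff ε) (4 * d))
  rw [Set.mem_ofPred_eq, Controlled, not_and_or] at hZ
  push Not at hZ
  exact hZ

/-- Half of the Gaussian exponent yields exp(-V²/4); the other half is integrated and gives 2^{d/2}.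
-/
lemma maxwellMeasure_tail_le (V : ℝ) (hV : 0 ≤ V) :
    maxwellMeasure d {v | V < ‖v‖} ≤ ENNReal.ofReal (2 ^ d * Real.exp (-V ^ 2 / 4)) := by
  have hm : MeasurableSet {v : EuclideanSpace ℝ (Fin d) | V < ‖v‖} :=
    measurableSet_lt measurable_const measurable_norm
  set c : ℝ := 1 / (2 * Real.pi) ^ ((d : ℝ) / 2) with hc
  have hc0 : 0 < c := by positivity
  have hi : Integrable fun v : EuclideanSpace ℝ (Fin d) =>
      c * Real.exp (-V ^ 2 / 4) * Real.exp (-(1 / 4) * ‖v‖ ^ 2) :=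
    (integrable_exp_norm_sq (by norm_num)).const_mul _
  rw [maxwellMeasure, withDensity_apply _ hm]
  calc ∫⁻ v in {v | V < ‖v‖}, ENNReal.ofReal (maxwellian v)
      ≤ ∫⁻ v in {v | V < ‖v‖}, ENNReal.ofReal
        (c * Real.exp (-V ^ 2 / 4) * Real.exp (-(1 / 4) * ‖v‖ ^ 2)) := by
        refine setLIntegral_mono' hm fun v hv => ENNReal.ofReal_le_ofReal ?_
        rw [maxwellian_eq, ← hc, mul_assoc, ← Real.exp_add]
        refine mul_le_mul_of_nonneg_left (Real.exp_le_exp.2 ?_) hc0.le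
        have : V ^ 2 ≤ ‖v‖ ^ 2 := pow_le_pow_left₀ hV (le_of_lt hv) 2
        generalize V ^ 2 = a at this ⊢
        generalize ‖v‖ ^ 2 = b at this ⊢
        linarith
    _ ≤ ∫⁻ v, ENNReal.ofReal
        (c * Real.exp (-V ^ 2 / 4) * Real.exp (-(1 / 4) * ‖v‖ ^ 2)) :=
        setLIntegral_le_lintegral _ _
    _ = ENNReal.ofReal (c * Real.exp (-V ^ 2 / 4) * (Real.pi / (1 / 4)) ^ ((d : ℝ) / 2)) := by
        rw [← ofReal_integral_eq_lintegral_ofReal hi (ae_of_all _ fun v => by positivity),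
          integral_const_mul, integral_exp_norm_sq (by norm_num)]
    _ ≤ _ := by
        refine ENNReal.ofReal_le_ofReal ?_
        have h1 : c * (Real.pi / (1 / 4)) ^ ((d : ℝ) / 2) = 2 ^ ((d : ℝ) / 2) := by
          rw [hc, show Real.pi / (1 / 4) = 2 * (2 * Real.pi) by ring,
            Real.mul_rpow (x := 2) (y := 2 * Real.pi) (by norm_num) (by positivity)]
          rw [one_div, mul_comm, mul_assoc, mul_inv_cancel₀ (by positivity), mul_one]
        have h2 : (2 : ℝ) ^ ((d : ℝ) / 2) ≤ 2 ^ d := by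
          rw [← Real.rpow_natCast]
          refine Real.rpow_le_rpow_of_exponent_le (by norm_num) ?_
          have : (0 : ℝ) ≤ d := Nat.cast_nonneg d
          linarith
        calc _ = 2 ^ ((d : ℝ) / 2) * Real.exp (-V ^ 2 / 4) := by rw [← h1]; ring
          _ ≤ _ := by gcongr

end ControlledProbability

/-! ### The conditioning event has high probability. -/

section Conditioning

variable {d : ℕ} {ε : ℝ}

lemma tendsto_abs_log_pow_mul_rpow {n : ℕ} (hn : 0 < n) {s : ℝ} (hs : 0 < s) :
    Tendsto (fun ε : ℝ => |Real.log ε| ^ n * ε ^ s) (𝓝[>] 0) (𝓝 0) := by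
  have h1 := (tendsto_log_mul_rpow_nhdsGT_zero (r := s / n) (by positivity)).abs.pow n
  rw [abs_zero, zero_pow hn.ne'] at h1
  refine h1.congr' ?_
  filter_upwards [self_mem_nhdsWithin] with ε hε
  have hε0 : (0 : ℝ) < ε := hε
  rw [abs_mul, mul_pow, abs_of_pos (Real.rpow_pos_of_pos hε0 _), ← Real.rpow_natCast (ε ^ (s / n)),
    ← Real.rpow_mul hε0.le]
  congr 2
  field_simp

lemma mu_eq_rpow (hd : 1 ≤ d) (hε : 0 < ε) : mu d ε = ε ^ (1 - (d : ℝ)) := by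
  rw [mu, ← Real.rpow_natCast, ← Real.rpow_neg hε.le, Nat.cast_sub hd]
  congr 1
  push_cast
  ring

/-- With cut-off |log ε| the factor exp(-|log ε|²/4) is smaller than any power of ε. -/
lemma eventually_tail_le (hd : 1 ≤ d) {c : ℝ} (hc : 0 < c) : ∀ᶠ ε in 𝓝[>] (0 : ℝ),
    mu d ε * (2 ^ d * Real.exp (-cutoff ε ^ 2 / 4)) ≤ c * (delta d ε * ε ^ d) := by
  have h1 : Tendsto (fun ε : ℝ => |Real.log ε|) (𝓝[>] 0) atTop :=
    tendsto_abs_atBot_atTop.comp Real.tendsto_log_nhdsGT_zero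
  have h2 : Tendsto (fun ε : ℝ => 2 ^ d * ε) (𝓝[>] 0) (𝓝 (2 ^ d * 0)) :=
    (tendsto_const_nhds.mul tendsto_id).mono_left nhdsWithin_le_nhds
  rw [mul_zero] at h2
  filter_upwards [h1.eventually_ge_atTop (4 * (2 * d + 1)), h2.eventually (gt_mem_nhds hc),
    self_mem_nhdsWithin, Ioo_mem_nhdsGT one_pos] with ε hL hcε hε0 hε1
  have hε0 : (0 : ℝ) < ε := hε0
  have hlog : Real.log ε < 0 := Real.log_neg hε0 hε1.2
  set L := Real.log ε with hLdef
  rw [abs_of_neg hlog] at hL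
  have e1 : ∀ s : ℝ, ε ^ s = Real.exp (L * s) := fun s => Real.rpow_def_of_pos hε0 s
  rw [mu_eq_rpow hd hε0, cutoff, ← hLdef, sq_abs, delta, ← Real.rpow_natCast ε d, e1, e1, e1]
  have hd0 : (1 : ℝ) ≤ d := by exact_mod_cast hd
  calc Real.exp (L * (1 - d)) * (2 ^ d * Real.exp (-L ^ 2 / 4))
      = 2 ^ d * Real.exp (L * (1 - d) + -L ^ 2 / 4) := by rw [Real.exp_add]; ring
    _ ≤ 2 ^ d * Real.exp (L + (L * (1 - 1 / (2 * d)) + L * d)) := by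
        refine mul_le_mul_of_nonneg_left (Real.exp_le_exp.2 ?_) (by positivity)
        have h3 : L ≤ L * (1 - 1 / (2 * d)) := by
          have : 0 ≤ 1 / (2 * (d : ℝ)) := by positivity
          nlinarith
        have h4 : -L ^ 2 / 4 ≤ L * (2 * d + 1) := by
          have h5 : (2 * (d : ℝ) + 1) ≤ -L / 4 := by linarith
          have h6 := mul_le_mul_of_nonpos_left h5 hlog.le
          have e : L * (-L / 4) = -L ^ 2 / 4 := by ring
          rw [e] at h6
          exact h6
        nlinarith
    _ = 2 ^ d * ε * (Real.exp (L * (1 - 1 / (2 * d))) * Real.exp (L * d)) := by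
        rw [Real.exp_add L, Real.exp_log hε0, Real.exp_add]; ring
    _ ≤ _ := by gcongr

/-- Power counting behind γ = 4d and δ = ε^{1-1/(2d)}: up to logarithms the left side has exponent
(1 - d)(1 + 4d) + 4d²(1 - 1/(2d)) = d + 1, while δ ε^d has exponent d + 1 - 1/(2d). The spare power
ε^{1/(2d)} beats the logarithms. -/
lemma eventually_crowd_le (hd : 1 ≤ d) {c : ℝ} (hc : 0 < c) : ∀ᶠ ε in 𝓝[>] (0 : ℝ),
    mu d ε * (mu d ε * (2 * ((4 * d : ℕ) * (3 * Real.sqrt (4 * d) * cutoff ε * delta d ε))) ^ d) ^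
      (4 * d) ≤ c * (delta d ε * ε ^ d) := by
  set K : ℝ := 2 * ((4 * d : ℕ) * (3 * Real.sqrt (4 * d))) with hK
  have hd0 : (0 : ℝ) < d := by exact_mod_cast hd
  have h1 := (tendsto_abs_log_pow_mul_rpow (n := d * (4 * d)) (by positivity)
    (s := 1 / (2 * d)) (by positivity)).const_mul (K ^ (d * (4 * d)))
  rw [mul_zero] at h1
  filter_upwards [h1.eventually (gt_mem_nhds hc), self_mem_nhdsWithin] with ε h2 hε0
  have hε0 : (0 : ℝ) < ε := hε0
  have e1 : mu d ε * (mu d ε * (2 * ((4 * d : ℕ) *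
      (3 * Real.sqrt (4 * d) * cutoff ε * delta d ε))) ^ d) ^ (4 * d) =
      (K ^ (d * (4 * d)) * |Real.log ε| ^ (d * (4 * d))) *
        (mu d ε * mu d ε ^ (4 * d) * delta d ε ^ (d * (4 * d))) := by
    have : 2 * ((4 * d : ℕ) * (3 * Real.sqrt (4 * d) * cutoff ε * delta d ε)) =
      K * |Real.log ε| * delta d ε := by rw [hK, cutoff]; ring
    rw [this, mul_pow (mu d ε), ← pow_mul, mul_pow, mul_pow]
    ring
  have e2 : mu d ε * mu d ε ^ (4 * d) * delta d ε ^ (d * (4 * d)) =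
      ε ^ (1 / (2 * (d : ℝ))) * (delta d ε * ε ^ d) := by
    rw [mu_eq_rpow hd hε0, delta, ← Real.rpow_natCast, ← Real.rpow_natCast, ← Real.rpow_natCast,
      ← Real.rpow_mul hε0.le, ← Real.rpow_mul hε0.le, ← Real.rpow_add hε0, ← Real.rpow_add hε0,
      ← Real.rpow_add hε0, ← Real.rpow_add hε0]
    congr 1
    push_cast
    field_simp
    ring
  rw [e1, e2, ← mul_assoc]
  have : 0 ≤ delta d ε * ε ^ d := mul_nonneg (Real.rpow_nonneg hε0.le _) (by positivity)
  rw [← mul_assoc] at h2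
  exact mul_le_mul_of_nonneg_right h2.le this

/-- Uncontrolled configurations are unlikely at equilibrium. -/
lemma eventually_not_controlled_le (hd : 1 ≤ d) {c : ℝ} (hc : 0 < c) : ∀ᶠ ε in 𝓝[>] (0 : ℝ),
    eqMeasure d ε {Z : Phase d | ¬ Controlled ε Z.2} ≤
      ENNReal.ofReal (c * (delta d ε * ε ^ d)) := by
  filter_upwards [eventually_tail_le hd (half_pos hc), eventually_crowd_le hd (half_pos hc),
    self_mem_nhdsWithin] with ε h1 h2 hε0
  have hε0 : (0 : ℝ) < ε := hε0
  have hmu := mu_pos (d := d) hε0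
  have hδ : 0 ≤ delta d ε := Real.rpow_nonneg hε0.le _
  have hV : 0 ≤ cutoff ε := abs_nonneg _
  refine (not_controlled_le hε0).trans ?_
  have e : c * (delta d ε * ε ^ d) =
    c / 2 * (delta d ε * ε ^ d) + c / 2 * (delta d ε * ε ^ d) := by ring
  rw [e, ENNReal.ofReal_add (by positivity) (by positivity)]
  refine add_le_add ?_ ?_
  · have : {z : Particle d | cutoff ε < ‖z.2‖} =
        Set.univ ×ˢ {v : EuclideanSpace ℝ (Fin d) | cutoff ε < ‖v‖} := by ext z; simp
    rw [intensity, Measure.smul_apply, smul_eq_mul, this, Measure.prod_prod, measure_univ, one_mul]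
    refine le_trans ?_ (ENNReal.ofReal_le_ofReal h1)
    rw [ENNReal.ofReal_mul hmu.le]
    gcongr
    exact maxwellMeasure_tail_le _ hV
  · refine le_trans (le_of_eq ?_) (ENNReal.ofReal_le_ofReal h2)
    rw [ENNReal.ofReal_mul hmu.le, ENNReal.ofReal_pow (by positivity), ENNReal.ofReal_mul hmu.le,
      ENNReal.ofReal_pow (by positivity)]

lemma ae_admissible (hε : 0 < ε) : ∀ᵐ Z ∂(eqMeasure d ε), Z.2 ∈ admissible d ε Z.1 := by
  refine Measure.ae_smul_measure ?_ _
  rw [Measure.ae_sum_iff]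
  intro N
  rw [(measurableEmbedding_sigma_mk N).ae_map_iff, weight_eq_gasLevel hε]
  have h2 : hardCore (Overlap d ε) N = admissible d ε N := by
    ext Z; simp [hardCore, admissible, Overlap]
  refine Measure.ae_smul_measure ?_ _
  rw [h2]
  exact ae_restrict_mem (measurableSet_admissible d ε N)

lemma measurableSet_phase_controlled (ε : ℝ) :
    MeasurableSet {Z : Phase d | Controlled ε Z.2} := by
  rw [Sigma.instMeasurableSpace, MeasurableSpace.measurableSet_iInf]
  exact fun N => measurableSet_controlled ε N

/-- A sampling time is at least a - kτ ≥ b, so the flow and its invariance apply at it. -/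
lemma sampling_time_nonneg {τ δ a b : ℝ} (hτ : 0 < τ) (hδ : 0 < δ) (hb : 0 ≤ b) {k r : ℕ}
    (hk : (k : ℝ) ≤ (a - b) / τ) (hr : (r : ℝ) ≤ τ / δ) :
    0 ≤ a - ((k : ℝ) - 1) * τ - r * δ := by
  rw [le_div_iff₀ hτ] at hk
  rw [le_div_iff₀ hδ] at hr
  linarith

lemma nullMeasurableSet_conditioning (hd : 1 ≤ d) (hε : 0 < ε) (hε' : ε < 1 / 2) {τ : ℝ}
    (hτ : 0 < τ) {P : ℕ} {θ : Fin P → ℝ} (hθ : ∀ i, 0 ≤ θ i) :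
    NullMeasurableSet (conditioning d ε τ θ) (eqMeasure d ε) := by
  have hδ : 0 < delta d ε := Real.rpow_pos_of_pos hε _
  have hadm : NullMeasurableSet {Z : Phase d | Z.2 ∈ admissible d ε Z.1} (eqMeasure d ε) :=
    MeasurableSet.univ.nullMeasurableSet.congr (eventuallyEq_univ.2 (ae_admissible hε)).symm
  have e : conditioning d ε τ θ = {Z : Phase d | Z.2 ∈ admissible d ε Z.1} ∩
      ⋂ p : Fin P, ⋂ q : Fin P, ⋂ k : ℕ, ⋂ r : ℕ, {Z : Phase d | (q : ℕ) + 1 = p → 1 ≤ k →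
        (k : ℝ) ≤ (θ p - θ q) / τ → (r : ℝ) ≤ τ / delta d ε →
          Controlled ε (flow ε Z.2 (θ p - ((k : ℝ) - 1) * τ - r * delta d ε))} := by
    ext Z
    simp only [conditioning, Set.mem_ofPred_eq, Set.mem_inter_iff, Set.mem_iInter]
    exact and_congr_right fun _ => ⟨fun h p q k r h1 h2 h3 h4 => h p q h1 k h2 h3 r h4,
      fun h p q h1 k h2 h3 r h4 => h p q k r h1 h2 h3 h4⟩
  rw [e]
  refine hadm.inter (NullMeasurableSet.iInter fun p => NullMeasurableSet.iInter fun q =>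
    NullMeasurableSet.iInter fun k => NullMeasurableSet.iInter fun r => ?_)
  by_cases h : (q : ℕ) + 1 = p ∧ 1 ≤ k ∧ (k : ℝ) ≤ (θ p - θ q) / τ ∧ (r : ℝ) ≤ τ / delta d ε
  · have ht := sampling_time_nonneg hτ hδ (hθ q) h.2.2.1 h.2.2.2
    have := (phaseFlow_eqMeasure (d := d) hd hε hε' ht).1.nullMeasurable
      (measurableSet_phase_controlled ε)
    convert this using 1
    ext Z
    simp only [Set.mem_ofPred_eq, Set.mem_preimage]
    exact ⟨fun H => H h.1 h.2.1 h.2.2.1 h.2.2.2, fun H _ _ _ _ => H⟩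
  · convert MeasurableSet.univ.nullMeasurableSet
    ext Z
    simp only [Set.mem_ofPred_eq, Set.mem_univ, iff_true]
    exact fun h1 h2 h3 h4 => absurd ⟨h1, h2, h3, h4⟩ h

/-- Union bound: by invariance each sampling time costs the static probability. There are at most P²
(Θ/τ)(τ/δ + 1) of them, and δ ≤ τ bounds this by 2P²Θ/δ, so that τ cancels. -/
lemma measure_compl_conditioning_le (hd : 1 ≤ d) (hε : 0 < ε) (hε' : ε < 1 / 2) {τ Θ : ℝ}
    (hτ : 0 < τ) (hδτ : delta d ε ≤ τ) {P : ℕ} {θ : Fin P → ℝ} (hΘ : 0 ≤ Θ)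
    (hθ : ∀ i, θ i ∈ Set.Icc 0 Θ) :
    eqMeasure d ε (conditioning d ε τ θ)ᶜ ≤ ENNReal.ofReal ((P : ℝ) ^ 2 * (2 * Θ / delta d ε)) *
      eqMeasure d ε {Z : Phase d | ¬ Controlled ε Z.2} := by
  have hδ : 0 < delta d ε := Real.rpow_pos_of_pos hε _
  set p0 := eqMeasure d ε {Z : Phase d | ¬ Controlled ε Z.2} with hp0
  set K := ⌊Θ / τ⌋₊ with hK
  set M := ⌊τ / delta d ε⌋₊ with hM
  set A : Fin P × Fin P × ℕ × ℕ → Set (Phase d) := fun a =>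
    {Z | (a.2.2.1 : ℝ) ≤ (θ a.1 - θ a.2.1) / τ ∧ (a.2.2.2 : ℝ) ≤ τ / delta d ε ∧
      ¬ Controlled ε (flow ε Z.2 (θ a.1 - ((a.2.2.1 : ℝ) - 1) * τ - a.2.2.2 * delta d ε))} with hA
  have hAle : ∀ a, eqMeasure d ε (A a) ≤ p0 := fun a => by
    by_cases h : (a.2.2.1 : ℝ) ≤ (θ a.1 - θ a.2.1) / τ ∧ (a.2.2.2 : ℝ) ≤ τ / delta d ε
    · have ht := sampling_time_nonneg hτ hδ (hθ a.2.1).1 h.1 h.2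
      obtain ⟨h1, h2⟩ := phaseFlow_eqMeasure (d := d) hd hε hε' ht
      have h3 := Measure.map_apply_of_aemeasurable h1 (measurableSet_phase_controlled ε).compl
      rw [h2] at h3
      have h4 : {Z : Phase d | Controlled ε Z.2}ᶜ = {Z : Phase d | ¬ Controlled ε Z.2} := rfl
      rw [hp0, ← h4, h3]
      exact measure_mono fun Z hZ => hZ.2.2
    · rw [hA]
      refine le_trans (le_of_eq ?_) zero_le
      convert measure_empty (μ := eqMeasure d ε)
      ext Z
      simp only [Set.mem_ofPred_eq, Set.mem_empty_iff_false, iff_false]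
      exact fun H => h ⟨H.1, H.2.1⟩
  set S : Finset (Fin P × Fin P × ℕ × ℕ) :=
    Finset.univ ×ˢ Finset.univ ×ˢ Finset.Icc 1 K ×ˢ Finset.range (M + 1) with hS
  have hsub : (conditioning d ε τ θ)ᶜ ⊆
      {Z : Phase d | ¬ Z.2 ∈ admissible d ε Z.1} ∪ ⋃ a ∈ S, A a := by
    intro Z hZ
    by_cases hadm : Z.2 ∈ admissible d ε Z.1
    · right
      simp only [conditioning, Set.mem_compl_iff, Set.mem_ofPred_eq, not_and] at hZ
      have := hZ hadm
      push Not at this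
      obtain ⟨p, q, _, k, hk1, hk, r, hr, hc⟩ := this
      refine Set.mem_biUnion (x := (p, q, k, r)) ?_ ⟨hk, hr, hc⟩
      have hkΘ : (k : ℝ) ≤ Θ / τ := hk.trans (by
        gcongr
        linarith [(hθ p).2, (hθ q).1])
      simp only [hS, Finset.coe_product, Set.mem_prod, Finset.coe_univ, Set.mem_univ, true_and,
        Finset.coe_Icc, Set.mem_Icc, Finset.coe_range, Set.mem_Iio]
      exact ⟨⟨hk1, Nat.le_floor hkΘ⟩, Nat.lt_succ_of_le (Nat.le_floor hr)⟩
    · exact Or.inl hadm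
  calc eqMeasure d ε (conditioning d ε τ θ)ᶜ
      ≤ eqMeasure d ε {Z : Phase d | ¬ Z.2 ∈ admissible d ε Z.1} +
        eqMeasure d ε (⋃ a ∈ S, A a) := (measure_mono hsub).trans (measure_union_le _ _)
    _ ≤ 0 + ∑ _a ∈ S, p0 := by
        refine add_le_add (le_of_eq (ae_admissible hε)) ?_
        exact (measure_biUnion_finset_le S A).trans (Finset.sum_le_sum fun a _ => hAle a)
    _ = ((P * (P * (K * (M + 1))) : ℕ) : ENNReal) * p0 := by
        rw [zero_add, Finset.sum_const, nsmul_eq_mul]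
        simp [hS]
    _ ≤ _ := by
        gcongr
        rw [← ENNReal.ofReal_natCast]
        refine ENNReal.ofReal_le_ofReal ?_
        push_cast
        have h1 : (K : ℝ) ≤ Θ / τ := Nat.floor_le (by positivity)
        have h2 : (M : ℝ) ≤ τ / delta d ε := Nat.floor_le (by positivity)
        have h3 : 1 ≤ τ / delta d ε := (one_le_div hδ).2 hδτ
        have h4 : (K : ℝ) * (M + 1) ≤ 2 * Θ / delta d ε := by
          calc (K : ℝ) * (M + 1) ≤ Θ / τ * (2 * (τ / delta d ε)) := by
                gcongr
                linarith
            _ = _ := by field_simp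
        calc (P : ℝ) * (P * (K * (M + 1))) = (P : ℝ) ^ 2 * (K * (M + 1)) := by ring
          _ ≤ _ := by gcongr

/-- The conditioning has high probability. -/
theorem eventually_conditioning (hd : 1 ≤ d) (P : ℕ) : ∀ᶠ ε in 𝓝[>] (0 : ℝ), ∀ τ Θ : ℝ, 0 < τ →
    delta d ε ≤ τ → 0 ≤ Θ → ∀ θ : Fin P → ℝ, (∀ i, θ i ∈ Set.Icc 0 Θ) →
      NullMeasurableSet (conditioning d ε τ θ) (eqMeasure d ε) ∧
      (eqMeasure d ε).real (conditioning d ε τ θ)ᶜ ≤ Θ * ε ^ d := by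
  -- This constant absorbs the factor 2P² of the union bound; the added 1 covers P = 0.
  have hc : (0 : ℝ) < 1 / (2 * (P : ℝ) ^ 2 + 1) := by positivity
  filter_upwards [eventually_not_controlled_le hd hc, Ioo_mem_nhdsGT (one_half_pos (α := ℝ))] with ε h1 hε τ Θ hτ hδτ hΘ θ hθ
  have hδ : 0 < delta d ε := Real.rpow_pos_of_pos hε.1 _
  refine ⟨nullMeasurableSet_conditioning hd hε.1 hε.2 hτ fun i => (hθ i).1, ?_⟩
  have hε0 := hε.1
  refine ENNReal.toReal_le_of_le_ofReal (by positivity) ?_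
  refine (measure_compl_conditioning_le hd hε.1 hε.2 hτ hδτ hΘ hθ).trans ?_
  refine (mul_le_mul_right h1 _).trans ?_
  rw [← ENNReal.ofReal_mul (by positivity)]
  refine ENNReal.ofReal_le_ofReal ?_
  calc (P : ℝ) ^ 2 * (2 * Θ / delta d ε) * (1 / (2 * (P : ℝ) ^ 2 + 1) * (delta d ε * ε ^ d))
      = 2 * (P : ℝ) ^ 2 / (2 * (P : ℝ) ^ 2 + 1) * (Θ * ε ^ d) := by field_simp
    _ ≤ 1 * (Θ * ε ^ d) := by
        gcongr
        rw [div_le_one (by positivity)]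
        linarith
    _ = _ := one_mul _

end Conditioning

/-! ### From exponential moments to moments and products. -/

section Abstract

variable {Ω : Type*} [MeasurableSpace Ω] {m : Measure Ω}

/-- Exponential integrability bounds all moments. -/
lemma moments_of_exp {Y : Ω → ℝ} (hY : AEStronglyMeasurable Y m) {H K : ℝ} (hH : 0 < H)
    (hi : Integrable (fun ω => Real.exp (|Y ω| / H)) m)
    (hK : ∫ ω, Real.exp (|Y ω| / H) ∂m ≤ K) {p : ℝ} (hp : 1 ≤ p) :
    Integrable (fun ω => |Y ω| ^ p) m ∧ ∫ ω, |Y ω| ^ p ∂m ≤ p ^ p * K * H ^ p := by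
  have hle : ∀ ω, |Y ω| ^ p ≤ p ^ p * H ^ p * Real.exp (|Y ω| / H) := fun ω => by
    have h1 := ProbabilityTheory.rpow_abs_le_mul_exp_abs (Y ω / H) (t := 1) (p := p)
      (by linarith) one_ne_zero
    rw [abs_one, div_one, one_mul, abs_div, abs_of_pos hH,
      Real.div_rpow (abs_nonneg _) hH.le, div_le_iff₀ (by positivity)] at h1
    linarith
  have hint : Integrable (fun ω => |Y ω| ^ p) m := by
    refine (hi.const_mul (p ^ p * H ^ p)).mono' ?_ (ae_of_all _ fun ω => ?_)
    · exact (hY.aemeasurable.norm.pow_const p).aestronglyMeasurable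
    · rw [Real.norm_of_nonneg (by positivity)]
      exact hle ω
  refine ⟨hint, (integral_mono hint (hi.const_mul _) hle).trans ?_⟩
  rw [integral_const_mul]
  have : 0 ≤ p ^ p * H ^ p := by positivity
  calc _ ≤ p ^ p * H ^ p * K := by gcongr
    _ = _ := by ring

lemma integer_moments_of_abs {Y : Ω → ℝ} (hY : AEStronglyMeasurable Y m) {p B : ℝ}
    (hi : Integrable (fun ω => |Y ω| ^ p) m) (hB : ∫ ω, |Y ω| ^ p ∂m ≤ B) {n : ℕ}
    (hn : (n : ℝ) = p) : Integrable (fun ω => Y ω ^ n) m ∧ |∫ ω, Y ω ^ n ∂m| ≤ B := by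
  subst hn
  simp only [Real.rpow_natCast] at hi hB
  refine ⟨hi.mono' (hY.pow n) (ae_of_all _ fun ω => by rw [Real.norm_eq_abs, abs_pow]), ?_⟩
  refine le_trans ?_ hB
  exact norm_integral_le_of_norm_le hi (ae_of_all _ fun ω => by rw [Real.norm_eq_abs, abs_pow])

/-- The exponential bounds require H > 0, so they are used for every H above the sup norm and a
limit is taken; this covers h vanishing almost everywhere. -/
lemma le_mul_rpow_of_forall_gt {a C S p : ℝ} (hp : 0 ≤ p)
    (h : ∀ H, S < H → a ≤ C * H ^ p) : a ≤ C * S ^ p := by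
  have h1 : Tendsto (fun H : ℝ => C * H ^ p) (𝓝[>] S) (𝓝 (C * S ^ p)) :=
    (((Real.continuous_rpow_const hp).tendsto S).const_mul C).mono_left nhdsWithin_le_nhds
  refine ge_of_tendsto h1 ?_
  filter_upwards [self_mem_nhdsWithin] with H hH using h H hH

lemma le_prod_mul_of_forall_pos {ι : Type*} [Fintype ι] {a C : ℝ} {S : ι → ℝ}
    (h : ∀ η, 0 < η → a ≤ (∏ i, (S i + η)) * C) : a ≤ (∏ i, S i) * C := by
  have h1 : Tendsto (fun η : ℝ => (∏ i, (S i + η)) * C) (𝓝[>] 0) (𝓝 ((∏ i, (S i + 0)) * C)) := by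
    refine Tendsto.mono_left (Continuous.tendsto ?_ 0) nhdsWithin_le_nhds
    fun_prop
  simp only [add_zero] at h1
  refine ge_of_tendsto h1 ?_
  filter_upwards [self_mem_nhdsWithin] with η hη using h η hη

lemma prod_le_sum_pow {ι : Type*} (s : Finset ι) {a : ι → ℝ} (ha : ∀ i, 1 ≤ a i) (n : ℕ)
    (hs : s.card ≤ n) (hne : s.Nonempty) : ∏ i ∈ s, a i ≤ ∑ i ∈ s, a i ^ n := by
  obtain ⟨j, hj, hmax⟩ := s.exists_max_image a hne
  calc ∏ i ∈ s, a i ≤ ∏ _i ∈ s, a j :=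
        Finset.prod_le_prod (fun i _ => zero_le_one.trans (ha i)) hmax
    _ = a j ^ s.card := by rw [Finset.prod_const]
    _ ≤ a j ^ n := pow_le_pow_right₀ (ha j) hs
    _ ≤ ∑ i ∈ s, a i ^ n := Finset.single_le_sum (f := fun i => a i ^ n)
        (fun i _ => pow_nonneg (zero_le_one.trans (ha i)) n) hj

/-- Telescoping; since a i ≥ 1, the factor missing from each term can be reinserted. -/
lemma abs_prod_sub_prod_le {ι : Type*} (s : Finset ι) {u v a : ι → ℝ} {c : ℝ}
    (ha : ∀ i, 1 ≤ a i) (hu : ∀ i, |u i| ≤ a i) (hv : ∀ i, |v i| ≤ a i)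
    (huv : ∀ i, |u i - v i| ≤ c) (hc : 0 ≤ c) :
    |∏ i ∈ s, u i - ∏ i ∈ s, v i| ≤ s.card * c * ∏ i ∈ s, a i := by
  classical
  induction s using Finset.induction_on with
  | empty => simp
  | insert j s hj ih =>
    rw [Finset.prod_insert hj, Finset.prod_insert hj, Finset.prod_insert hj,
      Finset.card_insert_of_notMem hj]
    have ha1 : 1 ≤ ∏ i ∈ s, a i := Finset.one_le_prod fun i _ => ha i
    have hus : |∏ i ∈ s, u i| ≤ ∏ i ∈ s, a i := by
      rw [Finset.abs_prod]
      exact Finset.prod_le_prod (fun i _ => abs_nonneg _) fun i _ => hu i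
    have e : u j * ∏ i ∈ s, u i - v j * ∏ i ∈ s, v i =
        (u j - v j) * ∏ i ∈ s, u i + v j * (∏ i ∈ s, u i - ∏ i ∈ s, v i) := by ring
    rw [e]
    refine (abs_add_le _ _).trans ?_
    rw [abs_mul, abs_mul]
    have h1 : |u j - v j| * |∏ i ∈ s, u i| ≤ c * ∏ i ∈ s, a i :=
      mul_le_mul (huv j) hus (abs_nonneg _) hc
    have h2 : |v j| * |∏ i ∈ s, u i - ∏ i ∈ s, v i| ≤ a j * (s.card * c * ∏ i ∈ s, a i) :=
      mul_le_mul (hv j) ih (abs_nonneg _) (zero_le_one.trans (ha j))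
    have h3 : c * ∏ i ∈ s, a i ≤ a j * (c * ∏ i ∈ s, a i) :=
      le_mul_of_one_le_left (by positivity) (ha j)
    push_cast
    calc _ ≤ a j * (c * ∏ i ∈ s, a i) + a j * (s.card * c * ∏ i ∈ s, a i) := by linarith
      _ = _ := by ring

/-- Comparison of the moments of a family of random variables with those of shifted variables
restricted to an event of high probability. -/
lemma abs_integral_prod_sub_le [IsProbabilityMeasure m] {U : Set Ω} (hU : NullMeasurableSet U m)
    {P : ℕ} (hP : 0 < P) {K c b : ℝ} (hb : 0 < b) (hb1 : b ≤ 1) (hc : 0 ≤ c)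
    (hUb : m.real Uᶜ ≤ b ^ 2) {y : Fin P → Ω → ℝ} (hy : ∀ i, AEStronglyMeasurable (y i) m)
    (hi : ∀ i, Integrable (fun ω => Real.exp |y i ω|) m)
    (hK : ∀ i, ∫ ω, Real.exp |y i ω| ∂m ≤ K) {s : Fin P → ℝ} (hs : ∀ i, |s i| ≤ c * b) :
    Integrable (fun ω => ∏ i, y i ω) m ∧
    Integrable (fun ω => ∏ i, (y i ω + s i)) (m.restrict U) ∧
    |∫ ω, ∏ i, y i ω ∂m - ∫ ω in U, ∏ i, (y i ω + s i) ∂m| ≤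
      (1 + (1 + P * c) * (P * ((2 * P).factorial * Real.exp (1 + c) * K))) * b := by
  have : NeZero P := ⟨hP.ne'⟩
  set F : ℝ := (2 * P).factorial * Real.exp (1 + c) with hF
  set D : ℝ := P * (F * K) with hD
  set B : Ω → ℝ := fun ω => ∑ i, F * Real.exp |y i ω| with hB
  have hBi : Integrable B m := integrable_finsetSum _ fun i _ => (hi i).const_mul F
  have hBD : ∫ ω, B ω ∂m ≤ D := by
    rw [integral_finsetSum _ fun i _ => (hi i).const_mul F]
    calc _ ≤ ∑ _i : Fin P, F * K := Finset.sum_le_sum fun i _ => by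
          rw [integral_const_mul]
          have : 0 ≤ F := by positivity
          exact mul_le_mul_of_nonneg_left (hK i) this
      _ = D := by simp [hD]
  have hs1 : ∀ i, |s i| ≤ c := fun i => (hs i).trans (mul_le_of_le_one_right hc hb1)
  set a : Ω → Fin P → ℝ := fun ω i => 1 + c + |y i ω| with ha
  have ha1 : ∀ ω i, 1 ≤ a ω i := fun ω i => by
    have := abs_nonneg (y i ω)
    simp only [ha]; linarith
  -- The square is what is needed off U. The product is bounded by powers of order 2P of its
  -- factors, and x^{2P} ≤ (2P)! exp(x) with x = 1 + c + |y i| gives F.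
  have hQ : ∀ ω, (∏ i, a ω i) ^ 2 ≤ B ω := fun ω => by
    rw [← Finset.prod_pow]
    have h1 : ∀ i, 1 ≤ a ω i ^ 2 := fun i => one_le_pow₀ (ha1 ω i)
    refine (prod_le_sum_pow Finset.univ h1 P (by simp) Finset.univ_nonempty).trans
      (Finset.sum_le_sum fun i _ => ?_)
    rw [← pow_mul]
    have h2 := Real.pow_div_factorial_le_exp (a ω i) (zero_le_one.trans (ha1 ω i)) (2 * P)
    rw [div_le_iff₀ (by positivity)] at h2
    refine h2.trans (le_of_eq ?_)
    rw [hF, ha, Real.exp_add]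
    ring
  have hA : ∀ ω, 1 ≤ ∏ i, a ω i := fun ω => Finset.one_le_prod fun i _ => ha1 ω i
  have hAB : ∀ ω, ∏ i, a ω i ≤ B ω := fun ω => (le_self_pow₀ (hA ω) two_ne_zero).trans (hQ ω)
  have hya : ∀ ω i, |y i ω| ≤ a ω i := fun ω i => by simp only [ha]; linarith
  have hsa : ∀ ω i, |y i ω + s i| ≤ a ω i := fun ω i => by
    have := abs_add_le (y i ω) (s i)
    have := hs1 i
    simp only [ha]; linarith
  have hy1 : ∀ ω, |∏ i, y i ω| ≤ ∏ i, a ω i := fun ω => by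
    rw [Finset.abs_prod]
    exact Finset.prod_le_prod (fun i _ => abs_nonneg _) fun i _ => hya ω i
  have hy2 : ∀ ω, |∏ i, (y i ω + s i)| ≤ ∏ i, a ω i := fun ω => by
    rw [Finset.abs_prod]
    exact Finset.prod_le_prod (fun i _ => abs_nonneg _) fun i _ => hsa ω i
  have hm1 : AEStronglyMeasurable (fun ω => ∏ i, y i ω) m :=
    Finset.aestronglyMeasurable_fun_prod _ fun i _ => hy i
  have hm2 : AEStronglyMeasurable (fun ω => ∏ i, (y i ω + s i)) m :=
    Finset.aestronglyMeasurable_fun_prod _ fun i _ => (hy i).add_const _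
  have hi1 : Integrable (fun ω => ∏ i, y i ω) m :=
    hBi.mono' hm1 (ae_of_all _ fun ω => (hy1 ω).trans (hAB ω))
  have hi2 : Integrable (fun ω => ∏ i, (y i ω + s i)) m :=
    hBi.mono' hm2 (ae_of_all _ fun ω => (hy2 ω).trans (hAB ω))
  refine ⟨hi1, hi2.integrableOn, ?_⟩
  have hUi : Integrable (Set.indicator Uᶜ fun _ => (1 : ℝ)) m :=
    (integrable_const (1 : ℝ)).indicator₀ hU.compl
  rw [← integral_indicator₀ hU, ← integral_sub hi1 (hi2.indicator₀ hU)]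
  have hbound : ∀ ω, ‖∏ i, y i ω - Set.indicator U (fun ω => ∏ i, (y i ω + s i)) ω‖ ≤
      b⁻¹ * Set.indicator Uᶜ (fun _ => 1) ω + (1 + P * c) * b * B ω := fun ω => by
    have hB1 : 1 ≤ B ω := (hA ω).trans (hAB ω)
    by_cases hω : ω ∈ U
    · rw [Set.indicator_of_mem hω, Set.indicator_of_notMem (by simpa using hω), mul_zero, zero_add,
        Real.norm_eq_abs]
      have h1 := abs_prod_sub_prod_le Finset.univ (u := fun i => y i ω)
        (v := fun i => y i ω + s i) (c := c * b) (ha1 ω) (hya ω) (hsa ω)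
        (fun i => by simpa using hs i) (by positivity)
      rw [Finset.card_univ, Fintype.card_fin] at h1
      refine h1.trans ?_
      calc (P : ℝ) * (c * b) * ∏ i, a ω i ≤ P * (c * b) * B ω := by
            gcongr
            exact hAB ω
        _ ≤ (1 + P * c) * b * B ω := by nlinarith
    · rw [Set.indicator_of_notMem hω, Set.indicator_of_mem (by simpa using hω), sub_zero, mul_one,
        Real.norm_eq_abs]
      refine (hy1 ω).trans ?_
      have h1 := hQ ω
      set x := ∏ i, a ω i
      -- Replaces Cauchy–Schwarz: off U, of measure at most b², the first term integrates to at most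
      -- b and the second is b times a second moment.
      have h2 : x ≤ b⁻¹ + b * x ^ 2 := by
        have h3 : 0 ≤ b⁻¹ * (b * x - 1) ^ 2 := by positivity
        have h4 : b⁻¹ * (b * x - 1) ^ 2 = b * x ^ 2 - 2 * x + b⁻¹ := by
          field_simp
          ring
        have h5 := hA ω
        linarith
      have h3 : b * x ^ 2 ≤ b * B ω := by gcongr
      have h4 : 0 ≤ P * c * b * B ω := by positivity
      linarith
  refine (norm_integral_le_of_norm_le ((hUi.const_mul _).add (hBi.const_mul _))
    (ae_of_all _ hbound)).trans ?_
  simp only [Pi.add_apply]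
  rw [integral_add (hUi.const_mul _) (hBi.const_mul _), integral_const_mul, integral_const_mul,
    integral_indicator₀ hU.compl]
  simp only [integral_const, MeasurableSet.univ, measureReal_restrict_apply, Set.univ_inter,
    smul_eq_mul, mul_one]
  have h1 : b⁻¹ * m.real Uᶜ ≤ b := by
    rw [inv_mul_le_iff₀ hb, ← sq]
    exact hUb
  have h2 : (1 + P * c) * b * ∫ ω, B ω ∂m ≤ (1 + P * c) * b * D := by gcongr
  linarith

end Abstract

/-! ### Equilibrium and conditioned fields compared. -/

section Comparison

variable {d : ℕ} {ε : ℝ}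

/-- The fields `ζ^ε` and `ζ^{ε,eq}` differ by a small constant. -/
lemma exists_zetaCond_eq (hd : 1 ≤ d) (hε : 0 < ε) (hκ : 6 * 2 ^ d * ε ≤ 1) {τ Θ : ℝ} {P : ℕ}
    {θ : Fin P → ℝ} (hU : NullMeasurableSet (conditioning d ε τ θ) (eqMeasure d ε))
    (hUb : (eqMeasure d ε).real (conditioning d ε τ θ)ᶜ ≤ Θ * ε ^ d) (hΘ : 1 ≤ Θ)
    (hΘε : Θ * ε ≤ 1) {h : Particle d → ℝ} (hh : MemLp h ⊤ volume) {H : ℝ}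
    (hhH : supNorm h ≤ H) (hH : 0 < H) {t : ℝ} (ht : 0 ≤ t) :
    ∃ c : ℝ, |c| ≤ (4 * Real.exp 4 + 2) * Real.sqrt (Θ * ε ^ d) * H ∧
      ∀ Z, zetaCond ε τ θ t h Z = zetaEq ε t h Z + c := by
  have := isProbabilityMeasure_eqMeasure (d := d) hε
  obtain ⟨hm, hi, hK, hei, heb⟩ := zetaEq_exp hd hε hκ hh hhH hH ht
  set U := conditioning d ε τ θ with hUdef
  set E := eqMeasure d ε with hE
  set b := Real.sqrt (Θ * ε ^ d) with hb
  have hb0 : 0 < b := Real.sqrt_pos.2 (by positivity)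
  have hbb : b ^ 2 = Θ * ε ^ d := Real.sq_sqrt (by positivity)
  have hmu := mu_pos (d := d) hε
  set s := Real.sqrt (mu d ε) with hs
  have hs0 : 0 < s := Real.sqrt_pos.2 hmu
  -- This is μ_ε Θ ε^d = Θ ε ≤ 1. It makes the contribution s H b² of the equilibrium mean no larger
  -- than H b.
  have hsb : s * b ≤ 1 := by
    rw [hs, hb, ← Real.sqrt_mul hmu.le]
    refine Real.sqrt_le_one.2 ?_
    obtain ⟨n, rfl⟩ : ∃ n, d = n + 1 := ⟨d - 1, by omega⟩
    have : mu (n + 1) ε * (Θ * ε ^ (n + 1)) = Θ * ε := by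
      rw [mu, Nat.add_sub_cancel, pow_succ]
      field_simp
    rw [this]
    exact hΘε
  -- The shift is the part of the mean lost on the complement of U. There |ζ| is bounded through x ≤
  -- b⁻¹ + b x², and x² by 2 exp(x).
  refine ⟨s * ∫ Z in Uᶜ, empirical ε t h Z ∂E, ?_, fun Z => ?_⟩
  · set e := ∫ Z, empirical ε t h Z ∂E with he
    have hY : ∀ Z, s * empirical ε t h Z = zetaEq ε t h Z + s * e := fun Z => by
      rw [zetaEq, fluctuation]
      ring
    have hpt : ∀ Z, |Set.indicator Uᶜ (fun Z => s * empirical ε t h Z) Z| ≤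
        b * H * 2 * Real.exp (|zetaEq ε t h Z| / H) +
          (b⁻¹ * H + s * H) * Set.indicator Uᶜ (fun _ => 1) Z := fun Z => by
      by_cases hZ : Z ∈ Uᶜ
      · rw [Set.indicator_of_mem hZ, Set.indicator_of_mem hZ, hY, mul_one]
        refine (abs_add_le _ _).trans ?_
        have h1 : |s * e| ≤ s * H := by
          rw [abs_mul, abs_of_pos hs0]
          gcongr
        have h2 := Real.pow_div_factorial_le_exp (|zetaEq ε t h Z| / H) (by positivity) 2
        set x := |zetaEq ε t h Z| / H with hx
        have hxH : |zetaEq ε t h Z| = x * H := by rw [hx]; field_simp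
        have h3 : x ≤ b⁻¹ + b * x ^ 2 := by
          have h3 : 0 ≤ b⁻¹ * (b * x - 1) ^ 2 := by positivity
          have h4 : b⁻¹ * (b * x - 1) ^ 2 = b * x ^ 2 - 2 * x + b⁻¹ := by
            field_simp
            ring
          have h5 : 0 ≤ x := by positivity
          linarith
        rw [div_le_iff₀ (by positivity)] at h2
        have h4 : b * x ^ 2 ≤ b * (Real.exp x * 2) := by
          gcongr
          simpa using h2
        rw [hxH]
        have h5 : x * H ≤ (b⁻¹ + b * (Real.exp x * 2)) * H := by
          gcongr
          linarith
        linarith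
      · rw [Set.indicator_of_notMem hZ, Set.indicator_of_notMem hZ, abs_zero, mul_zero, add_zero]
        positivity
    have hUi : Integrable (Set.indicator Uᶜ fun _ => (1 : ℝ)) E :=
      (integrable_const (1 : ℝ)).indicator₀ hU.compl
    rw [← integral_const_mul, ← integral_indicator₀ hU.compl, ← Real.norm_eq_abs]
    refine (norm_integral_le_of_norm_le ((hi.const_mul _).add (hUi.const_mul _))
      (ae_of_all _ hpt)).trans ?_
    simp only [Pi.add_apply]
    rw [integral_add (hi.const_mul _) (hUi.const_mul _), integral_const_mul, integral_const_mul,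
      integral_indicator₀ hU.compl]
    simp only [integral_const, MeasurableSet.univ, measureReal_restrict_apply, Set.univ_inter,
      smul_eq_mul, mul_one]
    rw [← hbb] at hUb
    have h1 : b * H * 2 * ∫ Z, Real.exp (|zetaEq ε t h Z| / H) ∂E ≤
        b * H * 2 * (2 * Real.exp 4) := by gcongr
    have h2 : (b⁻¹ * H + s * H) * E.real Uᶜ ≤ (b⁻¹ * H + s * H) * b ^ 2 := by gcongr
    have h3 : (b⁻¹ * H + s * H) * b ^ 2 = b * H + (s * b) * (b * H) := by
      field_simp
    have h4 : (s * b) * (b * H) ≤ 1 * (b * H) := by gcongr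
    linarith
  · have h1 : ∫ Z, empirical ε t h Z ∂E =
        ∫ Z in U, empirical ε t h Z ∂E + ∫ Z in Uᶜ, empirical ε t h Z ∂E :=
      (integral_add_compl₀ hU hei).symm
    rw [zetaCond, zetaEq, fluctuation, fluctuation, condMeasure, ← hE, ← hUdef, h1]
    ring

lemma eventually_small (d : ℕ) : ∀ᶠ ε in 𝓝[>] (0 : ℝ), 0 < ε ∧ 6 * 2 ^ d * ε ≤ 1 := by
  have h2 : Tendsto (fun ε : ℝ => 6 * 2 ^ d * ε) (𝓝[>] 0) (𝓝 (6 * 2 ^ d * 0)) :=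
    (tendsto_const_nhds.mul tendsto_id).mono_left nhdsWithin_le_nhds
  rw [mul_zero] at h2
  filter_upwards [h2.eventually (gt_mem_nhds one_pos), self_mem_nhdsWithin] with ε h1 h2
  exact ⟨h2, h1.le⟩

lemma tendsto_abs_log : Tendsto (fun ε : ℝ => |Real.log ε|) (𝓝[>] 0) atTop :=
  tendsto_abs_atBot_atTop.comp Real.tendsto_log_nhdsGT_zero

lemma eventually_abs_log_mul_rpow_le {s C : ℝ} (hs : 0 < s) :
    ∀ᶠ ε in 𝓝[>] (0 : ℝ), C * (|Real.log ε| * ε ^ s) ≤ 1 := by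
  have h := (tendsto_abs_log_pow_mul_rpow one_pos hs).const_mul C
  rw [mul_zero] at h
  filter_upwards [h.eventually (gt_mem_nhds one_pos)] with ε h1
  simpa using h1.le

/-- Moments of the equilibrium fluctuation field. -/
theorem zetaEq_moments {p : ℝ} (hp : 1 ≤ p) (hd : 1 ≤ d) (hε : 0 < ε) (hκ : 6 * 2 ^ d * ε ≤ 1)
    {h : Particle d → ℝ} (hh : MemLp h ⊤ volume) {t : ℝ} (ht : 0 ≤ t) :
    AEStronglyMeasurable (zetaEq ε t h) (eqMeasure d ε) ∧
    Integrable (fun Z => |zetaEq ε t h Z| ^ p) (eqMeasure d ε) ∧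
    ∫ Z, |zetaEq ε t h Z| ^ p ∂(eqMeasure d ε) ≤ p ^ p * (2 * Real.exp 4) * supNorm h ^ p := by
  have hS : 0 ≤ supNorm h := ENNReal.toReal_nonneg
  have key := fun H (hH : supNorm h < H) =>
    zetaEq_exp hd hε hκ hh hH.le (hS.trans_lt hH) ht
  have hm := (key (supNorm h + 1) (by linarith)).1
  refine ⟨hm, ?_, le_mul_rpow_of_forall_gt (by linarith) fun H hH => ?_⟩
  · obtain ⟨_, h1, h2, _⟩ := key (supNorm h + 1) (by linarith)
    exact (moments_of_exp hm (by linarith) h1 h2 hp).1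
  · obtain ⟨_, h1, h2, _⟩ := key H hH
    exact (moments_of_exp hm (hS.trans_lt hH) h1 h2 hp).2

/-- Moments of the conditioned fluctuation field. -/
theorem zetaCond_moments {p : ℝ} (hp : 1 ≤ p) (hd : 1 ≤ d) (hε : 0 < ε) (hκ : 6 * 2 ^ d * ε ≤ 1)
    {τ Θ : ℝ} {P : ℕ} {θ : Fin P → ℝ}
    (hU : NullMeasurableSet (conditioning d ε τ θ) (eqMeasure d ε))
    (hUb : (eqMeasure d ε).real (conditioning d ε τ θ)ᶜ ≤ Θ * ε ^ d) (hΘ : 1 ≤ Θ)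
    (hΘε : Θ * ε ≤ 1) {h : Particle d → ℝ} (hh : MemLp h ⊤ volume) {t : ℝ} (ht : 0 ≤ t) :
    AEStronglyMeasurable (zetaCond ε τ θ t h) (condMeasure d ε τ θ) ∧
    Integrable (fun Z => |zetaCond ε τ θ t h Z| ^ p) (condMeasure d ε τ θ) ∧
    ∫ Z, |zetaCond ε τ θ t h Z| ^ p ∂(condMeasure d ε τ θ) ≤
      p ^ p * (Real.exp (4 * Real.exp 4 + 2) * (2 * Real.exp 4)) * supNorm h ^ p := by
  have := isProbabilityMeasure_eqMeasure (d := d) hε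
  have hS : 0 ≤ supNorm h := ENNReal.toReal_nonneg
  have hε1 : ε ≤ 1 := by nlinarith
  have hb1 : Real.sqrt (Θ * ε ^ d) ≤ 1 := by
    refine Real.sqrt_le_one.2 (le_trans ?_ hΘε)
    gcongr
    exact pow_le_of_le_one hε.le hε1 (by omega)
  set q : ℝ := 4 * Real.exp 4 + 2 with hq
  have hq0 : 0 ≤ q := by positivity
  have key : ∀ H, supNorm h < H →
      AEStronglyMeasurable (zetaCond ε τ θ t h) (condMeasure d ε τ θ) ∧
      Integrable (fun Z => Real.exp (|zetaCond ε τ θ t h Z| / H)) (condMeasure d ε τ θ) ∧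
      ∫ Z, Real.exp (|zetaCond ε τ θ t h Z| / H) ∂(condMeasure d ε τ θ) ≤
        Real.exp q * (2 * Real.exp 4) := by
    intro H hSH
    have hH := hS.trans_lt hSH
    obtain ⟨hm, hi, hK, _, _⟩ := zetaEq_exp hd hε hκ hh hSH.le hH ht
    obtain ⟨c, hc, hce⟩ := exists_zetaCond_eq hd hε hκ hU hUb hΘ hΘε hh hSH.le hH ht
    have hmc : AEStronglyMeasurable (zetaCond ε τ θ t h) (eqMeasure d ε) := by
      rw [show zetaCond ε τ θ t h = _ from funext hce]
      exact hm.add_const c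
    -- The shift is at most q H, so it costs only a factor exp(q).
    have hle : ∀ Z, Real.exp (|zetaCond ε τ θ t h Z| / H) ≤
        Real.exp q * Real.exp (|zetaEq ε t h Z| / H) := fun Z => by
      rw [← Real.exp_add, hce]
      refine Real.exp_le_exp.2 ?_
      rw [div_le_iff₀ hH, add_mul, div_mul_cancel₀ _ hH.ne']
      have h1 : |c| ≤ q * H := hc.trans (by
        gcongr
        exact mul_le_of_le_one_right hq0 hb1)
      linarith [abs_add_le (zetaEq ε t h Z) c]
    have hie : Integrable (fun Z => Real.exp (|zetaCond ε τ θ t h Z| / H)) (eqMeasure d ε) :=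
      (hi.const_mul (Real.exp q)).mono'
        (hmc.aemeasurable.norm.div_const H).exp.aestronglyMeasurable
        (ae_of_all _ fun Z => by rw [Real.norm_of_nonneg (Real.exp_pos _).le]; exact hle Z)
    refine ⟨hmc.restrict, hie.integrableOn, ?_⟩
    calc _ ≤ ∫ Z, Real.exp (|zetaCond ε τ θ t h Z| / H) ∂(eqMeasure d ε) :=
          setIntegral_le_integral hie (ae_of_all _ fun Z => (Real.exp_pos _).le)
      _ ≤ ∫ Z, Real.exp q * Real.exp (|zetaEq ε t h Z| / H) ∂(eqMeasure d ε) :=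
          integral_mono hie (hi.const_mul _) hle
      _ ≤ _ := by
          rw [integral_const_mul]
          gcongr
  have hm := (key (supNorm h + 1) (by linarith)).1
  refine ⟨hm, ?_, le_mul_rpow_of_forall_gt (by linarith) fun H hH => ?_⟩
  · obtain ⟨_, h1, h2⟩ := key (supNorm h + 1) (by linarith)
    exact (moments_of_exp hm (by linarith) h1 h2 hp).1
  · obtain ⟨_, h1, h2⟩ := key H hH
    exact (moments_of_exp hm (hS.trans_lt hH) h1 h2 hp).2

/-- The constant in the comparison of the `P`-point moments. -/
def comparisonConst (P : ℕ) : ℝ :=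
  1 + (1 + P * (4 * Real.exp 4 + 2)) *
    (P * ((2 * P).factorial * Real.exp (1 + (4 * Real.exp 4 + 2)) * (2 * Real.exp 4)))

/-- Comparison of the equilibrium and conditioned moments. -/
theorem abs_momentEq_sub_momentCond_le (hd : 1 ≤ d) (hε : 0 < ε) (hκ : 6 * 2 ^ d * ε ≤ 1)
    {τ Θ : ℝ} {P : ℕ} (hP : 0 < P) {θ : Fin P → ℝ}
    (hU : NullMeasurableSet (conditioning d ε τ θ) (eqMeasure d ε))
    (hUb : (eqMeasure d ε).real (conditioning d ε τ θ)ᶜ ≤ Θ * ε ^ d) (hΘ : 1 ≤ Θ)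
    (hΘε : Θ * ε ≤ 1) (hθ : ∀ i, 0 ≤ θ i) {h : Fin P → Particle d → ℝ}
    (hh : ∀ i, MemLp (h i) ⊤ volume) :
    Integrable (fun Z => ∏ i, zetaEq ε (θ i) (h i) Z) (eqMeasure d ε) ∧
    Integrable (fun Z => ∏ i, zetaCond ε τ θ (θ i) (h i) Z) (condMeasure d ε τ θ) ∧
    |momentEq ε θ h - momentCond ε τ θ h| ≤
      (∏ i, supNorm (h i)) * (comparisonConst P * Real.sqrt (Θ * ε ^ d)) := by
  have := isProbabilityMeasure_eqMeasure (d := d) hε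
  have hS : ∀ i, 0 ≤ supNorm (h i) := fun i => ENNReal.toReal_nonneg
  have hε1 : ε ≤ 1 := by nlinarith
  set b := Real.sqrt (Θ * ε ^ d) with hb
  have hb0 : 0 < b := Real.sqrt_pos.2 (by positivity)
  have hbb : b ^ 2 = Θ * ε ^ d := Real.sq_sqrt (by positivity)
  have hb1 : b ≤ 1 := by
    refine Real.sqrt_le_one.2 (le_trans ?_ hΘε)
    gcongr
    exact pow_le_of_le_one hε.le hε1 (by omega)
  have key : ∀ η, 0 < η →
      Integrable (fun Z => ∏ i, zetaEq ε (θ i) (h i) Z) (eqMeasure d ε) ∧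
      Integrable (fun Z => ∏ i, zetaCond ε τ θ (θ i) (h i) Z) (condMeasure d ε τ θ) ∧
      |momentEq ε θ h - momentCond ε τ θ h| ≤
        (∏ i, (supNorm (h i) + η)) * (comparisonConst P * b) := by
    intro η hη
    -- The fields are normalised by positive numbers, η making division possible when some h i
    -- vanishes; η tends to 0 at the end.
    set H : Fin P → ℝ := fun i => supNorm (h i) + η with hH
    have hH0 : ∀ i, 0 < H i := fun i => by have := hS i; simp only [hH]; linarith
    have hSH : ∀ i, supNorm (h i) ≤ H i := fun i => by simp only [hH]; linarith
    have hexp := fun i => zetaEq_exp hd hε hκ (hh i) (hSH i) (hH0 i) (hθ i)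
    choose c hc hce using fun i =>
      exists_zetaCond_eq hd hε hκ hU hUb hΘ hΘε (hh i) (hSH i) (hH0 i) (hθ i)
    have habs : ∀ i Z, |zetaEq ε (θ i) (h i) Z / H i| = |zetaEq ε (θ i) (h i) Z| / H i :=
      fun i Z => by rw [abs_div, abs_of_pos (hH0 i)]
    obtain ⟨i1, i2, h3⟩ := abs_integral_prod_sub_le (m := eqMeasure d ε) hU hP hb0 hb1
      (c := 4 * Real.exp 4 + 2) (K := 2 * Real.exp 4) (by positivity) (by rw [hbb]; exact hUb)
      (y := fun i Z => zetaEq ε (θ i) (h i) Z / H i) (s := fun i => c i / H i)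
      (fun i => (hexp i).1.aemeasurable.div_const (H i) |>.aestronglyMeasurable)
      (fun i => by simp only [habs]; exact (hexp i).2.1)
      (fun i => by simp only [habs]; exact (hexp i).2.2.1)
      (fun i => by
        rw [abs_div, abs_of_pos (hH0 i), div_le_iff₀ (hH0 i)]
        exact hc i)
    have e1 : ∀ Z, ∏ i, zetaEq ε (θ i) (h i) Z =
        (∏ i, H i) * ∏ i, zetaEq ε (θ i) (h i) Z / H i := fun Z => by
      rw [← Finset.prod_mul_distrib]
      exact Finset.prod_congr rfl fun i _ => by have := (hH0 i).ne'; field_simp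
    have e2 : ∀ Z, ∏ i, zetaCond ε τ θ (θ i) (h i) Z =
        (∏ i, H i) * ∏ i, (zetaEq ε (θ i) (h i) Z / H i + c i / H i) := fun Z => by
      rw [← Finset.prod_mul_distrib]
      exact Finset.prod_congr rfl fun i _ => by
        have := (hH0 i).ne'
        rw [hce]
        field_simp
    have hHp : 0 < ∏ i, H i := Finset.prod_pos fun i _ => hH0 i
    refine ⟨?_, ?_, ?_⟩
    · simp only [e1]
      exact i1.const_mul _
    · simp only [e2]
      exact i2.const_mul _
    · rw [momentEq, momentCond]
      simp only [e1, e2]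
      rw [integral_const_mul, integral_const_mul, ← mul_sub, abs_mul, abs_of_pos hHp]
      exact mul_le_mul_of_nonneg_left h3 hHp.le
  exact ⟨(key 1 one_pos).1, (key 1 one_pos).2.1,
    le_prod_mul_of_forall_pos fun η hη => (key η hη).2.2⟩

end Comparison

/-! ### Asymptotic regimes of τ and Θ. -/

section Final

variable {d : ℕ}

lemma one_sub_one_div_pos (hd : 2 ≤ d) : 0 < 1 - 1 / (2 * (d : ℝ)) := by
  have : (2 : ℝ) ≤ d := by exact_mod_cast hd
  rw [sub_pos, div_lt_one (by positivity)]
  linarith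

/-- The asymptotic regime of the moment bounds. -/
lemma eventually_regime_of_isBigO {τ Θ : ℝ → ℝ}
    (h0 : ∀ᶠ ε in 𝓝[>] (0 : ℝ), 0 < τ ε ∧ 1 ≤ Θ ε)
    (h1 : Tendsto (fun ε => delta d ε / τ ε) (𝓝[>] (0 : ℝ)) (𝓝 0))
    (h2 : Asymptotics.IsBigO (𝓝[>] (0 : ℝ)) Θ
      (fun ε => Real.log (Real.log |Real.log ε|))) :
    ∀ᶠ ε in 𝓝[>] (0 : ℝ), delta d ε ≤ τ ε ∧ Θ ε * ε ≤ 1 := by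
  obtain ⟨C, hC⟩ := h2.bound
  filter_upwards [h0, h1.eventually (gt_mem_nhds one_pos), hC, self_mem_nhdsWithin,
    tendsto_abs_log.eventually_ge_atTop (Real.exp 1),
    eventually_abs_log_mul_rpow_le (s := 1) (C := |C|) one_pos] with ε ⟨hτ, hΘ⟩ h3 h4 hε h5 h6
  have hε : 0 < ε := hε
  constructor
  · rw [div_lt_one hτ] at h3
    exact h3.le
  · set L := |Real.log ε|
    have hL : 0 < L := (Real.exp_pos 1).trans_le h5
    have hl1 : 1 ≤ Real.log L := (Real.le_log_iff_exp_le hL).2 h5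
    -- The iterated logarithm is crudely replaced by L = |log ε|, because L ε → 0 is all that Θ ε ≤
    -- 1 requires.
    have hl2 : Real.log (Real.log L) ≤ L :=
      (Real.log_le_self (by linarith)).trans (Real.log_le_self hL.le)
    rw [Real.norm_eq_abs, Real.norm_eq_abs, abs_of_nonneg (Real.log_nonneg hl1),
      abs_of_pos (by linarith : 0 < Θ ε)] at h4
    rw [Real.rpow_one] at h6
    have h7 : Θ ε ≤ |C| * L := by
      refine h4.trans (mul_le_mul (le_abs_self C) hl2 (Real.log_nonneg hl1) (abs_nonneg C))
    calc Θ ε * ε ≤ |C| * L * ε := by gcongr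
      _ = |C| * (L * ε) := by ring
      _ ≤ 1 := h6

/-- The asymptotic regime of the comparison of moments. -/
lemma eventually_regime_of_tendsto (hd : 2 ≤ d) {τ Θ : ℝ → ℝ} {n : ℕ}
    (h0 : ∀ᶠ ε in 𝓝[>] (0 : ℝ), 0 < τ ε ∧ 1 ≤ Θ ε)
    (h1 : Tendsto (fun ε => Θ ε ^ n * τ ε) (𝓝[>] (0 : ℝ)) (𝓝 0))
    (h2 : Tendsto (fun ε => Θ ε / (τ ε * Real.log |Real.log ε|)) (𝓝[>] (0 : ℝ)) (𝓝 0)) :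
    ∀ᶠ ε in 𝓝[>] (0 : ℝ), delta d ε ≤ τ ε ∧ Θ ε * ε ≤ 1 := by
  filter_upwards [h0, h1.eventually (gt_mem_nhds one_pos), h2.eventually (gt_mem_nhds one_pos),
    self_mem_nhdsWithin, tendsto_abs_log.eventually_ge_atTop (Real.exp 1),
    eventually_abs_log_mul_rpow_le (s := 1) (C := 1) one_pos,
    eventually_abs_log_mul_rpow_le (C := 1) (one_sub_one_div_pos hd)]
    with ε ⟨hτ, hΘ⟩ h3 h4 hε h5 h6 h7
  have hε : 0 < ε := hε
  rw [Real.rpow_one, one_mul] at h6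
  rw [one_mul] at h7
  set L := |Real.log ε|
  have hL : 0 < L := (Real.exp_pos 1).trans_le h5
  have hl1 : 1 ≤ Real.log L := (Real.le_log_iff_exp_le hL).2 h5
  have hl2 : Real.log L ≤ L := Real.log_le_self hL.le
  rw [div_lt_one (by positivity)] at h4
  -- From Θ ≥ 1 come τ ≤ Θ^n τ < 1 and 1 ≤ Θ ≤ τ L. Hence L δ ≤ 1 ≤ L τ gives δ ≤ τ, and Θ ≤ L gives
  -- Θ ε ≤ 1.
  have hτ1 : τ ε ≤ 1 := (le_mul_of_one_le_left hτ.le (one_le_pow₀ hΘ)).trans h3.le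
  have h8 : Θ ε ≤ τ ε * L := h4.le.trans (by gcongr)
  constructor
  · have h9 : L * delta d ε ≤ L * τ ε := by
      have : L * delta d ε ≤ 1 := h7
      linarith
    exact le_of_mul_le_mul_left h9 hL
  · have h9 : τ ε * L ≤ L := mul_le_of_le_one_left hL.le hτ1
    calc Θ ε * ε ≤ L * ε := by gcongr; exact h8.trans h9
      _ ≤ 1 := h6

end Final

end HardSphere

end

theorem proposition2p2 :
    -- moments of the equilibrium field and of the conditioned field, real exponents `p ≥ 1`
    (∀ p : ℝ, 1 ≤ p → ∃ C : ℝ, 0 < C ∧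
      (∀ d : ℕ, 2 ≤ d → ∀ᶠ ε in 𝓝[>] (0 : ℝ),
        ∀ h : HardSphere.Particle d → ℝ, MemLp h ⊤ volume → ∀ t : ℝ, 0 ≤ t →
          Integrable (fun Z => |HardSphere.zetaEq ε t h Z| ^ p) (HardSphere.eqMeasure d ε) ∧
          ∫ Z, |HardSphere.zetaEq ε t h Z| ^ p ∂(HardSphere.eqMeasure d ε)
            ≤ C * HardSphere.supNorm h ^ p ∧
          ∀ n : ℕ, (n : ℝ) = p →
            Integrable (fun Z => HardSphere.zetaEq ε t h Z ^ n) (HardSphere.eqMeasure d ε) ∧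
            |∫ Z, HardSphere.zetaEq ε t h Z ^ n ∂(HardSphere.eqMeasure d ε)|
              ≤ C * HardSphere.supNorm h ^ n) ∧
      (∀ d : ℕ, 2 ≤ d → ∀ P : ℕ, 2 ≤ P → ∀ τ Θ : ℝ → ℝ,
        (∀ᶠ ε in 𝓝[>] (0 : ℝ), 0 < τ ε ∧ 1 ≤ Θ ε) →
        Tendsto (fun ε => HardSphere.delta d ε / τ ε) (𝓝[>] (0 : ℝ)) (𝓝 0) →
        Tendsto τ (𝓝[>] (0 : ℝ)) (𝓝 0) →
        Asymptotics.IsBigO (𝓝[>] (0 : ℝ)) Θ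
          (fun ε => Real.log (Real.log |Real.log ε|)) →
        ∀ᶠ ε in 𝓝[>] (0 : ℝ),
          ∀ θ : Fin P → ℝ, Monotone θ → (∀ i, θ i ∈ Set.Icc 0 (Θ ε)) →
          ∀ h : HardSphere.Particle d → ℝ, MemLp h ⊤ volume → ∀ t : ℝ, 0 ≤ t →
            Integrable (fun Z => |HardSphere.zetaCond ε (τ ε) θ t h Z| ^ p)
              (HardSphere.condMeasure d ε (τ ε) θ) ∧
            ∫ Z, |HardSphere.zetaCond ε (τ ε) θ t h Z| ^ p
                ∂(HardSphere.condMeasure d ε (τ ε) θ)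
              ≤ C * HardSphere.supNorm h ^ p ∧
            ∀ n : ℕ, (n : ℝ) = p →
              Integrable (fun Z => HardSphere.zetaCond ε (τ ε) θ t h Z ^ n)
                (HardSphere.condMeasure d ε (τ ε) θ) ∧
              |∫ Z, HardSphere.zetaCond ε (τ ε) θ t h Z ^ n
                  ∂(HardSphere.condMeasure d ε (τ ε) θ)|
                ≤ C * HardSphere.supNorm h ^ n)) ∧
    -- comparison of the conditioned and equilibrium `P`-point moments
    (∀ P : ℕ, 2 ≤ P → ∃ C : ℝ, 0 < C ∧
      ∀ d : ℕ, 2 ≤ d → ∀ τ Θ : ℝ → ℝ,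
        (∀ᶠ ε in 𝓝[>] (0 : ℝ), 0 < τ ε ∧ 1 ≤ Θ ε) →
        Tendsto (fun ε => Θ ε ^ (3 * (P - 1)) * τ ε) (𝓝[>] (0 : ℝ)) (𝓝 0) →
        Tendsto (fun ε => Θ ε / (τ ε * Real.log |Real.log ε|)) (𝓝[>] (0 : ℝ)) (𝓝 0) →
        ∀ᶠ ε in 𝓝[>] (0 : ℝ),
          ∀ θ : Fin P → ℝ, Monotone θ → (∀ i, θ i ∈ Set.Icc 0 (Θ ε)) →
          ∀ h : Fin P → HardSphere.Particle d → ℝ, (∀ i, MemLp (h i) ⊤ volume) →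
            Integrable (fun Z => ∏ i, HardSphere.zetaEq ε (θ i) (h i) Z)
              (HardSphere.eqMeasure d ε) ∧
            Integrable (fun Z => ∏ i, HardSphere.zetaCond ε (τ ε) θ (θ i) (h i) Z)
              (HardSphere.condMeasure d ε (τ ε) θ) ∧
            |HardSphere.momentEq ε θ h - HardSphere.momentCond ε (τ ε) θ h|
              ≤ (∏ i, HardSphere.supNorm (h i)) * (C * Real.sqrt (Θ ε * ε ^ d))) := by
  refine ⟨fun p hp => ?_, fun P hP => ?_⟩
  · have hpp : 0 < p ^ p := Real.rpow_pos_of_pos (by linarith) _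
    -- The constant of the conditioned field exceeds that of the equilibrium field and serves for
    -- both; it depends on p alone.
    refine ⟨p ^ p * (Real.exp (4 * Real.exp 4 + 2) * (2 * Real.exp 4)), by positivity,
      fun d hd => ?_, fun d hd P _ τ Θ h0 h1 _ h2 => ?_⟩
    · filter_upwards [HardSphere.eventually_small d] with ε ⟨hε, hκ⟩ h hh t ht
      obtain ⟨hm, hi, hb⟩ := HardSphere.zetaEq_moments hp (by omega) hε hκ hh ht
      have hS : 0 ≤ HardSphere.supNorm h := ENNReal.toReal_nonneg
      have hb' : ∫ Z, |HardSphere.zetaEq ε t h Z| ^ p ∂(HardSphere.eqMeasure d ε) ≤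
          p ^ p * (Real.exp (4 * Real.exp 4 + 2) * (2 * Real.exp 4)) *
            HardSphere.supNorm h ^ p := by
        have h1 : 2 * Real.exp 4 ≤ Real.exp (4 * Real.exp 4 + 2) * (2 * Real.exp 4) :=
          le_mul_of_one_le_left (by positivity) (Real.one_le_exp (by positivity))
        exact hb.trans (mul_le_mul_of_nonneg_right (mul_le_mul_of_nonneg_left h1 hpp.le)
          (Real.rpow_nonneg hS p))
      refine ⟨hi, hb', fun n hn => ?_⟩
      have := HardSphere.integer_moments_of_abs hm hi hb' hn
      rwa [← Real.rpow_natCast (HardSphere.supNorm h) n, hn]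
    · filter_upwards [HardSphere.eventually_small d, h0,
        HardSphere.eventually_regime_of_isBigO h0 h1 h2,
        HardSphere.eventually_conditioning (d := d) (by omega) P]
        with ε ⟨hε, hκ⟩ ⟨hτ, hΘ⟩ ⟨hδ, hΘε⟩ hcond θ _ hθ h hh t ht
      obtain ⟨hU, hUb⟩ := hcond (τ ε) (Θ ε) hτ hδ (by linarith) θ hθ
      obtain ⟨hm, hi, hb⟩ :=
        HardSphere.zetaCond_moments hp (by omega) hε hκ hU hUb hΘ hΘε hh ht
      refine ⟨hi, hb, fun n hn => ?_⟩
      have := HardSphere.integer_moments_of_abs hm hi hb hn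
      rwa [← Real.rpow_natCast (HardSphere.supNorm h) n, hn]
  · refine ⟨HardSphere.comparisonConst P, ?_, fun d hd τ Θ h0 h1 h2 => ?_⟩
    · unfold HardSphere.comparisonConst
      positivity
    · filter_upwards [HardSphere.eventually_small d, h0,
        HardSphere.eventually_regime_of_tendsto hd h0 h1 h2,
        HardSphere.eventually_conditioning (d := d) (by omega) P]
        with ε ⟨hε, hκ⟩ ⟨hτ, hΘ⟩ ⟨hδ, hΘε⟩ hcond θ _ hθ h hh
      obtain ⟨hU, hUb⟩ := hcond (τ ε) (Θ ε) hτ hδ (by linarith) θ hθ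
      exact HardSphere.abs_momentEq_sub_momentCond_le (by omega) hε hκ (by omega) hU hUb hΘ hΘε
        (fun i => (hθ i).1) hh
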